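/- Let $n\ge 0$, $T>0$, let $(\cdot,\cdot)$ be the standard Hermitian inner product (linear in the first argument), let $J(x,y)=(-y,x)$ on $\mathbf C^{2n}=\mathbf C^n\oplus\mathbf C^n$, $\omega(v,w)=(Jv,w)$, and $\mathrm{Sp}(2n,\mathbf C)=\{M : M^*JM=J\}$. For an operator $M$ let $\mathrm{Gr}(M)=\{(v,Mv)\}$. For a linear subspace $R\subset\mathbf C^{2n}$ put $$R^b=\{(x,y)\in\mathbf C^{2n} : (x,-y)\in R^{\perp}\},\qquad W(R)=\{(x,y,z,u)\in\mathbf C^{4n} : (x,-z)\in R^{\perp},\ (y,u)\in R\}.$$ *Maslov-type index.* On $\mathbf C^{4n}=\mathbf C^{2n}\oplus\mathbf C^{2n}$ consider the symplectic form $(-\omega)\oplus\omega$, given by $\mathcal J=(-J)\oplus J$. Every Lagrangian subspace is the graph $\{x+Ux : x\in X_1\}$ of a unique linear isometry $U$ from $X_1=\ker(\mathcal J-\sqrt{-1})$ onto $X_2=\ker(\mathcal J+\sqrt{-1})$. For a continuous path $\gamma:[0,T]\to\mathrm{Sp}(2n,\mathbf C)$ and a Lagrangian subspace $W$, let $\mathrm{Gr}(\gamma(t))$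 be the graph of $U(t)$ and $W$ the graph of $U'$. Then $i_W(\gamma)\in\mathbf Z$ is minus the spectral flow of the unitary operators $U'^{-1}U(t)$, $0\le t\le T$, through $1$, that is, minus the net number (with multiplicity) of eigenvalues which pass through $1$ from the lower to the upper half of the unit circle, where the point $1$ itself is counted with the upper half. Explicitly, the spectral flow is $\sum_j\bigl(k(t_{j+1},\varepsilon_j)-k(t_j,\varepsilon_j)\bigr)$ for any subdivision $0=t_0\le\dots\le t_N=T$ and any $\varepsilon_j\in(0,\pi)$ such that $e^{\sqrt{-1}\varepsilon_j}$ is not an eigenvalue of $U'^{-1}U(t)$ for $t\in[t_j,t_{j+1}]$, where $k(t,\varepsilon)$ is the number of eigenvalues of $U'^{-1}U(t)$, with multiplicity, in $\{e^{\sqrt{-1}\theta} : 0\le\theta<\varepsilon\}$. **Proposition.** Let $\gamma\in C([0,T],\mathrm{Sp}(2n,\mathbf C))$ with $\gamma(0)=I$, and let $R_1\subset R_2$ be two linear subspaces of $\mathbf C^{2n}$. Define $$\mathcal N=\{(x,y,z,u)\in\mathrm{Gr}(\gamma(T)) : (x,z)\in R_1^b,\ (y,u)\in R_2\},$$ $$Q\bigl((x_1,y_1,z_1,u_1),(x_2,y_2,z_2,u_2)\bigr)=(z_1,u_2)-(x_1,y_2)\quad\text{on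 }\mathcal N.$$ Then $Q$ is a quadratic form on $\mathcal N$ (a Hermitian sesquilinear form), the indices $i_{W(R_1)}(\gamma)$ and $i_{W(R_2)}(\gamma)$ are well defined, and $$i_{W(R_2)}(\gamma)-i_{W(R_1)}(\gamma)=C(\gamma(T);R_1,R_2)+\dim_{\mathbf C}(\mathrm{Gr}(I_n)\cap R_2^b)-\dim_{\mathbf C}(\mathrm{Gr}(I_n)\cap R_1^b),$$ where $\mathrm{Gr}(I_n)=\{(x,x) : x\in\mathbf C^n\}$ and $$C(\gamma(T);R_1,R_2)=m^-(Q)+\dim_{\mathbf C}\ker Q-\dim_{\mathbf C}(\mathrm{Gr}(\gamma(T))\cap W(R_2))$$ is the Morse concavity of $\gamma(T)$ with respect to $R_1,R_2$. Here $m^-(Q)$ is the Morse (negative) index, the largest dimension of a subspace of $\mathcal N$ on which $Q$ is negative definite, and $\ker Q=\{v\in\mathcal N : Q(v,w)=0\text{ for all }w\in\mathcal N\}$. -/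

import Mathlib

noncomputable section

/-! ### Spectral flow of a curve of unitary operators through `1` -/

section SpectralFlow

variable {X : Type*} [NormedAddCommGroup X] [InnerProductSpace ℂ X] [FiniteDimensional ℂ X]

open Classical in
/-- The number of eigenvalues of `A`, counted with algebraic multiplicity, on the arc
`{exp (iθ) : 0 ≤ θ < ε}` of the unit circle (for a unitary `A` and `0 < ε < π`).
The point `1` belongs to the arc: it lies on the non-negative side. -/
def arcCount (A : X →ₗ[ℂ] X) (ε : ℝ) : ℕ :=
  ((LinearMap.charpoly A).roots.filter (fun z => 0 ≤ z.arg ∧ z.arg < ε)).card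

/-- `m` is the spectral flow of the continuous curve `A s`, `a ≤ s ≤ b`, of unitary operators
through the interval `(1 - δ, 1 + δ)` of the real axis, cooriented from the lower to the upper
half plane: the number of spectral lines which pass from the negative (lower) to the non-negative
side minus the number of those which pass back, with multiplicities.
As usual it is computed from a subdivision of `[a, b]` and angles `ε j ∈ (0, π)` such that
`exp (i ε j)` is not in the spectrum on the `j`-th piece: on that piece
an eigenvalue can enter or leave the arc `{exp (iθ) : 0 ≤ θ < ε j}` only across `1`. -/
def IsSpectralFlow (A : ℝ → (X ≃ₗᵢ[ℂ] X)) (a b : ℝ) (m : ℤ) : Prop :=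
  ContinuousOn (fun s => ((A s).toContinuousLinearEquiv : X →L[ℂ] X)) (Set.Icc a b) ∧
  ∃ (N : ℕ) (t ε : ℕ → ℝ), t 0 = a ∧ t N = b ∧
    (∀ j < N, t j ≤ t (j + 1)) ∧
    (∀ j < N, 0 < ε j ∧ ε j < Real.pi) ∧
    (∀ j < N, ∀ s ∈ Set.Icc (t j) (t (j + 1)),
      ¬ Module.End.HasEigenvalue ((A s).toLinearEquiv : X →ₗ[ℂ] X)
        (Complex.exp ((ε j : ℂ) * Complex.I))) ∧
    m = ∑ j ∈ Finset.range N,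
      ((arcCount ((A (t (j + 1))).toLinearEquiv : X →ₗ[ℂ] X) (ε j) : ℤ)
        - (arcCount ((A (t j)).toLinearEquiv : X →ₗ[ℂ] X) (ε j) : ℤ))

end SpectralFlow

/-! ### The Maslov index

The symplectic form is `ω x y = (J x, y)` with `J* = -J` and `J² = -1`. A Lagrangian subspace is
the graph of a unique isometry from `ker (J - i)` onto `ker (J + i)`. -/

section Maslov

variable {X : Type*} [NormedAddCommGroup X] [InnerProductSpace ℂ X]

/-- The space `X₁ = ker (J - i)`. -/
abbrev posEig (J : X →ₗ[ℂ] X) : Submodule ℂ X := LinearMap.ker (J - Complex.I • LinearMap.id)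

/-- The space `X₂ = ker (J + i)`. -/
abbrev negEig (J : X →ₗ[ℂ] X) : Submodule ℂ X := LinearMap.ker (J + Complex.I • LinearMap.id)

/-- The subspace `{x + U x : x ∈ X₁}` of `X`. -/
def isometryGraph (J : X →ₗ[ℂ] X) (U : posEig J ≃ₗᵢ[ℂ] negEig J) : Submodule ℂ X :=
  LinearMap.range ((posEig J).subtype + (negEig J).subtype ∘ₗ
    (U.toLinearEquiv : posEig J →ₗ[ℂ] negEig J))

/-- `m` is the Maslov index of the pair of curves of Lagrangian subspaces `Λ s`, `Λ' s`,
`a ≤ s ≤ b`: if they are the graphs of `U s` and `U' s`, then `m` is minus the spectral flow of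
`(U' s)⁻¹ (U s)` through `1`. -/
def IsMaslovIndex [FiniteDimensional ℂ X] (J : X →ₗ[ℂ] X) (Λ Λ' : ℝ → Submodule ℂ X)
    (a b : ℝ) (m : ℤ) : Prop :=
  ∃ U U' : ℝ → (posEig J ≃ₗᵢ[ℂ] negEig J),
    (∀ s ∈ Set.Icc a b, Λ s = isometryGraph J (U s)) ∧
    (∀ s ∈ Set.Icc a b, Λ' s = isometryGraph J (U' s)) ∧
    IsSpectralFlow (fun s => (U s).trans (U' s).symm) a b (-m)

end Maslov

/-! ### The spaces `ℂⁿ`, `ℂ²ⁿ`, `ℂ⁴ⁿ` and symplectic maps -/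

/-- `ℂⁿ` with its standard Hermitian inner product. -/
abbrev Cn (n : ℕ) : Type := EuclideanSpace ℂ (Fin n)

/-- `ℂ²ⁿ`, the pairs `(x, y)` of vectors in `ℂⁿ`. -/
abbrev C2n (n : ℕ) : Type := WithLp 2 (Cn n × Cn n)

/-- `ℂ⁴ⁿ = ℂ²ⁿ ⊕ ℂ²ⁿ`; the vector `(x, y, z, u)` is the pair of `(x, y)` and `(z, u)`. -/
abbrev C4n (n : ℕ) : Type := WithLp 2 (C2n n × C2n n)

/-- `J (x, y) = (-y, x)`. -/
def stdJ (n : ℕ) : C2n n →ₗ[ℂ] C2n n where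
  toFun v := WithLp.toLp 2 (-v.snd, v.fst)
  map_add' v w := by
    apply (WithLp.equiv 2 _).injective
    ext <;> simp [add_comm]
  map_smul' c v := by
    apply (WithLp.equiv 2 _).injective
    ext <;> simp

/-- The operator `(-J) ⊕ J` on `ℂ⁴ⁿ = ℂ²ⁿ ⊕ ℂ²ⁿ`, which gives the form `(-ω) ⊕ ω`. -/
def dblJ (n : ℕ) : C4n n →ₗ[ℂ] C4n n where
  toFun v := WithLp.toLp 2 (-(stdJ n v.fst), stdJ n v.snd)
  map_add' v w := by
    apply (WithLp.equiv 2 _).injective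
    ext <;> simp [add_comm]
  map_smul' c v := by
    apply (WithLp.equiv 2 _).injective
    ext <;> simp

/-- `Sp(2n, ℂ)`: the operators `M` on `ℂ²ⁿ` with `(J M v, M w) = (J v, w)`, that is
`M* J M = J` where `*` is the conjugate transpose. -/
def SpC (n : ℕ) : Set (C2n n →L[ℂ] C2n n) :=
  {M | ∀ v w : C2n n, inner ℂ (M w) (stdJ n (M v)) = inner ℂ w (stdJ n v)}

/-- The graph `{(v, M v)}` of an operator. -/
def Gr {E : Type*} [NormedAddCommGroup E] [NormedSpace ℂ E] (M : E →L[ℂ] E) :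
    Submodule ℂ (WithLp 2 (E × E)) where
  carrier := {v | v.snd = M v.fst}
  add_mem' := by
    intro v w hv hw
    rw [Set.mem_ofPred_eq] at hv hw ⊢
    simp [hv, hw]
  zero_mem' := by simp
  smul_mem' := by
    intro c v hv
    rw [Set.mem_ofPred_eq] at hv ⊢
    simp [hv]

/-- `Rᵇ = {(x, y) ∈ ℂ²ⁿ : (x, -y) ∈ R^⊥}`. -/
def flatSub {n : ℕ} (R : Submodule ℂ (C2n n)) : Submodule ℂ (C2n n) where
  carrier := {v | WithLp.toLp 2 (v.fst, -v.snd) ∈ Rᗮ}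
  add_mem' := by
    intro v w hv hw
    rw [Set.mem_ofPred_eq] at hv hw ⊢
    have h := Rᗮ.add_mem hv hw
    rw [← WithLp.toLp_add, Prod.mk_add_mk] at h
    simpa [add_comm] using h
  zero_mem' := by
    have h : WithLp.toLp 2 ((0 : Cn n), (0 : Cn n)) = (0 : C2n n) := rfl
    simp [h]
  smul_mem' := by
    intro c v hv
    rw [Set.mem_ofPred_eq] at hv ⊢
    have h := Rᗮ.smul_mem c hv
    rw [← WithLp.toLp_smul, Prod.smul_mk] at h
    simpa using h

/-- The linear map `(x, y, z, u) ↦ (x, z)`. -/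
def projXZ (n : ℕ) : C4n n →ₗ[ℂ] C2n n where
  toFun v := WithLp.toLp 2 (v.fst.fst, v.snd.fst)
  map_add' _ _ := rfl
  map_smul' _ _ := rfl

/-- The linear map `(x, y, z, u) ↦ (y, u)`. -/
def projYU (n : ℕ) : C4n n →ₗ[ℂ] C2n n where
  toFun v := WithLp.toLp 2 (v.fst.snd, v.snd.snd)
  map_add' _ _ := rfl
  map_smul' _ _ := rfl

/-- `W(R) = {(x, y, z, u) ∈ ℂ⁴ⁿ : (x, -z) ∈ R^⊥, (y, u) ∈ R}`, where `(x, -z) ∈ R^⊥` means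
`(x, z) ∈ Rᵇ`. -/
def WR {n : ℕ} (R : Submodule ℂ (C2n n)) : Submodule ℂ (C4n n) :=
  (flatSub R).comap (projXZ n) ⊓ R.comap (projYU n)

/-- `m` is the Maslov-type index `i_W(γ)` of the path `γ t`, `0 ≤ t ≤ T`: the Maslov index of the
curve `Gr (γ t)` with respect to the constant curve `W` in `(ℂ⁴ⁿ, (-ω) ⊕ ω)`. -/
def IsMaslovTypeIndex {n : ℕ} (W : Submodule ℂ (C4n n)) (T : ℝ)
    (γ : ℝ → (C2n n →L[ℂ] C2n n)) (m : ℤ) : Prop :=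
  IsMaslovIndex (dblJ n) (fun t => Gr (γ t)) (fun _ => W) 0 T m

open Classical in
/-- The Maslov-type index `i_W(γ)`. -/
def maslovTypeIndex {n : ℕ} (W : Submodule ℂ (C4n n)) (T : ℝ)
    (γ : ℝ → (C2n n →L[ℂ] C2n n)) : ℤ :=
  if h : ∃ m, IsMaslovTypeIndex W T γ m then h.choose else 0

/-! ### The form `Q` and the Morse concavity -/

/-- The form `((x₁, y₁, z₁, u₁), (x₂, y₂, z₂, u₂)) ↦ (z₁, u₂) - (x₁, y₂)` on `ℂ⁴ⁿ`, linear in the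
first and conjugate linear in the second argument; `(a, b)` is `inner ℂ b a` in Mathlib. -/
def formQ (n : ℕ) : C4n n →ₗ[ℂ] C4n n →ₗ⋆[ℂ] ℂ :=
  LinearMap.mk₂'ₛₗ (RingHom.id ℂ) (starRingEnd ℂ)
    (fun v w => inner ℂ w.snd.snd v.snd.fst - inner ℂ w.fst.snd v.fst.fst)
    (by intro v₁ v₂ w; simp; ring)
    (by intro c v w; simp; ring)
    (by intro v w₁ w₂; simp; ring)
    (by intro c v w; simp; ring)

/-- `𝒩 = {(x, y, z, u) ∈ Gr(M) : (x, z) ∈ R₁ᵇ, (y, u) ∈ R₂}`. -/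
def spaceN {n : ℕ} (M : C2n n →L[ℂ] C2n n) (R₁ R₂ : Submodule ℂ (C2n n)) :
    Submodule ℂ (C4n n) :=
  Gr M ⊓ (flatSub R₁).comap (projXZ n) ⊓ R₂.comap (projYU n)

/-- The restriction `Q` of the form to `𝒩`. -/
def formQN {n : ℕ} (M : C2n n →L[ℂ] C2n n) (R₁ R₂ : Submodule ℂ (C2n n)) :
    spaceN M R₁ R₂ →ₗ[ℂ] spaceN M R₁ R₂ →ₗ⋆[ℂ] ℂ :=
  (formQ n).domRestrict₁₂ (spaceN M R₁ R₂) (spaceN M R₁ R₂)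

/-- The Morse (negative) index `m⁻(B)` of a Hermitian form on a finite dimensional space: the
largest dimension of a subspace on which `B` is negative definite. -/
def morseIndex {N : Type*} [AddCommGroup N] [Module ℂ N] (B : N →ₗ[ℂ] N →ₗ⋆[ℂ] ℂ) : ℕ :=
  sSup {d | ∃ S : Submodule ℂ N, Module.finrank ℂ S = d ∧ ∀ v ∈ S, v ≠ 0 → (B v v).re < 0}

/-- The Morse concavity
`C(M; R₁, R₂) = m⁻(Q) + dim ker Q - dim (Gr(M) ∩ W(R₂))`. -/
def morseConcavity {n : ℕ} (M : C2n n →L[ℂ] C2n n) (R₁ R₂ : Submodule ℂ (C2n n)) : ℤ :=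
  (morseIndex (formQN M R₁ R₂) : ℤ)
    + (Module.finrank ℂ (LinearMap.ker (formQN M R₁ R₂)) : ℤ)
    - (Module.finrank ℂ ↥(Gr M ⊓ WR R₂) : ℤ)

end

/-! In the coordinates a = (y, u), b = (x, -z) of ℂ⁴ⁿ the operator (-J) ⊕ J is (a, b) ↦ (-b, a). A
Lagrangian subspace is then encoded by the unitary operator a + ib ↦ a - ib of ℂ²ⁿ (`IsCayley`). To
W(R) belongs the reflection ρ_R that fixes R (`isCayley_WR`), to Gr(γ(t)) a continuous curve u(t),
and i_{W(R)}(γ) is minus the spectral flow of ρ_R u(t) (`isMaslovTypeIndex_iff`).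

Let Θ(A) be the sum of the angles in [0, 2π) of the eigenvalues of A. A continuous argument of det
A(t) changes by the change of Θ plus 2π times the spectral flow (`IsSpectralFlow.angle_lift`). Since
ρ_{R₁}u and ρ_{R₂}u have determinants with constant ratio, 2π(i_{W(R₂)} - i_{W(R₁)}) = c(T) - c(0),
where c = Θ(ρ_{R₂}u) - Θ(ρ_{R₁}u): only the end points matter.

Put D = R₂ ∩ R₁^⊥ and A = ρ_{R₁}u; then ρ_{R₂}u = ρA, where ρ is the reflection in D^⊥. The core is
the computation of Θ(ρA) - Θ(A) (`angleSum_reflection_sub`). If 1 is an eigenvalue of neither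
operator, it is π times the signature on D of the form with weight cot(θ/2) on the eigenvectors of
angle θ: follow the arguments in det(1 - rρA) = det(1 - rA) det(C*(1 + rA)(1 - rA)⁻¹C), C the
inclusion of D, from r = 0 to r = 1 (`sum_posAngle_reflection_diagonal`). In general, first rotate
by a small e^{iδ}, δ > 0. The weight tends to +∞ where θ = 0, so the part of D that is not
orthogonal to ker(A - 1) contributes positive directions only.

Finally v ↦ a + ib identifies Gr(M) with ℂ²ⁿ, carries 𝒩 onto {h : Ah - h ∈ D}, and gives Im⟪h, Ah⟫ =
-2Q(v, v). With ker Q = Gr(M) ∩ W(R₁) + Gr(M) ∩ W(R₂) (`map_ker_formQN`), dimension counting yields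
c = π(2C - dim D) (`angleSum_sub_eq_morseConcavity`). At t = 0 the form vanishes and C is a
difference of two dimensions (`morseConcavity_id`). -/

noncomputable section

set_option linter.unusedSectionVars false

open Polynomial Filter Topology

/-! ### Continuous dependence of the roots of a polynomial -/

section Roots

lemma exists_roots_eq_map {N : ℕ} {p : ℂ[X]} (hN : p.natDegree = N) :
    ∃ w : Fin N → ℂ, p.roots = Finset.univ.val.map w := by
  have hc : p.roots.toList.length = N := by
    rw [Multiset.length_toList, IsAlgClosed.card_roots_eq_natDegree, hN]
  subst hc
  refine ⟨fun i => p.roots.toList.get i, ?_⟩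
  rw [Fin.univ_val_map, List.ofFn_get, Multiset.coe_toList]

lemma eval_eq_prod_of_roots {N : ℕ} {p : ℂ[X]} (hm : p.Monic) {w : Fin N → ℂ}
    (hw : p.roots = Finset.univ.val.map w) (z : ℂ) : p.eval z = ∏ k, (z - w k) := by
  have h := (IsAlgClosed.splits p).eq_prod_roots_of_monic hm
  rw [h, hw, eval_multiset_prod, Multiset.map_map, Multiset.map_map]
  simp only [Function.comp_def, eval_sub, eval_X, eval_C]
  rfl

/-- Symmetric sums of a function over the roots of a monic polynomial depend continuously on the
polynomial, wherever the function is continuous at the roots. -/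
lemma tendsto_sum_map_roots {ι : Type*} {l : Filter ι} {p : ι → ℂ[X]} {q : ℂ[X]} {N : ℕ} {R : ℝ}
    (hm : ∀ i, (p i).Monic) (hN : ∀ i, (p i).natDegree = N)
    (hp : ∀ z, Tendsto (fun i => (p i).eval z) l (𝓝 (q.eval z)))
    (hR : ∀ᶠ i in l, ∀ z ∈ (p i).roots, ‖z‖ ≤ R)
    {f : ℂ → ℝ} (hf : ∀ z ∈ q.roots, ContinuousAt f z) :
    Tendsto (fun i => ((p i).roots.map f).sum) l (𝓝 (q.roots.map f).sum) := by
  choose w hw using fun i => exists_roots_eq_map (hN i)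
  -- The roots carry no continuous numbering. Along an ultrafilter their tuples, confined to a
  -- compact polydisc, converge to some `v`; convergence of the values of the polynomials forces `v`
  -- to list the roots of `q`. Hence every ultrafilter gives the same limit.
  rw [tendsto_iff_ultrafilter]
  intro g hg
  have hmem : ∀ᶠ i in (g : Filter ι), w i ∈ Set.univ.pi fun _ : Fin N => Metric.closedBall (0 : ℂ) R := by
    filter_upwards [hg hR] with i hi
    intro k _
    rw [mem_closedBall_zero_iff]
    apply hi
    rw [hw i]
    exact Multiset.mem_map_of_mem _ (Finset.mem_univ k)
  have hK : IsCompact (Set.univ.pi fun _ : Fin N => Metric.closedBall (0 : ℂ) R) :=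
    isCompact_univ_pi fun _ => isCompact_closedBall _ _
  obtain ⟨v, -, hv⟩ := hK.ultrafilter_le_nhds (g.map w) (by
    rw [le_principal_iff]; exact hmem)
  have hv' : ∀ k, Tendsto (fun i => w i k) g (𝓝 (v k)) := fun k =>
    (tendsto_pi_nhds.1 (show Tendsto w g (𝓝 v) from hv)) k
  have hqv : q = ∏ k, (X - C (v k)) := by
    apply Polynomial.funext
    intro z
    refine tendsto_nhds_unique ((hp z).mono_left hg) ?_
    have : Tendsto (fun i => ∏ k, (z - w i k)) g (𝓝 (∏ k, (z - v k))) :=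
      tendsto_finsetProd _ fun k _ => (hv' k).const_sub z
    simpa [eval_prod, fun i => eval_eq_prod_of_roots (hm i) (hw i) z] using this
  have hqr : q.roots = Finset.univ.val.map v := by
    have := roots_multiset_prod_X_sub_C (Finset.univ.val.map v)
    rw [Multiset.map_map] at this
    rw [hqv, ← this]
    rfl
  have hs : Tendsto (fun i => ∑ k, f (w i k)) g (𝓝 (∑ k, f (v k))) := by
    refine tendsto_finsetSum _ fun k _ => ?_
    refine Tendsto.comp (hf (v k) ?_) (hv' k)
    rw [hqr]
    exact Multiset.mem_map_of_mem _ (Finset.mem_univ k)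
  simp only [hqr, hw, Multiset.map_map]
  exact hs

lemma exp_sum_map_mul_I {s : Multiset ℂ} {f : ℂ → ℝ}
    (h : ∀ z ∈ s, Complex.exp (f z * Complex.I) = z) :
    Complex.exp ((s.map f).sum * Complex.I) = s.prod := by
  induction s using Multiset.induction_on with
  | empty => simp
  | cons a s ih =>
    rw [Multiset.map_cons, Multiset.sum_cons, Multiset.prod_cons,
      ← ih fun z hz => h z (Multiset.mem_cons_of_mem hz)]
    conv_rhs => rw [← h a (Multiset.mem_cons_self a s)]
    rw [← Complex.exp_add]
    push_cast
    ring_nf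

end Roots

/-! ### Two branches of the argument on the unit circle -/

section Angle

open Real in
/-- The argument of a complex number in `[0, 2π)`. -/
def posAngle (z : ℂ) : ℝ := if z.arg < 0 then z.arg + 2 * π else z.arg

open Real in
/-- The argument of a complex number in `(ε, ε + 2π]`. -/
def shiftAngle (ε : ℝ) (z : ℂ) : ℝ :=
  (-(z * Complex.exp (-(ε * Complex.I)))).arg + π + ε

open Real

lemma exp_arg_of_norm_one {z : ℂ} (hz : ‖z‖ = 1) : Complex.exp (z.arg * Complex.I) = z := by
  have h := Complex.norm_mul_exp_arg_mul_I z
  simpa [hz] using h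

lemma exp_posAngle {z : ℂ} (hz : ‖z‖ = 1) : Complex.exp (posAngle z * Complex.I) = z := by
  unfold posAngle
  split_ifs
  · push_cast
    rw [add_mul, Complex.exp_add, exp_arg_of_norm_one hz, Complex.exp_two_pi_mul_I, mul_one]
  · exact exp_arg_of_norm_one hz

lemma posAngle_nonneg (z : ℂ) : 0 ≤ posAngle z := by
  unfold posAngle
  split_ifs with h
  · linarith [Complex.neg_pi_lt_arg z, Real.pi_pos]
  · linarith

lemma posAngle_lt (z : ℂ) : posAngle z < 2 * π := by
  unfold posAngle
  split_ifs with h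
  · linarith
  · linarith [Complex.arg_le_pi z, Real.pi_pos]

lemma arg_exp_of_mem {x : ℝ} (h1 : -π < x) (h2 : x ≤ π) :
    (Complex.exp (x * Complex.I)).arg = x := by
  rw [Complex.arg_exp_mul_I, toIocMod_eq_self]
  constructor <;> linarith

lemma posAngle_exp {x : ℝ} (h1 : 0 ≤ x) (h2 : x < 2 * π) :
    posAngle (Complex.exp (x * Complex.I)) = x := by
  unfold posAngle
  rcases le_or_gt x π with h | h
  · rw [arg_exp_of_mem (by linarith [Real.pi_pos]) h, if_neg (by linarith)]
  · have : Complex.exp (x * Complex.I) = Complex.exp ((x - 2 * π : ℝ) * Complex.I) := by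
      push_cast
      rw [sub_mul, Complex.exp_sub, Complex.exp_two_pi_mul_I, div_one]
    rw [this, arg_exp_of_mem (by linarith) (by linarith), if_pos (by linarith)]
    ring

lemma neg_mul_exp_neg {z : ℂ} (hz : ‖z‖ = 1) (ε : ℝ) :
    -(z * Complex.exp (-(ε * Complex.I))) = Complex.exp ((z.arg - ε + π : ℝ) * Complex.I) := by
  conv_lhs => rw [← exp_arg_of_norm_one hz]
  push_cast
  rw [add_mul, Complex.exp_add, Complex.exp_pi_mul_I, sub_mul, Complex.exp_sub, Complex.exp_neg]
  ring

/-- The branches with values in [0, 2π) and (ε, ε + 2π] disagree exactly on angles in [0, ε], by one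
full turn. The end point ε is excluded because the arc is half open. -/
lemma shiftAngle_eq {z : ℂ} (hz : ‖z‖ = 1) {ε : ℝ} (h0 : 0 < ε) (h1 : ε < π)
    (hne : z ≠ Complex.exp (ε * Complex.I)) :
    shiftAngle ε z = posAngle z + 2 * π * if 0 ≤ z.arg ∧ z.arg < ε then 1 else 0 := by
  have hne' : z.arg ≠ ε := by
    intro h
    exact hne (by rw [← h, exp_arg_of_norm_one hz])
  have hl := Complex.neg_pi_lt_arg z
  have hu := Complex.arg_le_pi z
  unfold shiftAngle posAngle
  rw [neg_mul_exp_neg hz]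
  rcases lt_or_ge z.arg ε with h | h
  · rw [arg_exp_of_mem (by linarith) (by linarith)]
    rcases lt_or_ge z.arg 0 with h2 | h2
    · rw [if_pos h2, if_neg (by intro h3; linarith [h3.1])]; ring
    · rw [if_neg (by linarith), if_pos ⟨h2, h⟩]; ring
  · have h' := lt_of_le_of_ne h (Ne.symm hne')
    have : Complex.exp ((z.arg - ε + π : ℝ) * Complex.I)
        = Complex.exp ((z.arg - ε - π : ℝ) * Complex.I) := by
      have : ((z.arg - ε + π : ℝ) : ℂ) * Complex.I
          = ((z.arg - ε - π : ℝ) : ℂ) * Complex.I + 2 * π * Complex.I := by push_cast; ring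
      rw [this, Complex.exp_add, Complex.exp_two_pi_mul_I, mul_one]
    rw [this, arg_exp_of_mem (by linarith) (by linarith), if_neg (by linarith),
      if_neg (by intro h3; linarith [h3.2])]
    ring

/-- The factor -e^{-iε} moves the cut of the principal argument from -1 to e^{iε}, the only point of
the circle where continuity is lost. -/
lemma continuousAt_shiftAngle {z : ℂ} (hz : ‖z‖ = 1) {ε : ℝ}
    (hne : z ≠ Complex.exp (ε * Complex.I)) : ContinuousAt (shiftAngle ε) z := by
  have hs : -(z * Complex.exp (-(ε * Complex.I))) ∈ Complex.slitPlane := by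
    rw [Complex.mem_slitPlane_iff_arg]
    refine ⟨fun h => hne ?_, ?_⟩
    · have h2 : ‖-(z * Complex.exp (-(ε * Complex.I)))‖ = 1 := by
        rw [norm_neg, norm_mul, hz, ← neg_mul, ← Complex.ofReal_neg, Complex.norm_exp_ofReal_mul_I,
          one_mul]
      have h3 := exp_arg_of_norm_one h2
      rw [h, Complex.exp_pi_mul_I] at h3
      have h4 : z * Complex.exp (-(ε * Complex.I)) = 1 := by
        linear_combination h3
      rw [Complex.exp_neg] at h4
      exact (mul_inv_eq_one₀ (Complex.exp_ne_zero _)).1 h4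
    · intro h
      rw [neg_eq_zero, mul_eq_zero] at h
      rcases h with h | h
      · rw [h, norm_zero] at hz; exact zero_ne_one hz
      · exact Complex.exp_ne_zero _ h
  unfold shiftAngle
  refine ((ContinuousAt.comp (f := fun z : ℂ => -(z * Complex.exp (-(ε * Complex.I))))
    (Complex.continuousAt_arg hs) ?_).add continuousAt_const).add continuousAt_const
  fun_prop

lemma exp_shiftAngle {z : ℂ} (hz : ‖z‖ = 1) (ε : ℝ) :
    Complex.exp (shiftAngle ε z * Complex.I) = z := by
  have h2 : ‖-(z * Complex.exp (-(ε * Complex.I)))‖ = 1 := by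
    rw [norm_neg, norm_mul, hz, ← neg_mul, ← Complex.ofReal_neg, Complex.norm_exp_ofReal_mul_I,
      one_mul]
  unfold shiftAngle
  push_cast
  rw [add_mul, add_mul, Complex.exp_add, Complex.exp_add, exp_arg_of_norm_one h2,
    Complex.exp_pi_mul_I, Complex.exp_neg]
  field_simp [Complex.exp_ne_zero]

end Angle

/-! ### Spectral flow and continuous arguments of the determinant -/

section SpectralFlow

lemma continuousOn_det {X : Type*} [NormedAddCommGroup X] [InnerProductSpace ℂ X]
    {A : ℝ → (X ≃ₗᵢ[ℂ] X)} {s : Set ℝ}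
    (hA : ContinuousOn (fun s => ((A s).toContinuousLinearEquiv : X →L[ℂ] X)) s) :
    ContinuousOn (fun t => LinearMap.det ((A t).toLinearEquiv : X →ₗ[ℂ] X)) s :=
  ContinuousLinearMap.continuous_det.comp_continuousOn hA

variable {X : Type*} [NormedAddCommGroup X] [InnerProductSpace ℂ X] [FiniteDimensional ℂ X]

/-- The sum of the arguments in `[0, 2π)` of the eigenvalues of an operator. -/
def angleSum (A : X →ₗ[ℂ] X) : ℝ := (A.charpoly.roots.map posAngle).sum

lemma norm_of_mem_roots (A : X ≃ₗᵢ[ℂ] X) {z : ℂ}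
    (hz : z ∈ (LinearMap.charpoly (A.toLinearEquiv : X →ₗ[ℂ] X)).roots) : ‖z‖ = 1 := by
  have h := (Module.End.hasEigenvalue_iff_isRoot_charpoly
    (A.toLinearEquiv : X →ₗ[ℂ] X) z).2 (isRoot_of_mem_roots hz)
  obtain ⟨v, hv⟩ := h.exists_hasEigenvector
  have h1 := hv.apply_eq_smul
  have h2 : ‖v‖ = ‖z‖ * ‖v‖ := by
    rw [← norm_smul, ← h1]
    exact (A.norm_map v).symm
  have h3 : ‖v‖ ≠ 0 := norm_ne_zero_iff.2 hv.2
  exact (mul_right_cancel₀ h3 (by rw [← h2, one_mul]))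

lemma det_eq_exp_angleSum (A : X ≃ₗᵢ[ℂ] X) :
    Complex.exp (angleSum (A.toLinearEquiv : X →ₗ[ℂ] X) * Complex.I)
      = LinearMap.det (A.toLinearEquiv : X →ₗ[ℂ] X) := by
  rw [Module.End.det_eq_prod_roots_charpoly_of_splits (IsAlgClosed.splits _)]
  exact exp_sum_map_mul_I fun z hz => exp_posAngle (norm_of_mem_roots A hz)

/-- This links the arc count to the determinant: the left side is continuous as long as e^{iε} is
not an eigenvalue, so a jump of `angleSum` at the point 1 is compensated by the jump of the arc
count. -/
lemma sum_shiftAngle_eq (A : X ≃ₗᵢ[ℂ] X) {ε : ℝ} (h0 : 0 < ε) (h1 : ε < Real.pi)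
    (hne : ¬ Module.End.HasEigenvalue (A.toLinearEquiv : X →ₗ[ℂ] X)
        (Complex.exp ((ε : ℂ) * Complex.I))) :
    ((LinearMap.charpoly (A.toLinearEquiv : X →ₗ[ℂ] X)).roots.map (shiftAngle ε)).sum
      = angleSum (A.toLinearEquiv : X →ₗ[ℂ] X)
        + 2 * Real.pi * arcCount (A.toLinearEquiv : X →ₗ[ℂ] X) ε := by
  classical
  have hz1 := fun z => norm_of_mem_roots A (z := z)
  have hz2 : ∀ z ∈ (LinearMap.charpoly (A.toLinearEquiv : X →ₗ[ℂ] X)).roots,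
      z ≠ Complex.exp ((ε : ℂ) * Complex.I) := by
    rintro z hz rfl
    exact hne ((Module.End.hasEigenvalue_iff_isRoot_charpoly _ _).2 (isRoot_of_mem_roots hz))
  unfold angleSum arcCount
  rw [← Multiset.countP_eq_card_filter]
  generalize (LinearMap.charpoly (A.toLinearEquiv : X →ₗ[ℂ] X)).roots = s at *
  induction s using Multiset.induction_on with
  | empty => simp
  | cons a s ih =>
    have := ih (fun z hz => hz1 z (Multiset.mem_cons_of_mem hz))
      (fun z hz => hz2 z (Multiset.mem_cons_of_mem hz))
    rw [Multiset.map_cons, Multiset.sum_cons, this, Multiset.map_cons, Multiset.sum_cons,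
      Multiset.countP_cons, shiftAngle_eq (hz1 a (Multiset.mem_cons_self a s)) h0 h1
        (hz2 a (Multiset.mem_cons_self a s))]
    push_cast
    ring

lemma continuousOn_eval_charpoly {A : ℝ → (X ≃ₗᵢ[ℂ] X)} {s : Set ℝ}
    (hA : ContinuousOn (fun s => ((A s).toContinuousLinearEquiv : X →L[ℂ] X)) s) (z : ℂ) :
    ContinuousOn (fun t => (LinearMap.charpoly ((A t).toLinearEquiv : X →ₗ[ℂ] X)).eval z) s := by
  have h : ∀ t, (LinearMap.charpoly ((A t).toLinearEquiv : X →ₗ[ℂ] X)).eval z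
      = (z • ContinuousLinearMap.id ℂ X - ((A t).toContinuousLinearEquiv : X →L[ℂ] X)).det := by
    intro t
    rw [LinearMap.eval_charpoly]
    rfl
  simp_rw [h]
  exact ContinuousLinearMap.continuous_det.comp_continuousOn (continuousOn_const.sub hA)

lemma continuousOn_sum_shiftAngle {A : ℝ → (X ≃ₗᵢ[ℂ] X)} {s : Set ℝ} {ε : ℝ}
    (hA : ContinuousOn (fun s => ((A s).toContinuousLinearEquiv : X →L[ℂ] X)) s)
    (hne : ∀ t ∈ s, ¬ Module.End.HasEigenvalue ((A t).toLinearEquiv : X →ₗ[ℂ] X)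
        (Complex.exp ((ε : ℂ) * Complex.I))) :
    ContinuousOn (fun t => ((LinearMap.charpoly ((A t).toLinearEquiv : X →ₗ[ℂ] X)).roots.map
      (shiftAngle ε)).sum) s := by
  intro t ht
  refine tendsto_sum_map_roots (N := Module.finrank ℂ X) (R := 1)
    (fun i => LinearMap.charpoly_monic _) (fun i => LinearMap.charpoly_natDegree _)
    (fun z => continuousOn_eval_charpoly hA z t ht)
    (Eventually.of_forall fun i z hz => (norm_of_mem_roots _ hz).le) fun z hz => ?_
  refine continuousAt_shiftAngle (norm_of_mem_roots _ hz) ?_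
  rintro rfl
  exact hne t ht ((Module.End.hasEigenvalue_iff_isRoot_charpoly _ _).2 (isRoot_of_mem_roots hz))

/-- Two continuous real functions on an interval with the same exponential differ by a constant. -/
lemma sub_eq_sub_of_exp_eq {a b : ℝ} (hab : a ≤ b) {f g : ℝ → ℝ}
    (hf : ContinuousOn f (Set.Icc a b)) (hg : ContinuousOn g (Set.Icc a b))
    (h : ∀ t ∈ Set.Icc a b, Complex.exp (f t * Complex.I) = Complex.exp (g t * Complex.I)) :
    f b - f a = g b - g a := by
  have hk : ∀ t ∈ Set.Icc a b, ∃ k : ℤ, (f t - g t) / (2 * Real.pi) = k := by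
    intro t ht
    obtain ⟨k, hk⟩ := Complex.exp_eq_exp_iff_exists_int.1 (h t ht)
    refine ⟨k, ?_⟩
    have h2 : ((f t : ℂ)) = g t + k * (2 * Real.pi) := by
      apply mul_right_cancel₀ Complex.I_ne_zero
      rw [hk]; ring
    have h3 : f t = g t + k * (2 * Real.pi) := by exact_mod_cast h2
    rw [h3]
    field_simp
    ring
  have hc : ContinuousOn (fun t => (f t - g t) / (2 * Real.pi)) (Set.Icc a b) :=
    (hf.sub hg).div_const _
  have hpre : IsPreconnected ((fun t => (f t - g t) / (2 * Real.pi)) '' Set.Icc a b) :=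
    isPreconnected_Icc.image _ hc
  have hord := hpre.ordConnected
  have ha : a ∈ Set.Icc a b := ⟨le_rfl, hab⟩
  have hb : b ∈ Set.Icc a b := ⟨hab, le_rfl⟩
  -- The difference divided by 2π is continuous and takes integer values; if it took two of them, it
  -- would also take the value k + 1/2.
  have key : ∀ x ∈ Set.Icc a b, ∀ y ∈ Set.Icc a b,
      ¬ (f x - g x) / (2 * Real.pi) < (f y - g y) / (2 * Real.pi) := by
    intro x hx y hy hlt
    obtain ⟨k, hk1⟩ := hk x hx
    obtain ⟨m, hm⟩ := hk y hy
    rw [hk1, hm] at hlt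
    have hkm : k + 1 ≤ m := by exact_mod_cast hlt
    have hkm' : (k : ℝ) + 1 ≤ m := by exact_mod_cast hkm
    obtain ⟨s, hs, hs'⟩ := hord.out (Set.mem_image_of_mem _ hx) (Set.mem_image_of_mem _ hy)
      (show (k : ℝ) + 1 / 2 ∈ _ from by
        constructor
        · simp only [hk1]; linarith
        · simp only [hm]; linarith)
    obtain ⟨r, hr⟩ := hk s hs
    simp only [hr] at hs'
    have h5 : (r : ℝ) * 2 = 2 * k + 1 := by linarith
    have h6 : r * 2 = 2 * k + 1 := by exact_mod_cast h5
    omega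
  have heq : (f a - g a) / (2 * Real.pi) = (f b - g b) / (2 * Real.pi) :=
    le_antisymm (not_lt.1 (key b hb a ha)) (not_lt.1 (key a ha b hb))
  have h2 : (2 * Real.pi) ≠ 0 := by positivity
  have := (div_left_inj' h2).1 heq
  linarith

/-- On each piece of the subdivision the sum of shifted angles is a continuous argument of the
determinant, so it changes by as much as `L`. Expressed through `angleSum` and the arc counts, these
changes telescope to the change of `angleSum` plus 2π times the spectral flow. -/
lemma IsSpectralFlow.angle_lift {A : ℝ → (X ≃ₗᵢ[ℂ] X)} {a b : ℝ} {m : ℤ}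
    (h : IsSpectralFlow A a b m) {L : ℝ → ℝ} (hL : ContinuousOn L (Set.Icc a b))
    (hLA : ∀ t ∈ Set.Icc a b, Complex.exp (L t * Complex.I)
      = LinearMap.det ((A t).toLinearEquiv : X →ₗ[ℂ] X)) :
    L b - L a = angleSum ((A b).toLinearEquiv : X →ₗ[ℂ] X)
      - angleSum ((A a).toLinearEquiv : X →ₗ[ℂ] X) + 2 * Real.pi * m := by
  obtain ⟨hA, N, t, ε, h0, hN, hmono, hε, hne, hm⟩ := h
  have hle : ∀ i j, i ≤ j → j ≤ N → t i ≤ t j := by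
    intro i j hij
    induction j, hij using Nat.le_induction with
    | base => intro _; exact le_rfl
    | succ j hij ih => intro hj; exact (ih (by omega)).trans (hmono j (by omega))
  have hstep : ∀ j < N, L (t (j + 1)) - L (t j)
      = angleSum ((A (t (j + 1))).toLinearEquiv : X →ₗ[ℂ] X)
        - angleSum ((A (t j)).toLinearEquiv : X →ₗ[ℂ] X)
        + 2 * Real.pi * (((arcCount ((A (t (j + 1))).toLinearEquiv : X →ₗ[ℂ] X) (ε j) : ℤ)
        - (arcCount ((A (t j)).toLinearEquiv : X →ₗ[ℂ] X) (ε j) : ℤ) : ℤ) : ℝ) := by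
    intro j hj
    have hsub : Set.Icc (t j) (t (j + 1)) ⊆ Set.Icc a b := by
      rw [← h0, ← hN]
      exact Set.Icc_subset_Icc (hle 0 j (by omega) (by omega)) (hle _ _ (by omega) le_rfl)
    have h1 := sub_eq_sub_of_exp_eq (hmono j hj) (hL.mono hsub)
      (continuousOn_sum_shiftAngle (hA.mono hsub) (hne j hj)) (by
        intro s hs
        rw [hLA s (hsub hs), Module.End.det_eq_prod_roots_charpoly_of_splits (IsAlgClosed.splits _)]
        exact (exp_sum_map_mul_I fun z hz => exp_shiftAngle (norm_of_mem_roots _ hz) _).symm)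
    rw [h1, sum_shiftAngle_eq _ (hε j hj).1 (hε j hj).2 (hne j hj _ ⟨hmono j hj, le_rfl⟩),
      sum_shiftAngle_eq _ (hε j hj).1 (hε j hj).2 (hne j hj _ ⟨le_rfl, hmono j hj⟩)]
    push_cast
    ring
  have hsum := Finset.sum_congr rfl fun j hj => hstep j (Finset.mem_range.1 hj)
  rw [Finset.sum_range_sub (fun j => L (t j)), Finset.sum_add_distrib, ← Finset.mul_sum,
    Finset.sum_range_sub (fun j => angleSum ((A (t j)).toLinearEquiv : X →ₗ[ℂ] X)),
    ← Int.cast_sum, ← hm, h0, hN] at hsum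
  exact hsum

lemma norm_det_eq_one (A : X ≃ₗᵢ[ℂ] X) :
    ‖LinearMap.det (A.toLinearEquiv : X →ₗ[ℂ] X)‖ = 1 := by
  rw [← det_eq_exp_angleSum, Complex.norm_exp_ofReal_mul_I]

lemma exists_angle_lift {δ : ℝ → ℂ} {T : ℝ} (hT : 0 < T) (hδ : ContinuousOn δ (Set.Icc 0 T))
    (h1 : ∀ t ∈ Set.Icc 0 T, ‖δ t‖ = 1) :
    ∃ L : ℝ → ℝ, ContinuousOn L (Set.Icc 0 T) ∧
      ∀ t ∈ Set.Icc 0 T, Complex.exp (L t * Complex.I) = δ t := by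
  have hmem : ∀ s : unitInterval, (s : ℝ) * T ∈ Set.Icc 0 T := fun s =>
    ⟨mul_nonneg s.2.1 hT.le, mul_le_of_le_one_left hT.le s.2.2⟩
  let γ : C(unitInterval, Circle) :=
    ⟨fun s => ⟨δ (s * T), mem_sphere_zero_iff_norm.2 (h1 _ (hmem s))⟩, by
      refine Continuous.subtype_mk ?_ _
      exact hδ.comp_continuous (by fun_prop) hmem⟩
  -- Path lifting through the covering ℝ → `Circle`, after rescaling [0, T] to the unit interval.
  obtain ⟨e, he⟩ := Circle.exp_surjective (γ 0)
  obtain ⟨Γ, hΓ, -⟩ := Circle.isCoveringMap_exp.exists_path_lifts γ e he.symm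
  refine ⟨fun t => Γ (Set.projIcc 0 1 zero_le_one (t / T)), ?_, ?_⟩
  · exact (Γ.continuous.comp (continuous_projIcc.comp (continuous_id.div_const T))).continuousOn
  · intro t ht
    have h2 := congrArg Subtype.val (congrFun hΓ (Set.projIcc 0 1 zero_le_one (t / T)))
    have h3 : t / T ∈ Set.Icc (0 : ℝ) 1 := ⟨div_nonneg ht.1 hT.le, (div_le_one hT).2 ht.2⟩
    rw [Function.comp_apply, Circle.coe_exp] at h2
    rw [h2]
    change δ ((Set.projIcc (0 : ℝ) 1 zero_le_one (t / T) : ℝ) * T) = δ t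
    rw [Set.projIcc_of_mem zero_le_one h3]
    congr 1
    field_simp

/-- In `IsSpectralFlow.angle_lift` nothing but m depends on the subdivision and the angles ε. -/
lemma IsSpectralFlow.unique {A : ℝ → (X ≃ₗᵢ[ℂ] X)} {T : ℝ} (hT : 0 < T) {m m' : ℤ}
    (h : IsSpectralFlow A 0 T m) (h' : IsSpectralFlow A 0 T m') : m = m' := by
  obtain ⟨L, hL, hLA⟩ := exists_angle_lift hT (continuousOn_det h.1)
    fun t _ => norm_det_eq_one (A t)
  have h1 := h.angle_lift hL hLA
  have h2 := h'.angle_lift hL hLA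
  rw [h1] at h2
  have h3 : 2 * Real.pi * (m : ℝ) = 2 * Real.pi * m' := by linarith
  have h4 := mul_left_cancel₀ (by positivity) h3
  exact_mod_cast h4

/-- Composing a curve of unitary operators with a fixed one changes the spectral flow by the
change of a function of the end points. -/
lemma IsSpectralFlow.sub_eq {A : ℝ → (X ≃ₗᵢ[ℂ] X)} {E : X ≃ₗᵢ[ℂ] X} {T : ℝ} (hT : 0 < T)
    {m m' : ℤ} (h : IsSpectralFlow A 0 T m)
    (h' : IsSpectralFlow (fun t => (A t).trans E) 0 T m') :
    2 * Real.pi * ((m : ℝ) - m')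
      = (angleSum (((A T).trans E).toLinearEquiv : X →ₗ[ℂ] X)
          - angleSum ((A T).toLinearEquiv : X →ₗ[ℂ] X))
        - (angleSum (((A 0).trans E).toLinearEquiv : X →ₗ[ℂ] X)
          - angleSum ((A 0).toLinearEquiv : X →ₗ[ℂ] X)) := by
  obtain ⟨L, hL, hLA⟩ := exists_angle_lift hT (continuousOn_det h.1)
    fun t _ => norm_det_eq_one (A t)
  have h1 := h.angle_lift hL hLA
  -- The determinant only acquires the constant factor det E, so `L` plus a constant lifts it and
  -- the change of `L` drops out of the difference.
  have h2 := h'.angle_lift (L := fun t => L t + angleSum (E.toLinearEquiv : X →ₗ[ℂ] X))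
    (hL.add continuousOn_const) (by
      intro t ht
      push_cast
      rw [add_mul, Complex.exp_add, hLA t ht, det_eq_exp_angleSum, mul_comm, ← LinearMap.det_comp]
      rfl)
  simp only [add_sub_add_right_eq_sub] at h2
  linarith

/-- The spectral flow of a continuous curve of unitary operators is defined. -/
lemma exists_isSpectralFlow {A : ℝ → (X ≃ₗᵢ[ℂ] X)} {a b : ℝ} (hab : a ≤ b)
    (hA : ContinuousOn (fun s => ((A s).toContinuousLinearEquiv : X →L[ℂ] X)) (Set.Icc a b)) :
    ∃ m, IsSpectralFlow A a b m := by
  let c : Set.Ioo 0 Real.pi → Set (Set.Icc a b) := fun ε =>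
    {s | (LinearMap.charpoly ((A s).toLinearEquiv : X →ₗ[ℂ] X)).eval
      (Complex.exp (((ε : ℝ) : ℂ) * Complex.I)) ≠ 0}
  have hc : ∀ ε, IsOpen (c ε) := fun ε =>
    isOpen_ne_fun (continuousOn_iff_continuous_domRestrict.1 (continuousOn_eval_charpoly hA _))
      continuous_const
  -- Finitely many eigenvalues cannot exhaust the angles in (0, π), so each parameter has an
  -- admissible ε, which stays admissible nearby. Compactness then supplies the subdivision.
  have hcov : Set.univ ⊆ ⋃ ε, c ε := by
    intro s _
    rw [Set.mem_iUnion]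
    by_contra hcon
    push Not at hcon
    have hinj : Function.Injective fun ε : Set.Ioo 0 Real.pi =>
        Complex.exp (((ε : ℝ) : ℂ) * Complex.I) := by
      intro x y hxy
      have := congrArg Complex.arg hxy
      simp only at this
      rw [arg_exp_of_mem (by linarith [x.2.1, Real.pi_pos]) x.2.2.le,
        arg_exp_of_mem (by linarith [y.2.1, Real.pi_pos]) y.2.2.le] at this
      exact Subtype.ext this
    have hinf : Infinite (Set.Ioo 0 Real.pi) := (Set.Ioo_infinite Real.pi_pos).to_subtype
    refine Set.infinite_range_of_injective hinj (Set.Finite.subset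
      (LinearMap.charpoly ((A s).toLinearEquiv : X →ₗ[ℂ] X)).roots.toFinset.finite_toSet ?_)
    rintro _ ⟨ε, rfl⟩
    have h1 := hcon ε
    simp only [c, Set.mem_ofPred_eq, not_not] at h1
    rw [Finset.mem_coe, Multiset.mem_toFinset, mem_roots (LinearMap.charpoly_monic _).ne_zero]
    exact h1
  obtain ⟨t, h0, hmono, ⟨N, hN⟩, hsub⟩ := exists_monotone_Icc_subset_open_cover_Icc hab hc hcov
  choose ε hε using hsub
  refine ⟨_, hA, N, fun j => t j, fun j => ε j, h0, hN N le_rfl,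
    fun j _ => hmono (Nat.le_succ j), fun j _ => (ε j).2, ?_, rfl⟩
  intro j _ s hs
  have hs' : s ∈ Set.Icc a b := ⟨(t j).2.1.trans hs.1, hs.2.trans (t (j + 1)).2.2⟩
  have h2 := hε j (show (⟨s, hs'⟩ : Set.Icc a b) ∈ _ from ⟨hs.1, hs.2⟩)
  rw [Module.End.hasEigenvalue_iff_isRoot_charpoly]
  exact h2

end SpectralFlow

/-! ### Reflections and compressed Cayley transforms: the nondegenerate case -/

section Compression

open Matrix

variable {ι κ : Type*} [Fintype ι] [DecidableEq ι] [Fintype κ] [DecidableEq κ]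

open scoped ComplexOrder in
/-- The eigenvalues of a compression of a diagonal matrix are convex combinations of its entries. -/
lemma exists_convex_of_mem_roots_compression {C : Matrix ι κ ℂ} (hC : Cᴴ * C = 1) (h : ι → ℂ)
    {z : ℂ} (hz : z ∈ (Cᴴ * diagonal h * C).charpoly.roots) :
    ∃ t : ι → ℝ, (∀ k, 0 ≤ t k) ∧ ∑ k, t k = 1 ∧ z = ∑ k, (t k : ℂ) * h k := by
  have h1 : (Cᴴ * diagonal h * C).charpoly.eval z = 0 := isRoot_of_mem_roots hz
  rw [Matrix.eval_charpoly] at h1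
  obtain ⟨v, hv0, hv⟩ := Matrix.exists_mulVec_eq_zero_iff.2 h1
  rw [Matrix.sub_mulVec, sub_eq_zero] at hv
  have hv' : z • v = Cᴴ *ᵥ (diagonal h *ᵥ (C *ᵥ v)) := by
    rw [Matrix.mulVec_mulVec, Matrix.mulVec_mulVec, ← hv]
    simp
  have hn : star (C *ᵥ v) ⬝ᵥ (C *ᵥ v) = star v ⬝ᵥ v := by
    rw [Matrix.star_mulVec, ← Matrix.dotProduct_mulVec, Matrix.mulVec_mulVec, hC, Matrix.one_mulVec]
  have hq : z * (star v ⬝ᵥ v) = star (C *ᵥ v) ⬝ᵥ (diagonal h *ᵥ (C *ᵥ v)) := by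
    rw [Matrix.star_mulVec, ← Matrix.dotProduct_mulVec, ← hv', dotProduct_smul, smul_eq_mul]
  set w := C *ᵥ v
  have hS : star w ⬝ᵥ w = ((∑ k, ‖w k‖ ^ 2 : ℝ) : ℂ) := by
    simp only [dotProduct, Pi.star_apply, RCLike.star_def]
    push_cast
    exact Finset.sum_congr rfl fun k _ => Complex.conj_mul' _
  have hne : (∑ k, ‖w k‖ ^ 2 : ℝ) ≠ 0 := by
    intro h0
    rw [hn, h0] at hS
    simp only [Complex.ofReal_zero] at hS
    exact hv0 (dotProduct_star_self_eq_zero.1 hS)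
  -- For an eigenvector v the eigenvalue is the Rayleigh quotient of the diagonal matrix at w = Cv;
  -- the normalized |w_k|² are the weights.
  refine ⟨fun k => ‖w k‖ ^ 2 / ∑ k, ‖w k‖ ^ 2, fun k => by positivity, ?_, ?_⟩
  · rw [← Finset.sum_div, div_self hne]
  · have hq2 : z * ((∑ k, ‖w k‖ ^ 2 : ℝ) : ℂ) = ∑ k, ((‖w k‖ ^ 2 : ℝ) : ℂ) * h k := by
      rw [← hS, hn, hq]
      simp only [dotProduct, Pi.star_apply, RCLike.star_def, Matrix.mulVec_diagonal]
      refine Finset.sum_congr rfl fun k _ => ?_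
      push_cast
      rw [← Complex.conj_mul']
      ring
    have hne' : ((∑ k, ‖w k‖ ^ 2 : ℝ) : ℂ) ≠ 0 := by exact_mod_cast hne
    rw [← mul_div_cancel_right₀ z hne', hq2, Finset.sum_div]
    refine Finset.sum_congr rfl fun k _ => ?_
    push_cast
    ring

lemma det_scalar_sub_smul_eq_prod_roots (B : Matrix ι ι ℂ) {c : ℂ} (hc : c ≠ 0) (z : ℂ) :
    (scalar ι z - c • B).det = (B.charpoly.roots.map fun β => z - c * β).prod := by
  have hcard : B.charpoly.roots.card = Fintype.card ι := by
    rw [IsAlgClosed.card_roots_eq_natDegree, Matrix.charpoly_natDegree_eq_dim]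
  have h1 : (scalar ι z - c • B) = c • (scalar ι (c⁻¹ * z) - B) := by
    rw [smul_sub]
    congr 1
    ext i j
    by_cases hij : i = j
    · subst hij; simp [hc]
    · simp [hij]
  rw [h1, Matrix.det_smul, ← Matrix.eval_charpoly, ← hcard]
  have h2 := (IsAlgClosed.splits B.charpoly).eq_prod_roots_of_monic B.charpoly_monic
  rw [show B.charpoly.eval (c⁻¹ * z) = (B.charpoly.roots.map fun x => X - C x).prod.eval (c⁻¹ * z)
    by rw [← h2], eval_multiset_prod, Multiset.map_map]
  generalize B.charpoly.roots = s
  induction s using Multiset.induction_on with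
  | empty => simp
  | cons a s ih =>
    rw [Multiset.map_cons, Multiset.prod_cons, Multiset.card_cons, Multiset.map_cons,
      Multiset.prod_cons, ← ih, Function.comp_apply, eval_sub, eval_X, eval_C, pow_succ]
    have h3 : c * (c⁻¹ * z - a) = z - c * a := by field_simp
    rw [← h3]
    ring

lemma det_one_sub_smul_eq_prod_roots (B : Matrix ι ι ℂ) (r : ℂ) :
    (1 - r • B).det = (B.charpoly.roots.map fun β => 1 - r * β).prod := by
  rcases eq_or_ne r 0 with rfl | hr
  · simp
  · rw [← det_scalar_sub_smul_eq_prod_roots B hr, map_one]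

lemma roots_charpoly_smul (B : Matrix ι ι ℂ) {c : ℂ} (hc : c ≠ 0) :
    (c • B).charpoly.roots = B.charpoly.roots.map fun β => c * β := by
  have h : (c • B).charpoly = ((B.charpoly.roots.map fun β => c * β).map fun x => X - C x).prod := by
    apply Polynomial.funext
    intro z
    rw [Matrix.eval_charpoly, det_scalar_sub_smul_eq_prod_roots B hc, eval_multiset_prod,
      Multiset.map_map, Multiset.map_map]
    simp [Function.comp_def]
  rw [h, roots_multiset_prod_X_sub_C]

/-- Since 1 - r(1 - 2CC*)A = (1 + C · C* 2rA(1 - rA)⁻¹)(1 - rA), the identity det(1 + CX) = det(1 +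
XC) moves the first factor to the small space, where C*C = 1 turns it into the compression of (1 +
rA)(1 - rA)⁻¹. -/
lemma det_one_sub_smul_reflection {C : Matrix ι κ ℂ} (hC : Cᴴ * C = 1) {α : ι → ℂ} {r : ℂ}
    (hr : ∀ k, 1 - r * α k ≠ 0) :
    (1 - r • ((1 - (2 : ℂ) • (C * Cᴴ)) * diagonal α)).det
      = (∏ k, (1 - r * α k))
        * (Cᴴ * diagonal (fun k => (1 + r * α k) / (1 - r * α k)) * C).det := by
  have h1 : 1 - r • ((1 - (2 : ℂ) • (C * Cᴴ)) * diagonal α)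
      = (1 + C * (Cᴴ * diagonal (fun k => 2 * (r * α k) / (1 - r * α k))))
        * diagonal (fun k => 1 - r * α k) := by
    have e1 : diagonal (fun k => 2 * (r * α k) / (1 - r * α k)) * diagonal (fun k => 1 - r * α k)
        = (2 * r) • diagonal α := by
      rw [diagonal_mul_diagonal, ← diagonal_smul]
      congr 1
      funext k
      have := hr k
      simp only [Pi.smul_apply, smul_eq_mul]
      field_simp
    have e2 : diagonal (fun k => 1 - r * α k) = 1 - r • diagonal α := by
      rw [← diagonal_smul, ← diagonal_one, diagonal_sub]
      rfl
    rw [add_mul, one_mul, Matrix.mul_assoc C, Matrix.mul_assoc Cᴴ, e1, e2, sub_mul, one_mul,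
      smul_sub, Matrix.smul_mul, Matrix.mul_smul, Matrix.mul_smul, smul_smul, mul_comm r 2,
      Matrix.mul_assoc]
    abel
  have h2 : 1 + Cᴴ * diagonal (fun k => 2 * (r * α k) / (1 - r * α k)) * C
      = Cᴴ * diagonal (fun k => (1 + r * α k) / (1 - r * α k)) * C := by
    have e3 : diagonal (fun k => (1 + r * α k) / (1 - r * α k))
        = 1 + diagonal (fun k => 2 * (r * α k) / (1 - r * α k)) := by
      rw [← diagonal_one, diagonal_add]
      congr 1
      funext k
      have := hr k
      field_simp
      ring
    rw [e3, Matrix.mul_add, Matrix.mul_one, Matrix.add_mul, hC]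
  rw [h1, det_mul, det_one_add_mul_comm, h2, det_diagonal, mul_comm]

lemma exp_sum_map_arg {s : Multiset ℂ} (h : ∀ z ∈ s, z ≠ 0) :
    Complex.exp ((s.map Complex.arg).sum * Complex.I) = s.prod / ‖s.prod‖ := by
  induction s using Multiset.induction_on with
  | empty => simp
  | cons a s ih =>
    have ha : (‖a‖ : ℂ) ≠ 0 := by
      exact_mod_cast norm_ne_zero_iff.2 (h a (Multiset.mem_cons_self a s))
    have h1 : Complex.exp (a.arg * Complex.I) = a / ‖a‖ := by
      rw [eq_div_iff ha, mul_comm, Complex.norm_mul_exp_arg_mul_I]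
    rw [Multiset.map_cons, Multiset.sum_cons, Multiset.prod_cons]
    push_cast
    rw [add_mul, Complex.exp_add, h1, ih fun z hz => h z (Multiset.mem_cons_of_mem hz), norm_mul]
    push_cast
    ring

/-- For z = e^{ix} with 0 < x < 2π, 1 - z = 2 sin(x/2) e^{i(x - π)/2}, and the sine is positive. -/
lemma arg_one_sub {z : ℂ} (hz : ‖z‖ = 1) (h1 : z ≠ 1) :
    (1 - z).arg = (posAngle z - Real.pi) / 2 := by
  have hx0 : 0 < posAngle z := by
    refine lt_of_le_of_ne (posAngle_nonneg z) fun h => h1 ?_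
    rw [← exp_posAngle hz, ← h]; simp
  have hx1 := posAngle_lt z
  have hs : 0 < 2 * Real.sin (posAngle z / 2) := by
    have := Real.sin_pos_of_pos_of_lt_pi (x := posAngle z / 2) (by linarith) (by linarith)
    linarith
  have h2 : 1 - z = ((2 * Real.sin (posAngle z / 2) : ℝ) : ℂ)
      * Complex.exp (((posAngle z - Real.pi) / 2 : ℝ) * Complex.I) := by
    conv_lhs => rw [← exp_posAngle hz]
    set x := posAngle z
    have e1 : Complex.exp (((x - Real.pi) / 2 : ℝ) * Complex.I)
        = Complex.exp ((x / 2 : ℝ) * Complex.I) * (-Complex.I) := by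
      have : (((x - Real.pi) / 2 : ℝ) : ℂ) * Complex.I
          = ((x / 2 : ℝ) : ℂ) * Complex.I + (-(Real.pi / 2 * Complex.I)) := by push_cast; ring
      rw [this, Complex.exp_add, Complex.exp_neg, Complex.exp_pi_div_two_mul_I, Complex.inv_I]
    have e2 : Complex.exp (x * Complex.I) = Complex.exp ((x / 2 : ℝ) * Complex.I) ^ 2 := by
      rw [← Complex.exp_nat_mul]; congr 1; push_cast; ring
    rw [e1, e2]
    push_cast
    rw [Complex.exp_mul_I, mul_comm]
    have h3 := Complex.sin_sq_add_cos_sq ((x : ℂ) / 2)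
    have h4 := Complex.I_sq
    linear_combination (-1 : ℂ) * h3 + (Complex.sin ((x : ℂ) / 2)) ^ 2 * h4
  rw [h2, Complex.arg_real_mul _ hs, arg_exp_of_mem (by linarith [Real.pi_pos]) (by linarith [Real.pi_pos])]

/-- The real part equals (1 - |a|²)/|1 - a|². -/
lemma re_div_pos {a : ℂ} (ha : ‖a‖ < 1) : 0 < ((1 + a) / (1 - a)).re := by
  have hne : 1 - a ≠ 0 := by
    intro h
    rw [← sub_eq_zero.1 h] at ha
    simp at ha
  have h1 : a.re * a.re + a.im * a.im < 1 := by
    have : ‖a‖ ^ 2 < 1 := by nlinarith [norm_nonneg a]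
    rw [Complex.sq_norm, Complex.normSq_apply] at this
    exact this
  have h2 := Complex.normSq_pos.2 hne
  rw [Complex.div_re, ← add_div]
  apply div_pos _ h2
  simp
  nlinarith

lemma arg_I_mul_of_pos {x : ℝ} (hx : 0 < x) : (Complex.I * x).arg = Real.pi / 2 := by
  rw [mul_comm, Complex.arg_real_mul _ hx, Complex.arg_I]

lemma arg_I_mul_of_neg {x : ℝ} (hx : x < 0) : (Complex.I * x).arg = -(Real.pi / 2) := by
  have : Complex.I * x = ((-x : ℝ) : ℂ) * (-Complex.I) := by push_cast; ring
  rw [this, Complex.arg_real_mul _ (by linarith), Complex.arg_neg_I]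

lemma roots_charpoly_diagonal (d : κ → ℂ) :
    (diagonal d).charpoly.roots = Finset.univ.val.map d := by
  have := roots_multiset_prod_X_sub_C (Finset.univ.val.map d)
  rw [Multiset.map_map] at this
  rw [charpoly_diagonal, ← this]
  rfl

lemma one_sub_mul_mem_slitPlane {z : ℂ} (hz : ‖z‖ = 1) (h1 : z ≠ 1) {r : ℝ}
    (hr : r ∈ Set.Icc (0 : ℝ) 1) : 1 - (r : ℂ) * z ∈ Complex.slitPlane := by
  left
  have hre : z.re < 1 := by
    refine lt_of_le_of_ne (hz ▸ Complex.re_le_norm z) fun h => h1 ?_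
    have h3 : z.re * z.re + z.im * z.im = 1 := by
      rw [← Complex.normSq_apply, ← Complex.sq_norm, hz, one_pow]
    have h4 : z.im = 0 := by
      rw [h] at h3
      nlinarith
    exact Complex.ext h h4
  simp only [Complex.sub_re, Complex.one_re, Complex.re_ofReal_mul]
  rcases le_or_gt z.re 0 with h | h
  · nlinarith [hr.1]
  · nlinarith [hr.2]

lemma continuousOn_sum_arg_one_sub (s : Multiset ℂ) (hs : ∀ z ∈ s, ‖z‖ = 1 ∧ z ≠ 1) :
    ContinuousOn (fun r : ℝ => (s.map fun z => (1 - (r : ℂ) * z).arg).sum) (Set.Icc (0 : ℝ) 1) := by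
  induction s using Multiset.induction_on with
  | empty => simpa using continuousOn_const
  | cons a s ih =>
    simp only [Multiset.map_cons, Multiset.sum_cons]
    refine ContinuousOn.add (fun r hr => ?_) (ih fun z hz => hs z (Multiset.mem_cons_of_mem hz))
    have ha := hs a (Multiset.mem_cons_self a s)
    refine ContinuousAt.continuousWithinAt (ContinuousAt.comp (f := fun r : ℝ => 1 - (r : ℂ) * a)
      (Complex.continuousAt_arg (one_sub_mul_mem_slitPlane ha.1 ha.2 hr)) ?_)
    fun_prop

/-- The change of the sum of the arguments of the eigenvalues of a diagonal unitary matrix under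
a reflection is the signature of the compressed Cayley transform, in the nondegenerate case. -/
lemma sum_posAngle_reflection_diagonal {C : Matrix ι κ ℂ} (hC : Cᴴ * C = 1) {α : ι → ℂ}
    (hα : ∀ k, ‖α k‖ = 1) (hα1 : ∀ k, α k ≠ 1) {lam : κ → ℝ}
    (hlam : Cᴴ * diagonal (fun k => (1 + α k) / (1 - α k)) * C
      = diagonal fun j => Complex.I * lam j)
    (hB : ∀ β ∈ ((1 - (2 : ℂ) • (C * Cᴴ)) * diagonal α).charpoly.roots, ‖β‖ = 1 ∧ β ≠ 1) :
    (∀ j, lam j ≠ 0) ∧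
    (((1 - (2 : ℂ) • (C * Cᴴ)) * diagonal α).charpoly.roots.map posAngle).sum
      - ∑ k, posAngle (α k) = Real.pi * ∑ j, if 0 < lam j then (1 : ℝ) else -1 := by
  set B := (1 - (2 : ℂ) • (C * Cᴴ)) * diagonal α with hBdef
  -- The homotopy: `M 0 = 1`, while `M 1` is the compressed Cayley transform, with eigenvalues i·lam
  -- j.
  let M : ℝ → Matrix κ κ ℂ := fun r =>
    Cᴴ * diagonal (fun k => (1 + r * α k) / (1 - r * α k)) * C
  have hslit : ∀ r ∈ Set.Icc (0 : ℝ) 1, ∀ k, 1 - (r : ℂ) * α k ≠ 0 := fun r hr k =>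
    Complex.slitPlane_ne_zero (one_sub_mul_mem_slitPlane (hα k) (hα1 k) hr)
  have hdet : ∀ r ∈ Set.Icc (0 : ℝ) 1, (B.charpoly.roots.map fun β => 1 - (r : ℂ) * β).prod
      = (∏ k, (1 - (r : ℂ) * α k)) * (M r).charpoly.roots.prod := by
    intro r hr
    rw [← det_one_sub_smul_eq_prod_roots, hBdef, det_one_sub_smul_reflection hC (hslit r hr),
      ← Matrix.det_eq_prod_roots_charpoly]
  have hBne : ∀ r ∈ Set.Icc (0 : ℝ) 1, (B.charpoly.roots.map fun β => 1 - (r : ℂ) * β).prod ≠ 0 := by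
    intro r hr h0
    rw [Multiset.prod_eq_zero_iff, Multiset.mem_map] at h0
    obtain ⟨β, hβ, h0⟩ := h0
    exact Complex.slitPlane_ne_zero (one_sub_mul_mem_slitPlane (hB β hβ).1 (hB β hβ).2 hr) h0
  have hM1 : M 1 = diagonal fun j => Complex.I * lam j := by
    rw [← hlam]
    simp [M]
  have hM0 : M 0 = 1 := by
    simp [M, hC]
  have hlam0 : ∀ j, lam j ≠ 0 := by
    intro j hj
    have h1 : (1 : ℝ) ∈ Set.Icc (0 : ℝ) 1 := ⟨zero_le_one, le_rfl⟩
    apply hBne 1 h1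
    rw [hdet 1 h1, ← Matrix.det_eq_prod_roots_charpoly, hM1, det_diagonal]
    rw [Finset.prod_eq_zero (Finset.mem_univ j) (by simp [hj]), mul_zero]
  refine ⟨hlam0, ?_⟩
  -- No eigenvalue of `M r` meets the cut: for r < 1 it is a convex combination of numbers with
  -- positive real part, and at r = 1 it is purely imaginary and nonzero.
  have hMslit : ∀ r ∈ Set.Icc (0 : ℝ) 1, ∀ z ∈ (M r).charpoly.roots, z ∈ Complex.slitPlane := by
    intro r hr z hz
    rcases eq_or_lt_of_le hr.2 with rfl | hr1
    · rw [hM1, roots_charpoly_diagonal, Multiset.mem_map] at hz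
      obtain ⟨j, -, rfl⟩ := hz
      right
      simpa using hlam0 j
    · left
      obtain ⟨t, ht0, ht1, rfl⟩ := exists_convex_of_mem_roots_compression hC _ hz
      rw [Complex.re_sum]
      simp only [Complex.re_ofReal_mul]
      have hpos : ∀ k, 0 < ((1 + (r : ℂ) * α k) / (1 - r * α k)).re := fun k => re_div_pos (by
        rw [norm_mul, hα k, mul_one, Complex.norm_real, Real.norm_of_nonneg hr.1]
        exact hr1)
      refine lt_of_le_of_ne (Finset.sum_nonneg fun k _ => mul_nonneg (ht0 k) (hpos k).le) fun h0 => ?_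
      have h2 := (Finset.sum_eq_zero_iff_of_nonneg
        fun k _ => mul_nonneg (ht0 k) (hpos k).le).1 h0.symm
      have h3 : ∀ k, t k = 0 := fun k =>
        (mul_eq_zero.1 (h2 k (Finset.mem_univ k))).resolve_right (hpos k).ne'
      simp [h3] at ht1
  have hcont : ∀ k, ContinuousOn (fun r : ℝ => (1 + (r : ℂ) * α k) / (1 - r * α k))
      (Set.Icc (0 : ℝ) 1) := fun k =>
    ContinuousOn.div (by fun_prop) (by fun_prop) fun r hr => hslit r hr k
  have hMcont : ContinuousOn M (Set.Icc (0 : ℝ) 1) := by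
    have h1 : ContinuousOn (fun r : ℝ => diagonal fun k => (1 + (r : ℂ) * α k) / (1 - r * α k))
        (Set.Icc (0 : ℝ) 1) :=
      (Continuous.matrix_diagonal continuous_id).comp_continuousOn (continuousOn_pi.2 hcont)
    have h2 : Continuous fun N : Matrix ι ι ℂ => Cᴴ * N * C := by fun_prop
    exact h2.comp_continuousOn h1
  obtain ⟨R, hR⟩ : ∃ R : ℝ, ∀ r ∈ Set.Icc (0 : ℝ) 1, ∀ k,
      ‖(1 + (r : ℂ) * α k) / (1 - r * α k)‖ ≤ R := by
    obtain ⟨R, hR⟩ := isCompact_Icc.exists_bound_of_continuousOn (continuousOn_pi.2 hcont)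
    exact ⟨R, fun r hr k => (norm_le_pi_norm _ k).trans (hR r hr)⟩
  have hΛ : ContinuousOn (fun r => ((M r).charpoly.roots.map Complex.arg).sum)
      (Set.Icc (0 : ℝ) 1) := by
    intro r hr
    refine tendsto_sum_map_roots (N := Fintype.card κ) (R := R) (fun i => charpoly_monic _)
      (fun i => charpoly_natDegree_eq_dim _) (fun z => ?_) ?_
      fun z hz => Complex.continuousAt_arg (hMslit r hr z hz)
    · simp only [eval_charpoly]
      have : Continuous fun N : Matrix κ κ ℂ => (scalar κ z - N).det := by fun_prop
      exact this.comp_continuousOn hMcont r hr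
    · filter_upwards [self_mem_nhdsWithin] with i hi z hz
      obtain ⟨t, ht0, ht1, rfl⟩ := exists_convex_of_mem_roots_compression hC _ hz
      refine (norm_sum_le _ _).trans ?_
      calc ∑ k, ‖(t k : ℂ) * ((1 + (i : ℂ) * α k) / (1 - i * α k))‖
          ≤ ∑ k, t k * R := Finset.sum_le_sum fun k _ => by
            rw [norm_mul, Complex.norm_real, Real.norm_of_nonneg (ht0 k)]
            exact mul_le_mul_of_nonneg_left (hR i hi k) (ht0 k)
        _ = R := by rw [← Finset.sum_mul, ht1, one_mul]
  have hαs : ∀ z ∈ (Finset.univ.val.map α), ‖z‖ = 1 ∧ z ≠ 1 := by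
    intro z hz
    obtain ⟨k, -, rfl⟩ := Multiset.mem_map.1 hz
    exact ⟨hα k, hα1 k⟩
  -- The determinant identity, read as an equality of continuous sums of arguments modulo 2π. At r =
  -- 0 all the sums vanish; at r = 1 they are half the angle sums, up to a shift common to both, and
  -- ±π/2 for each lam j.
  have key := sub_eq_sub_of_exp_eq zero_le_one (continuousOn_sum_arg_one_sub _ hB)
    ((continuousOn_sum_arg_one_sub _ hαs).add hΛ) (by
      intro r hr
      have e1 := exp_sum_map_arg (s := B.charpoly.roots.map fun β => 1 - (r : ℂ) * β) (by
        intro z hz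
        obtain ⟨β, hβ, rfl⟩ := Multiset.mem_map.1 hz
        exact Complex.slitPlane_ne_zero (one_sub_mul_mem_slitPlane (hB β hβ).1 (hB β hβ).2 hr))
      have e2 := exp_sum_map_arg
        (s := (Finset.univ.val.map α).map fun β => 1 - (r : ℂ) * β) (by
        intro z hz
        obtain ⟨β, hβ, rfl⟩ := Multiset.mem_map.1 hz
        exact Complex.slitPlane_ne_zero
          (one_sub_mul_mem_slitPlane (hαs β hβ).1 (hαs β hβ).2 hr))
      have e3 := exp_sum_map_arg (s := (M r).charpoly.roots)
        fun z hz => Complex.slitPlane_ne_zero (hMslit r hr z hz)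
      have e4 : ((Finset.univ.val.map α).map fun β => 1 - (r : ℂ) * β).prod
          = ∏ k, (1 - (r : ℂ) * α k) := by
        rw [Multiset.map_map]; rfl
      rw [Multiset.map_map] at e1 e2
      simp only [Function.comp_def] at e1 e2
      rw [Pi.add_apply, Complex.ofReal_add]
      rw [add_mul, Complex.exp_add, e1, e2, e3, hdet r hr, e4, norm_mul]
      push_cast
      rw [mul_div_mul_comm])
  have hcard : (B.charpoly.roots.card : ℝ) = Fintype.card ι := by
    rw [IsAlgClosed.card_roots_eq_natDegree, Matrix.charpoly_natDegree_eq_dim]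
  have f1 : (B.charpoly.roots.map fun z => (1 - ((1 : ℝ) : ℂ) * z).arg).sum
      = ((B.charpoly.roots.map posAngle).sum - Real.pi * Fintype.card ι) / 2 := by
    have : (B.charpoly.roots.map fun z => (1 - ((1 : ℝ) : ℂ) * z).arg)
        = B.charpoly.roots.map fun z => (posAngle z - Real.pi) / 2 :=
      Multiset.map_congr rfl fun z hz => by
        rw [Complex.ofReal_one, one_mul, arg_one_sub (hB z hz).1 (hB z hz).2]
    rw [this, Multiset.sum_map_div, Multiset.sum_map_sub, Multiset.map_const', Multiset.sum_replicate,
      nsmul_eq_mul, hcard, mul_comm]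
  have f2 : ((Finset.univ.val.map α).map fun z => (1 - ((1 : ℝ) : ℂ) * z).arg).sum
      = (∑ k, posAngle (α k) - Real.pi * Fintype.card ι) / 2 := by
    rw [Multiset.map_map]
    change ∑ k, (1 - ((1 : ℝ) : ℂ) * α k).arg = _
    have : ∀ k, (1 - ((1 : ℝ) : ℂ) * α k).arg = (posAngle (α k) - Real.pi) / 2 := fun k => by
      rw [Complex.ofReal_one, one_mul, arg_one_sub (hα k) (hα1 k)]
    rw [Finset.sum_congr rfl fun k _ => this k, ← Finset.sum_div, Finset.sum_sub_distrib,
      Finset.sum_const, Finset.card_univ, nsmul_eq_mul, mul_comm Real.pi]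
  have f3 : ((M 1).charpoly.roots.map Complex.arg).sum
      = Real.pi / 2 * ∑ j, if 0 < lam j then (1 : ℝ) else -1 := by
    rw [hM1, roots_charpoly_diagonal, Multiset.map_map, Finset.mul_sum]
    refine Finset.sum_congr rfl fun j _ => ?_
    rw [Function.comp_apply]
    split_ifs with h
    · rw [arg_I_mul_of_pos h, mul_one]
    · rw [arg_I_mul_of_neg (lt_of_le_of_ne (not_lt.1 h) (hlam0 j))]; ring
  have f4 : ((M 0).charpoly.roots.map Complex.arg).sum = 0 := by
    rw [hM0, ← diagonal_one, roots_charpoly_diagonal]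
    simp
  rw [Pi.add_apply, Pi.add_apply, f1, f2, f3, f4] at key
  simp at key
  linarith

end Compression

/-! ### Orthonormal eigenbases of unitary operators -/

section Eigenbasis

open Module End

lemma norm_eq_one_of_mem_eigenspace {H : Type*} [NormedAddCommGroup H] [InnerProductSpace ℂ H]
    (A : H ≃ₗᵢ[ℂ] H) {μ : ℂ} {v : H} (hv : A v = μ • v)
    (hv0 : v ≠ 0) : ‖μ‖ = 1 := by
  have h2 : ‖v‖ = ‖μ‖ * ‖v‖ := by rw [← norm_smul, ← hv, A.norm_map]
  exact mul_right_cancel₀ (norm_ne_zero_iff.2 hv0) (by rw [← h2, one_mul])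

variable {H : Type*} [NormedAddCommGroup H] [InnerProductSpace ℂ H] [FiniteDimensional ℂ H]

lemma orthogonalFamily_eigenspaces_isometry (A : H ≃ₗᵢ[ℂ] H) :
    OrthogonalFamily ℂ (fun μ => eigenspace (A.toLinearEquiv : H →ₗ[ℂ] H) μ)
      fun μ => (eigenspace (A.toLinearEquiv : H →ₗ[ℂ] H) μ).subtypeₗᵢ := by
  rintro μ ν hμν ⟨v, hv⟩ ⟨w, hw⟩
  rw [mem_eigenspace_iff] at hv hw
  change inner ℂ v w = 0
  change A v = μ • v at hv
  change A w = ν • w at hw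
  by_cases hv0 : v = 0
  · simp [hv0]
  have h1 := norm_eq_one_of_mem_eigenspace A hv hv0
  have h2 := A.inner_map_map v w
  rw [hv, hw, inner_smul_left, inner_smul_right, ← mul_assoc] at h2
  by_contra h3
  have h4 : (starRingEnd ℂ) μ * ν = 1 := mul_right_cancel₀ h3 (by rw [h2, one_mul])
  apply hμν
  have h5 : μ * (starRingEnd ℂ) μ = 1 := by rw [Complex.mul_conj', h1]; simp
  calc μ = μ * ((starRingEnd ℂ) μ * ν) := by rw [h4, mul_one]
    _ = ν := by rw [← mul_assoc, h5, one_mul]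

/-- The orthogonal complement is invariant, because eigenvalues are nonzero and inner products are
preserved; if it were nonzero it would contain an eigenvector. -/
lemma orthogonal_iSup_eigenspaces_isometry (A : H ≃ₗᵢ[ℂ] H) :
    (⨆ μ, eigenspace (A.toLinearEquiv : H →ₗ[ℂ] H) μ)ᗮ = ⊥ := by
  set f : H →ₗ[ℂ] H := (A.toLinearEquiv : H →ₗ[ℂ] H) with hf
  have hinv : ∀ v ∈ (⨆ μ, eigenspace f μ)ᗮ, f v ∈ (⨆ μ, eigenspace f μ)ᗮ := by
    intro v hv
    rw [← Submodule.iInf_orthogonal, Submodule.mem_iInf] at hv ⊢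
    intro μ w hw
    by_cases hw0 : w = 0
    · simp [hw0]
    have h1 : A w = μ • w := mem_eigenspace_iff.1 hw
    have hμ : μ ≠ 0 := by
      have := norm_eq_one_of_mem_eigenspace A h1 hw0
      intro h; rw [h] at this; simp at this
    have h2 : inner ℂ (A w) (A v) = 0 := by rw [A.inner_map_map]; exact hv μ w hw
    rw [h1, inner_smul_left, mul_eq_zero] at h2
    exact h2.resolve_left (by simpa using hμ)
  by_contra hne
  have : Nontrivial ((⨆ μ, eigenspace f μ)ᗮ : Submodule ℂ H) :=
    (Submodule.nontrivial_iff_ne_bot).2 hne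
  obtain ⟨μ, hμ⟩ := exists_eigenvalue (f.restrict hinv)
  obtain ⟨v, hv⟩ := hμ.exists_hasEigenvector
  have h1 : f v = μ • (v : H) := congrArg Subtype.val hv.apply_eq_smul
  have h2 : (v : H) ∈ ⨆ μ, eigenspace f μ :=
    (le_iSup (fun μ => eigenspace f μ) μ) (mem_eigenspace_iff.2 h1)
  have h3 : inner ℂ (v : H) (v : H) = 0 := v.2 _ h2
  exact hv.2 (Subtype.ext (inner_self_eq_zero.1 h3))

/-- A unitary operator has an orthonormal basis of eigenvectors. -/
lemma exists_orthonormalBasis_eigenvectors (A : H ≃ₗᵢ[ℂ] H) :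
    ∃ (b : OrthonormalBasis (Fin (finrank ℂ H)) ℂ H) (α : Fin (finrank ℂ H) → ℂ),
      ∀ k, A (b k) = α k • b k ∧ ‖α k‖ = 1 := by
  classical
  set f : H →ₗ[ℂ] H := (A.toLinearEquiv : H →ₗ[ℂ] H) with hf
  have hfam : OrthogonalFamily ℂ (fun μ : Eigenvalues f => eigenspace f μ) fun μ =>
      (eigenspace f μ).subtypeₗᵢ :=
    (orthogonalFamily_eigenspaces_isometry A).comp Subtype.coe_injective
  have hbot : (⨆ μ : Eigenvalues f, eigenspace f μ)ᗮ = ⊥ :=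
    show (⨆ μ : { μ // eigenspace f μ ≠ ⊥ }, eigenspace f μ)ᗮ = ⊥ by
      rw [iSup_ne_bot_subtype, orthogonal_iSup_eigenspaces_isometry A]
  have hint : DirectSum.IsInternal fun μ : Eigenvalues f => eigenspace f μ :=
    hfam.isInternal_iff.2 hbot
  refine ⟨hint.subordinateOrthonormalBasis rfl hfam,
    fun k => ((hint.subordinateOrthonormalBasisIndex rfl k hfam : Eigenvalues f) : ℂ), fun k => ?_⟩
  have h1 : A (hint.subordinateOrthonormalBasis rfl hfam k) =
      ((hint.subordinateOrthonormalBasisIndex rfl k hfam : Eigenvalues f) : ℂ)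
        • hint.subordinateOrthonormalBasis rfl hfam k :=
    mem_eigenspace_iff.1 (hint.subordinateOrthonormalBasis_subordinate rfl k hfam)
  exact ⟨h1, norm_eq_one_of_mem_eigenspace A h1
    ((hint.subordinateOrthonormalBasis rfl hfam).orthonormal.ne_zero k)⟩

end Eigenbasis

/-! ### Inertia of a diagonal Hermitian form on a subspace -/

section WeightForm

open Module

variable {H ι : Type*} [NormedAddCommGroup H] [InnerProductSpace ℂ H] [FiniteDimensional ℂ H]
  [Fintype ι]

/-- The Hermitian form which is diagonal with entries `c` in the orthonormal basis `b`. -/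
def weightForm (b : OrthonormalBasis ι ℂ H) (c : ι → ℝ) (x : H) : ℝ :=
  ∑ k, c k * ‖inner ℂ (b k) x‖ ^ 2

/-- Diagonalization of the compression of a diagonal form to a subspace. -/
lemma exists_orthonormalBasis_compression (b : OrthonormalBasis ι ℂ H) (c : ι → ℝ)
    (D : Submodule ℂ H) :
    ∃ (e : OrthonormalBasis (Fin (finrank ℂ D)) ℂ D) (lam : Fin (finrank ℂ D) → ℝ),
      ∀ i j, ∑ k, inner ℂ (e i : H) (b k) * (c k * inner ℂ (b k) (e j : H))
        = if i = j then (lam j : ℂ) else 0 := by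
  -- The self-adjoint operator of the form; an eigenbasis of its compression to D is the required
  -- basis.
  let T : H →ₗ[ℂ] H := ∑ k, (c k : ℂ) • (innerₛₗ ℂ (b k)).smulRight (b k)
  have hT : ∀ x y : H, inner ℂ x (T y)
      = ∑ k, inner ℂ x (b k) * (c k * inner ℂ (b k) y) := by
    intro x y
    simp only [T, LinearMap.sum_apply, inner_sum, LinearMap.smul_apply, LinearMap.smulRight_apply,
      innerₛₗ_apply_apply, inner_smul_right]
    exact Finset.sum_congr rfl fun k _ => by ring
  have hTs : ∀ x y : H, inner ℂ (T x) y = inner ℂ x (T y) := by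
    intro x y
    rw [← inner_conj_symm, hT, hT, map_sum]
    refine Finset.sum_congr rfl fun k _ => ?_
    rw [map_mul, map_mul, inner_conj_symm, inner_conj_symm, Complex.conj_ofReal]
    ring
  let S : D →ₗ[ℂ] D := LinearMap.adjoint D.subtype ∘ₗ T ∘ₗ D.subtype
  have hS : ∀ x y : D, inner ℂ x (S y) = inner ℂ (x : H) (T y) := fun x y => by
    simp only [S, LinearMap.comp_apply, LinearMap.adjoint_inner_right]
    rfl
  have hsym : S.IsSymmetric := by
    intro x y
    rw [hS, ← inner_conj_symm, hS, ← hTs, inner_conj_symm]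
  refine ⟨hsym.eigenvectorBasis rfl, hsym.eigenvalues rfl, fun i j => ?_⟩
  rw [← hT, ← hS, hsym.apply_eigenvectorBasis, inner_smul_right,
    OrthonormalBasis.inner_eq_ite]
  simp

/-- `weightForm` in the diagonalizing basis of the subspace. -/
lemma weightForm_eq_of_compression {κ : Type*} [Fintype κ] [DecidableEq κ]
    {b : OrthonormalBasis ι ℂ H} {c : ι → ℝ}
    {D : Submodule ℂ H} {e : OrthonormalBasis κ ℂ D} {lam : κ → ℝ}
    (he : ∀ i j, ∑ k, inner ℂ (e i : H) (b k) * (c k * inner ℂ (b k) (e j : H))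
        = if i = j then (lam j : ℂ) else 0) (x : D) :
    weightForm b c x = ∑ j, lam j * ‖inner ℂ (e j) x‖ ^ 2 := by
  have hx : ∀ k, inner ℂ (b k) (x : H) = ∑ j, inner ℂ (e j) x * inner ℂ (b k) (e j : H) := by
    intro k
    have h1 : (x : H) = ∑ j, inner ℂ (e j) x • (e j : H) := by
      conv_lhs => rw [← e.sum_repr' x]
      push_cast
      rfl
    conv_lhs => rw [h1]
    rw [inner_sum]
    exact Finset.sum_congr rfl fun j _ => inner_smul_right _ _ _
  have h : ((weightForm b c x : ℝ) : ℂ) = ((∑ j, lam j * ‖inner ℂ (e j) x‖ ^ 2 : ℝ) : ℂ) := by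
    unfold weightForm
    push_cast
    calc ∑ k, (c k : ℂ) * (‖inner ℂ (b k) (x : H)‖ : ℂ) ^ 2
        = ∑ k, ∑ i, ∑ j, (starRingEnd ℂ) (inner ℂ (e i) x) * inner ℂ (e j) x
            * (inner ℂ (e i : H) (b k) * (c k * inner ℂ (b k) (e j : H))) := by
          refine Finset.sum_congr rfl fun k _ => ?_
          rw [← Complex.conj_mul', hx k, map_sum, Finset.sum_mul_sum, Finset.mul_sum]
          refine Finset.sum_congr rfl fun i _ => ?_
          rw [Finset.mul_sum]
          refine Finset.sum_congr rfl fun j _ => ?_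
          rw [map_mul, inner_conj_symm _ (b k)]
          ring
      _ = ∑ i, ∑ j, (starRingEnd ℂ) (inner ℂ (e i) x) * inner ℂ (e j) x
            * ∑ k, inner ℂ (e i : H) (b k) * (c k * inner ℂ (b k) (e j : H)) := by
          rw [Finset.sum_comm]
          refine Finset.sum_congr rfl fun i _ => ?_
          rw [Finset.sum_comm]
          exact Finset.sum_congr rfl fun j _ => (Finset.mul_sum _ _ _).symm
      _ = ∑ j, (lam j : ℂ) * (‖inner ℂ (e j) x‖ : ℂ) ^ 2 := by
          refine Finset.sum_congr rfl fun i _ => ?_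
          simp only [he, mul_ite, mul_zero, Finset.sum_ite_eq, Finset.mem_univ, if_true]
          rw [Complex.conj_mul']
          ring
  exact_mod_cast h

lemma finrank_add_le_of_disjoint {V : Type*} [AddCommGroup V] [Module ℂ V] [FiniteDimensional ℂ V]
    {S P D : Submodule ℂ V} (hS : S ≤ D) (hP : P ≤ D) (h : S ⊓ P = ⊥) :
    finrank ℂ S + finrank ℂ P ≤ finrank ℂ D := by
  rw [← Submodule.finrank_sup_add_finrank_inf_eq, h, finrank_bot, add_zero]
  exact Submodule.finrank_mono (sup_le hS hP)

lemma exists_submodule_of_basis_subset {κ : Type*} [Fintype κ] {D : Submodule ℂ H}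
    (e : OrthonormalBasis κ ℂ D) (s : Finset κ) :
    ∃ P : Submodule ℂ H, P ≤ D ∧ finrank ℂ P = s.card ∧
      ∀ x : D, (x : H) ∈ P → ∀ j ∉ s, inner ℂ (e j) x = 0 := by
  refine ⟨(Submodule.span ℂ (Set.range fun j : s => e j)).map D.subtype,
    Submodule.map_subtype_le _ _, ?_, ?_⟩
  · rw [Submodule.finrank_map_subtype_eq, finrank_span_eq_card]
    · simp
    · exact (e.orthonormal.linearIndependent).comp _ Subtype.val_injective
  · intro x hx j hj
    obtain ⟨y, hy, hyx⟩ := hx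
    have : y = x := Subtype.ext hyx
    subst this
    clear hyx
    induction hy using Submodule.span_induction with
    | mem y hy =>
      obtain ⟨i, rfl⟩ := hy
      exact e.orthonormal.2 fun h => hj (h ▸ i.2)
    | zero => exact inner_zero_right _
    | add y z _ _ h1 h2 => rw [inner_add_right, h1, h2, add_zero]
    | smul a y _ h1 => rw [inner_smul_right, h1, mul_zero]

/-- A subspace splits into a positive and a non-positive part with respect to a Hermitian form. -/
lemma exists_pos_nonpos_subspaces {κ : Type*} [Fintype κ] [DecidableEq κ]
    {b : OrthonormalBasis ι ℂ H} {c : ι → ℝ}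
    {D : Submodule ℂ H} {e : OrthonormalBasis κ ℂ D} {lam : κ → ℝ}
    (he : ∀ i j, ∑ k, inner ℂ (e i : H) (b k) * (c k * inner ℂ (b k) (e j : H))
        = if i = j then (lam j : ℂ) else 0) :
    ∃ P Z : Submodule ℂ H, P ≤ D ∧ Z ≤ D ∧
      finrank ℂ P = (Finset.univ.filter fun j => 0 < lam j).card ∧
      finrank ℂ P + finrank ℂ Z = finrank ℂ D ∧
      (∀ x ∈ P, x ≠ 0 → 0 < weightForm b c x) ∧ (∀ x ∈ Z, weightForm b c x ≤ 0) := by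
  obtain ⟨P, hPD, hP, hP'⟩ := exists_submodule_of_basis_subset e
    (Finset.univ.filter fun j => 0 < lam j)
  obtain ⟨Z, hZD, hZ, hZ'⟩ := exists_submodule_of_basis_subset e
    (Finset.univ.filter fun j => ¬ 0 < lam j)
  refine ⟨P, Z, hPD, hZD, hP, ?_, ?_, ?_⟩
  · rw [hP, hZ, Finset.card_filter_add_card_filter_not, Finset.card_univ,
      Module.finrank_eq_card_basis e.toBasis]
  · intro x hx hx0
    have h1 := hP' ⟨x, hPD hx⟩ hx
    have h2 := weightForm_eq_of_compression he ⟨x, hPD hx⟩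
    simp only at h2
    rw [h2]
    have hnn : ∀ j ∈ Finset.univ, 0 ≤ lam j * ‖inner ℂ (e j) (⟨x, hPD hx⟩ : D)‖ ^ 2 := by
      intro j _
      by_cases hj : 0 < lam j
      · positivity
      · rw [h1 j (by simpa using hj)]; simp
    refine lt_of_le_of_ne (Finset.sum_nonneg hnn) fun h0 => hx0 ?_
    have h3 := (Finset.sum_eq_zero_iff_of_nonneg hnn).1 h0.symm
    have h4 : ∀ j, inner ℂ (e j) (⟨x, hPD hx⟩ : D) = 0 := by
      intro j
      by_cases hj : 0 < lam j
      · have := (mul_eq_zero.1 (h3 j (Finset.mem_univ j))).resolve_left hj.ne'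
        simpa using this
      · exact h1 j (by simpa using hj)
    have h5 := e.sum_repr' ⟨x, hPD hx⟩
    simp only [h4, zero_smul, Finset.sum_const_zero] at h5
    exact congrArg Subtype.val h5.symm
  · intro x hx
    have h1 := hZ' ⟨x, hZD hx⟩ hx
    have h2 := weightForm_eq_of_compression he ⟨x, hZD hx⟩
    simp only at h2
    rw [h2]
    refine Finset.sum_nonpos fun j _ => ?_
    by_cases hj : 0 < lam j
    · rw [h1 j (by simpa using hj)]; simp
    · exact mul_nonpos_of_nonpos_of_nonneg (not_lt.1 hj) (by positivity)

lemma inf_eq_bot_of_pos_of_nonpos {V : Type*} [AddCommGroup V] [Module ℂ V] {q : V → ℝ}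
    {S Z : Submodule ℂ V} (hS : ∀ x ∈ S, x ≠ 0 → 0 < q x) (hZ : ∀ x ∈ Z, q x ≤ 0) : S ⊓ Z = ⊥ := by
  rw [eq_bot_iff]
  rintro x ⟨h1, h2⟩
  by_contra hx
  exact absurd (hS x h1 hx) (not_lt.2 (hZ x h2))

/-- Complementary positive and non-positive subspaces determine the number of positive
eigenvalues. -/
lemma card_pos_eq_of_subspaces {κ : Type*} [Fintype κ] [DecidableEq κ]
    {b : OrthonormalBasis ι ℂ H} {c : ι → ℝ}
    {D : Submodule ℂ H} {e : OrthonormalBasis κ ℂ D} {lam : κ → ℝ}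
    (he : ∀ i j, ∑ k, inner ℂ (e i : H) (b k) * (c k * inner ℂ (b k) (e j : H))
        = if i = j then (lam j : ℂ) else 0)
    {S Z : Submodule ℂ H} (hSD : S ≤ D) (hZD : Z ≤ D)
    (hdim : finrank ℂ S + finrank ℂ Z = finrank ℂ D)
    (hS : ∀ x ∈ S, x ≠ 0 → 0 < weightForm b c x) (hZ : ∀ x ∈ Z, weightForm b c x ≤ 0) :
    (Finset.univ.filter fun j => 0 < lam j).card = finrank ℂ S := by
  obtain ⟨P', Z', hP'D, hZ'D, hcard, hdim', hP', hZ'⟩ := exists_pos_nonpos_subspaces he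
  -- A positive subspace meets a non-positive one only in 0. Applied crosswise to the two
  -- splittings, this bounds each positive dimension by the other.
  have h1 := finrank_add_le_of_disjoint hSD hZ'D (inf_eq_bot_of_pos_of_nonpos hS hZ')
  have h2 := finrank_add_le_of_disjoint hP'D hZD (inf_eq_bot_of_pos_of_nonpos hP' hZ)
  omega

end WeightForm

/-! ### The weight cot(x/2) -/

section Cot

/-- `cot (x / 2)`, with value `0` at `x = 0`. -/
def halfCot (x : ℝ) : ℝ := Real.cos (x / 2) / Real.sin (x / 2)

lemma sin_half_pos {x : ℝ} (h0 : 0 < x) (h1 : x < 2 * Real.pi) : 0 < Real.sin (x / 2) :=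
  Real.sin_pos_of_pos_of_lt_pi (by linarith) (by linarith)

lemma halfCot_le_halfCot {x y : ℝ} (h0 : 0 < x) (hxy : x ≤ y) (h1 : y < 2 * Real.pi) :
    halfCot y ≤ halfCot x := by
  unfold halfCot
  rw [div_le_div_iff₀ (sin_half_pos (h0.trans_le hxy) h1) (sin_half_pos h0 (hxy.trans_lt h1))]
  have h2 : 0 ≤ Real.sin (y / 2 - x / 2) :=
    Real.sin_nonneg_of_nonneg_of_le_pi (by linarith) (by linarith)
  rw [Real.sin_sub] at h2
  linarith

lemma halfCot_zero : halfCot 0 = 0 := by simp [halfCot]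

lemma continuousAt_halfCot {x : ℝ} (h0 : 0 < x) (h1 : x < 2 * Real.pi) :
    ContinuousAt halfCot x :=
  ContinuousAt.div (by fun_prop) (by fun_prop) (sin_half_pos h0 h1).ne'

lemma tendsto_halfCot_zero : Tendsto halfCot (𝓝[>] 0) atTop := by
  have h1 : Tendsto (fun x : ℝ => Real.cos (x / 2)) (𝓝[>] 0) (𝓝 1) := by
    have : ContinuousAt (fun x : ℝ => Real.cos (x / 2)) 0 := by fun_prop
    have h := this.tendsto
    simp only [zero_div, Real.cos_zero] at h
    exact h.mono_left nhdsWithin_le_nhds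
  have h2 : Tendsto (fun x : ℝ => Real.sin (x / 2)) (𝓝[>] 0) (𝓝[>] 0) := by
    rw [tendsto_nhdsWithin_iff]
    constructor
    · have : ContinuousAt (fun x : ℝ => Real.sin (x / 2)) 0 := by fun_prop
      have h := this.tendsto
      simp only [zero_div, Real.sin_zero] at h
      exact h.mono_left nhdsWithin_le_nhds
    · filter_upwards [Ioo_mem_nhdsGT (show (0 : ℝ) < 2 * Real.pi by positivity)] with x hx
      exact sin_half_pos hx.1 hx.2
  exact (h1.pos_mul_atTop one_pos h2.inv_tendsto_nhdsGT_zero).congr fun x => by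
    rw [halfCot, div_eq_mul_inv]; rfl

/-- The origin of the weights: up to the factor i they are the eigenvalues of the Cayley transform
(1 + A)(1 - A)⁻¹. -/
lemma cayley_exp {x : ℝ} (h0 : 0 < x) (h1 : x < 2 * Real.pi) :
    (1 + Complex.exp (x * Complex.I)) / (1 - Complex.exp (x * Complex.I))
      = Complex.I * halfCot x := by
  have hs := (sin_half_pos h0 h1).ne'
  have hs' : Complex.sin ((x : ℂ) / 2) ≠ 0 := by
    have : Complex.sin ((x : ℂ) / 2) = ((Real.sin (x / 2) : ℝ) : ℂ) := by push_cast; rfl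
    rw [this]; exact_mod_cast hs
  have e2 : Complex.exp (x * Complex.I)
      = (Complex.cos ((x : ℂ) / 2) + Complex.sin ((x : ℂ) / 2) * Complex.I) ^ 2 := by
    rw [← Complex.exp_mul_I, ← Complex.exp_nat_mul]; congr 1; push_cast; ring
  have h3 := Complex.sin_sq_add_cos_sq ((x : ℂ) / 2)
  have h4 := Complex.I_sq
  set s := Complex.sin ((x : ℂ) / 2)
  set c := Complex.cos ((x : ℂ) / 2)
  have e3 : Complex.I * halfCot x = Complex.I * c / s := by
    unfold halfCot; push_cast; ring
  have hne : c + s * Complex.I ≠ 0 := by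
    intro h
    rw [h] at e2
    exact Complex.exp_ne_zero _ (by rw [e2]; ring)
  have e4 : 1 - (c + s * Complex.I) ^ 2 = -(2 * s * Complex.I) * (c + s * Complex.I) := by
    linear_combination (-1 : ℂ) * h3 + s ^ 2 * h4
  have e5 : 1 + (c + s * Complex.I) ^ 2 = 2 * c * (c + s * Complex.I) := by
    linear_combination (-1 : ℂ) * h3 + s ^ 2 * h4
  rw [e2, e3, e4, e5, div_eq_div_iff
    (mul_ne_zero (neg_ne_zero.2 (mul_ne_zero (mul_ne_zero two_ne_zero hs') Complex.I_ne_zero)) hne)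
    hs']
  linear_combination (2 * c * s * (c + s * Complex.I)) * h4

/-- The weight of the form `cot (θ / 2)` on `z - 1`. -/
lemma halfCot_mul_norm_sub_one_sq {z : ℂ} (hz : ‖z‖ = 1) :
    halfCot (posAngle z) * ‖z - 1‖ ^ 2 = 2 * z.im := by
  have h1 : z.im = Real.sin (posAngle z) := by
    conv_lhs => rw [← exp_posAngle hz]
    rw [Complex.exp_ofReal_mul_I_im]
  have h2 : z.re = Real.cos (posAngle z) := by
    conv_lhs => rw [← exp_posAngle hz]
    rw [Complex.exp_ofReal_mul_I_re]
  have h3 : ‖z - 1‖ ^ 2 = 4 * Real.sin (posAngle z / 2) ^ 2 := by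
    rw [Complex.sq_norm, Complex.normSq_apply]
    simp only [Complex.sub_re, Complex.one_re, Complex.sub_im, Complex.one_im, sub_zero]
    rw [h1, h2]
    have e1 : posAngle z = 2 * (posAngle z / 2) := by ring
    have e2 := Real.sin_sq_add_cos_sq (posAngle z)
    have e3 : Real.cos (posAngle z) = 1 - 2 * Real.sin (posAngle z / 2) ^ 2 := by
      conv_lhs => rw [e1, Real.cos_two_mul]
      have := Real.sin_sq_add_cos_sq (posAngle z / 2)
      linarith
    have e4 : Real.sin (posAngle z) ^ 2 = 1 - Real.cos (posAngle z) ^ 2 := by linarith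
    nlinarith
  rw [h1, h3]
  have e1 : Real.sin (posAngle z) = 2 * Real.sin (posAngle z / 2) * Real.cos (posAngle z / 2) := by
    rw [← Real.sin_two_mul]; congr 1; ring
  rw [e1]
  unfold halfCot
  -- This is the case z = 1, where the quotient has the default value 0 and both sides vanish.
  by_cases hs : Real.sin (posAngle z / 2) = 0
  · rw [hs]; ring
  · field_simp
    ring

lemma posAngle_eq_zero_iff {z : ℂ} (hz : ‖z‖ = 1) : posAngle z = 0 ↔ z = 1 := by
  constructor
  · intro h
    rw [← exp_posAngle hz, h]; simp
  · rintro rfl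
    simp [posAngle]

end Cot

/-! ### Inertia under a small rotation of the angles -/

section Perturbation

open Module

variable {H ι : Type*} [NormedAddCommGroup H] [InnerProductSpace ℂ H] [FiniteDimensional ℂ H]
  [Fintype ι]

lemma continuous_weightForm (b : OrthonormalBasis ι ℂ H) (c : ι → ℝ) :
    Continuous (weightForm b c) := by
  unfold weightForm
  fun_prop

lemma weightForm_mono (b : OrthonormalBasis ι ℂ H) {c c' : ι → ℝ} {x : H}
    (h : ∀ k, inner ℂ (b k) x ≠ 0 → c k ≤ c' k) : weightForm b c x ≤ weightForm b c' x := by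
  refine Finset.sum_le_sum fun k _ => ?_
  by_cases hk : inner ℂ (b k) x = 0
  · simp [hk]
  · exact mul_le_mul_of_nonneg_right (h k hk) (by positivity)

lemma weightForm_smul (b : OrthonormalBasis ι ℂ H) (c : ι → ℝ) (a : ℂ) (x : H) :
    weightForm b c (a • x) = ‖a‖ ^ 2 * weightForm b c x := by
  unfold weightForm
  rw [Finset.mul_sum]
  refine Finset.sum_congr rfl fun k _ => ?_
  rw [inner_smul_right, norm_mul]
  ring

/-- If at each nonzero vector of a subspace some small perturbation of the form is positive, then
all small perturbations of the form are positive on the subspace. -/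
lemma eventually_weightForm_pos (b : OrthonormalBasis ι ℂ H) {θ : ι → ℝ} (hθ0 : ∀ k, 0 ≤ θ k)
    {η : ℝ} (hη : ∀ k, θ k + η < 2 * Real.pi) (S : Submodule ℂ H)
    (hS : ∀ x ∈ S, x ≠ 0 → ∃ δ, 0 < δ ∧ δ < η ∧ 0 < weightForm b (fun k => halfCot (θ k + δ)) x) :
    ∀ᶠ δ in 𝓝[>] (0 : ℝ), ∀ x ∈ S, x ≠ 0 → 0 < weightForm b (fun k => halfCot (θ k + δ)) x := by
  have hK : IsCompact ((S : Set H) ∩ Metric.sphere 0 1) :=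
    (isCompact_sphere (0 : H) 1).inter_left S.closed_of_finiteDimensional
  have key : ∀ᶠ δ in 𝓝[>] (0 : ℝ), ∀ x ∈ (S : Set H) ∩ Metric.sphere 0 1,
      0 < weightForm b (fun k => halfCot (θ k + δ)) x := by
    refine hK.induction_on (p := fun s => ∀ᶠ δ in 𝓝[>] (0 : ℝ), ∀ x ∈ s,
      0 < weightForm b (fun k => halfCot (θ k + δ)) x) (by simp) ?_ ?_ ?_
    · intro s t hst ht
      filter_upwards [ht] with δ hδ x hx using hδ x (hst hx)
    · intro s t hs ht
      filter_upwards [hs, ht] with δ hδ hδ' x hx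
      exact hx.elim (hδ x) (hδ' x)
    · intro x hx
      have hx0 : x ≠ 0 := by
        rintro rfl
        simpa using hx.2
      obtain ⟨δ, hδ0, hδη, hδ⟩ := hS x hx.1 hx0
      refine ⟨{y | 0 < weightForm b (fun k => halfCot (θ k + δ)) y}, mem_nhdsWithin_of_mem_nhds
        ((isOpen_lt continuous_const (continuous_weightForm b _)).mem_nhds hδ), ?_⟩
      -- The weights decrease in δ, so positivity at one δ persists for all smaller ones. This makes
      -- the local statement uniform on a neighbourhood, as the compactness argument requires.
      filter_upwards [Ioo_mem_nhdsGT hδ0] with δ' hδ' y hy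
      refine lt_of_lt_of_le hy (weightForm_mono b fun k _ => ?_)
      exact halfCot_le_halfCot (by linarith [hθ0 k, hδ'.1]) (by linarith [hδ'.2])
        (by linarith [hη k])
  filter_upwards [key] with δ hδ x hx hx0
  have hn : (‖x‖ : ℂ) ≠ 0 := by exact_mod_cast norm_ne_zero_iff.2 hx0
  have h1 := hδ ((‖x‖ : ℂ)⁻¹ • x) ⟨S.smul_mem _ hx, by
    rw [mem_sphere_zero_iff_norm, norm_smul, norm_inv, Complex.norm_real, norm_norm]
    exact inv_mul_cancel₀ (norm_ne_zero_iff.2 hx0)⟩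
  rw [weightForm_smul] at h1
  exact pos_of_mul_pos_right h1 (by positivity)

/-- For a small positive shift of the angles, the inertia of the form is determined by the
unshifted form on the subspace where that form is finite. -/
lemma eventually_exists_pos_nonpos (b : OrthonormalBasis ι ℂ H) {θ : ι → ℝ} (hθ0 : ∀ k, 0 ≤ θ k)
    (hθ1 : ∀ k, θ k < 2 * Real.pi) {D D₀ P₀ Z₀ : Submodule ℂ H}
    (hD₀ : ∀ x, x ∈ D₀ ↔ x ∈ D ∧ ∀ k, θ k = 0 → inner ℂ (b k) x = 0)
    (hP₀ : P₀ ≤ D₀) (hZ₀ : Z₀ ≤ D₀) (hdim : finrank ℂ P₀ + finrank ℂ Z₀ = finrank ℂ D₀)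
    (hP : ∀ x ∈ P₀, x ≠ 0 → 0 < weightForm b (fun k => halfCot (θ k)) x)
    (hZ : ∀ x ∈ Z₀, weightForm b (fun k => halfCot (θ k)) x ≤ 0) :
    ∀ᶠ δ in 𝓝[>] (0 : ℝ), ∃ S Z : Submodule ℂ H, S ≤ D ∧ Z ≤ D ∧
      finrank ℂ S + finrank ℂ Z = finrank ℂ D ∧
      finrank ℂ S + finrank ℂ D₀ = finrank ℂ P₀ + finrank ℂ D ∧
      (∀ x ∈ S, x ≠ 0 → 0 < weightForm b (fun k => halfCot (θ k + δ)) x) ∧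
      (∀ x ∈ Z, weightForm b (fun k => halfCot (θ k + δ)) x ≤ 0) := by
  have hD₀D : D₀ ≤ D := fun x hx => ((hD₀ x).1 hx).1
  obtain ⟨η, hη0, hη⟩ : ∃ η : ℝ, 0 < η ∧ ∀ k, θ k + η < 2 * Real.pi := by
    have : ∀ᶠ η in 𝓝[>] (0 : ℝ), ∀ k, θ k + η < 2 * Real.pi := by
      rw [eventually_all]
      intro k
      filter_upwards [Ioo_mem_nhdsGT (show 0 < 2 * Real.pi - θ k by linarith [hθ1 k])] with η h
      linarith [h.2]
    obtain ⟨η, h1, h2⟩ := (this.and self_mem_nhdsWithin).exists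
    exact ⟨η, h2, h1⟩
  -- A complement Y of D₀ in D. Its nonzero vectors have a component of angle 0, hence a weight that
  -- explodes as δ → 0; this is why P₀ + Y becomes positive.
  obtain ⟨Y', hY'⟩ := Submodule.exists_isCompl (D₀.comap D.subtype)
  set Y := Y'.map D.subtype with hY
  have hYD : Y ≤ D := Submodule.map_subtype_le _ _
  have hinf : ∀ y ∈ Y, y ∈ D₀ → y = 0 := by
    rintro _ ⟨y, hy, rfl⟩ hy0
    have h2 : y ∈ D₀.comap D.subtype ⊓ Y' := ⟨hy0, hy⟩
    rw [hY'.inf_eq_bot, Submodule.mem_bot] at h2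
    rw [h2]; rfl
  have hYdim : finrank ℂ D₀ + finrank ℂ Y = finrank ℂ D := by
    have h1 := Submodule.finrank_add_eq_of_isCompl hY'
    rw [hY, Submodule.finrank_map_subtype_eq, ← h1]
    congr 1
    have h2 : (D₀.comap D.subtype).map D.subtype = D₀ := by
      rw [Submodule.map_comap_subtype, inf_eq_right.2 hD₀D]
    rw [← Submodule.finrank_map_subtype_eq D, h2]
  have hPY : P₀ ⊓ Y = ⊥ := by
    rw [eq_bot_iff]
    rintro x ⟨h1, h2⟩
    exact hinf x h2 (hP₀ h1)
  have hSdim : finrank ℂ (P₀ ⊔ Y : Submodule ℂ H) = finrank ℂ P₀ + finrank ℂ Y := by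
    have := Submodule.finrank_sup_add_finrank_inf_eq P₀ Y
    rwa [hPY, finrank_bot, add_zero] at this
  have hpos := eventually_weightForm_pos b hθ0 hη (P₀ ⊔ Y) (by
    intro x hx hx0
    -- The squared mass of x at angle 0. If s > 0, the term `halfCot δ * s` tends to +∞ and
    -- dominates. If s = 0, then x lies in P₀, where the limiting form is already positive.
    set s : ℝ := ∑ k, if θ k = 0 then ‖inner ℂ (b k) x‖ ^ 2 else 0 with hs
    have hs0 : 0 ≤ s := Finset.sum_nonneg fun k _ => by split_ifs <;> positivity
    have hform : ∀ δ, weightForm b (fun k => halfCot (θ k + δ)) x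
        = (∑ k, if θ k = 0 then 0 else halfCot (θ k + δ) * ‖inner ℂ (b k) x‖ ^ 2)
          + halfCot δ * s := by
      intro δ
      rw [hs, Finset.mul_sum, ← Finset.sum_add_distrib]
      refine Finset.sum_congr rfl fun k _ => ?_
      split_ifs with h
      · simp [h]
      · simp
    have hlim : Tendsto (fun δ => ∑ k, if θ k = 0 then 0 else
        halfCot (θ k + δ) * ‖inner ℂ (b k) x‖ ^ 2) (𝓝[>] 0)
        (𝓝 (weightForm b (fun k => halfCot (θ k)) x)) := by
      refine tendsto_finsetSum _ fun k _ => ?_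
      split_ifs with h
      · simp [h, halfCot_zero]
      · refine Tendsto.mul_const _ ?_
        have h1 : 0 < θ k := lt_of_le_of_ne (hθ0 k) (Ne.symm h)
        have h2 : ContinuousAt (fun δ => halfCot (θ k + δ)) 0 :=
          ContinuousAt.comp (f := fun δ => θ k + δ) (g := halfCot)
            (by simpa using continuousAt_halfCot h1 (hθ1 k)) (by fun_prop)
        have h3 := h2.tendsto
        simp only [add_zero] at h3
        exact h3.mono_left nhdsWithin_le_nhds
    have hev : ∀ᶠ δ in 𝓝[>] (0 : ℝ), 0 < weightForm b (fun k => halfCot (θ k + δ)) x := by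
      simp only [hform]
      rcases eq_or_lt_of_le hs0 with h0 | h0
      · have hk := (Finset.sum_eq_zero_iff_of_nonneg
          (fun k _ => by split_ifs <;> positivity)).1 h0.symm
        have hxD₀ : x ∈ D₀ := (hD₀ x).2 ⟨sup_le (hP₀.trans hD₀D) hYD hx, fun k hk0 => by
          have := hk k (Finset.mem_univ k)
          simpa [hk0] using this⟩
        have hxP : x ∈ P₀ := by
          obtain ⟨p, hp, y, hy, rfl⟩ := Submodule.mem_sup.1 hx
          have hy0 : y ∈ D₀ := by
            have := D₀.sub_mem hxD₀ (hP₀ hp)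
            simpa using this
          rw [hinf y hy hy0, add_zero]
          exact hp
        rw [← h0]
        simpa using hlim.eventually (lt_mem_nhds (hP x hxP hx0))
      · exact (hlim.add_atTop (tendsto_halfCot_zero.atTop_mul_const h0)).eventually_gt_atTop 0
    obtain ⟨δ, h1, h2⟩ := (hev.and (Ioo_mem_nhdsGT hη0)).exists
    exact ⟨δ, h2.1, h2.2, h1⟩)
  filter_upwards [hpos, Ioo_mem_nhdsGT hη0] with δ hδ hδη
  refine ⟨P₀ ⊔ Y, Z₀, sup_le (hP₀.trans hD₀D) hYD, hZ₀.trans hD₀D, by omega, by omega, hδ, ?_⟩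
  intro x hx
  -- On Z₀ only positive angles occur, and increasing them lowers the weights.
  refine le_trans (weightForm_mono b fun k hk => ?_) (hZ x hx)
  have h1 : θ k ≠ 0 := fun h => hk (((hD₀ x).1 (hZ₀ hx)).2 k h)
  exact halfCot_le_halfCot (lt_of_le_of_ne (hθ0 k) (Ne.symm h1)) (by linarith [hδη.1])
    (by linarith [hη k, hδη.2])

end Perturbation

/-! ### Change of the angle sum under a reflection: the general case -/

section Reflection

open Module Matrix

variable {H : Type*} [NormedAddCommGroup H] [InnerProductSpace ℂ H] [FiniteDimensional ℂ H]
  {ι κ : Type*} [Fintype ι] [DecidableEq ι] [Fintype κ] [DecidableEq κ]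

lemma finrank_map_of_disjoint_ker {V W : Type*} [AddCommGroup V] [Module ℂ V] [AddCommGroup W]
    [Module ℂ W] {f : V →ₗ[ℂ] W} {S : Submodule ℂ V} (h : ∀ x ∈ S, f x = 0 → x = 0) :
    finrank ℂ (S.map f) = finrank ℂ S := by
  rw [← LinearMap.range_domRestrict]
  refine LinearMap.finrank_range_of_inj (LinearMap.ker_eq_bot.1 ?_)
  rw [LinearMap.ker_eq_bot']
  intro x hx
  exact Subtype.ext (h x x.2 hx)

/-- The fixed vectors of a unitary operator. -/
def fixedSub (A : H ≃ₗᵢ[ℂ] H) : Submodule ℂ H :=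
  LinearMap.ker ((A.toLinearEquiv : H →ₗ[ℂ] H) - LinearMap.id)

lemma mem_fixedSub {A : H ≃ₗᵢ[ℂ] H} {x : H} : x ∈ fixedSub A ↔ A x = x := by
  rw [fixedSub, LinearMap.mem_ker, LinearMap.sub_apply, sub_eq_zero]
  rfl

/-- The vectors which a unitary operator moves along a subspace. -/
def moveSub (A : H ≃ₗᵢ[ℂ] H) (D : Submodule ℂ H) : Submodule ℂ H :=
  D.comap ((A.toLinearEquiv : H →ₗ[ℂ] H) - LinearMap.id)

lemma mem_moveSub {A : H ≃ₗᵢ[ℂ] H} {D : Submodule ℂ H} {x : H} :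
    x ∈ moveSub A D ↔ A x - x ∈ D := Iff.rfl

lemma inner_eigenbasis {A : H ≃ₗᵢ[ℂ] H} {b : OrthonormalBasis ι ℂ H} {α : ι → ℂ}
    (hb : ∀ k, A (b k) = α k • b k) (k : ι) (x : H) :
    inner ℂ (b k) (A x) = α k * inner ℂ (b k) x := by
  have h1 : A x = ∑ j, (inner ℂ (b j) x * α j) • b j := by
    conv_lhs => rw [← b.sum_repr' x]
    rw [map_sum]
    exact Finset.sum_congr rfl fun j _ => by rw [map_smul, hb, smul_smul]
  rw [h1, inner_sum]
  simp only [inner_smul_right, OrthonormalBasis.inner_eq_ite, mul_ite, mul_one, mul_zero,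
    Finset.sum_ite_eq, Finset.mem_univ, if_true]
  ring

lemma toMatrix_eigenbasis {A : H ≃ₗᵢ[ℂ] H} {b : OrthonormalBasis ι ℂ H} {α : ι → ℂ}
    (hb : ∀ k, A (b k) = α k • b k) :
    LinearMap.toMatrix b.toBasis b.toBasis (A.toLinearEquiv : H →ₗ[ℂ] H) = diagonal α := by
  ext i j
  rw [LinearMap.toMatrix_apply, b.coe_toBasis, b.coe_toBasis_repr_apply, b.repr_apply_apply]
  change inner ℂ (b i) (A (b j)) = _
  rw [hb, inner_smul_right, b.inner_eq_ite, diagonal_apply]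
  by_cases h : i = j
  · subst h; simp
  · simp [h]

lemma toMatrix_reflection (b : OrthonormalBasis ι ℂ H) {D : Submodule ℂ H}
    (e : OrthonormalBasis κ ℂ D) :
    LinearMap.toMatrix b.toBasis b.toBasis (Dᗮ.reflection.toLinearEquiv : H →ₗ[ℂ] H)
      = 1 - (2 : ℂ) • (Matrix.of (fun k j => inner ℂ (b k) (e j : H))
          * (Matrix.of (fun k j => inner ℂ (b k) (e j : H)))ᴴ) := by
  ext i j
  rw [LinearMap.toMatrix_apply, b.coe_toBasis, b.coe_toBasis_repr_apply, b.repr_apply_apply]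
  change inner ℂ (b i) (Dᗮ.reflection (b j)) = _
  rw [Submodule.reflection_orthogonal_apply, Submodule.reflection_apply,
    Submodule.starProjection_apply, e.orthogonalProjectionOnto_apply_eq_sum]
  push_cast
  rw [neg_sub, inner_sub_right, b.inner_eq_ite, two_smul, inner_add_right, inner_sum]
  simp only [inner_smul_right, Matrix.sub_apply, Matrix.smul_apply, mul_apply, of_apply, conjTranspose_apply,
    one_apply, smul_eq_mul, RCLike.star_def, inner_conj_symm]
  rw [← two_mul]
  congr 2
  exact Finset.sum_congr rfl fun k _ => mul_comm _ _

lemma conjTranspose_mul_self_of_orthonormalBasis (b : OrthonormalBasis ι ℂ H) {D : Submodule ℂ H}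
    (e : OrthonormalBasis κ ℂ D) :
    (Matrix.of (fun k j => inner ℂ (b k) (e j : H)))ᴴ
      * Matrix.of (fun k j => inner ℂ (b k) (e j : H)) = (1 : Matrix κ κ ℂ) := by
  ext i j
  simp only [mul_apply, of_apply, conjTranspose_apply, RCLike.star_def, inner_conj_symm]
  rw [b.sum_inner_mul_inner, one_apply]
  exact e.inner_eq_ite i j

/-- The bound says that the rotation does not carry z across the point 1, where the angle would lose
2π. -/
lemma posAngle_exp_mul {z : ℂ} (hz : ‖z‖ = 1) {δ : ℝ} (h0 : 0 < δ)
    (h1 : posAngle z + δ < 2 * Real.pi) :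
    posAngle (Complex.exp (δ * Complex.I) * z) = posAngle z + δ := by
  have : Complex.exp (δ * Complex.I) * z = Complex.exp ((posAngle z + δ : ℝ) * Complex.I) := by
    conv_lhs => rw [← exp_posAngle hz]
    rw [← Complex.exp_add]
    congr 1
    push_cast
    ring
  rw [this, posAngle_exp (by linarith [posAngle_nonneg z]) h1]

/-- A - 1 is inverted on the orthogonal complement of the fixed vectors. The default inverse 0 for α
k = 1 is harmless, since those coordinates of x vanish. -/
lemma exists_inverse_sub_id {A : H ≃ₗᵢ[ℂ] H} {b : OrthonormalBasis ι ℂ H} {α : ι → ℂ}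
    (hb : ∀ k, A (b k) = α k • b k) :
    ∃ G : H →ₗ[ℂ] H, ∀ x, (∀ k, α k = 1 → inner ℂ (b k) x = 0) → A (G x) - G x = x := by
  refine ⟨∑ k, (α k - 1)⁻¹ • (innerₛₗ ℂ (b k)).smulRight (b k), fun x hx => ?_⟩
  simp only [LinearMap.sum_apply, LinearMap.smul_apply, LinearMap.smulRight_apply,
    innerₛₗ_apply_apply, map_sum, map_smul, hb]
  rw [← Finset.sum_sub_distrib]
  conv_rhs => rw [← b.sum_repr' x]
  refine Finset.sum_congr rfl fun k _ => ?_
  by_cases hk : α k = 1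
  · simp [hx k hk]
  · have : α k - 1 ≠ 0 := sub_ne_zero.2 hk
    rw [smul_smul, smul_smul, smul_smul, ← sub_smul]
    congr 1
    field_simp

/-- The form of angles on `A h - h`. -/
lemma weightForm_sub_id {A : H ≃ₗᵢ[ℂ] H} {b : OrthonormalBasis ι ℂ H} {α : ι → ℂ}
    (hb : ∀ k, A (b k) = α k • b k) (hα : ∀ k, ‖α k‖ = 1) (h : H) :
    weightForm b (fun k => halfCot (posAngle (α k))) (A h - h) = 2 * (inner ℂ h (A h)).im := by
  rw [← b.sum_inner_mul_inner, Complex.im_sum, Finset.mul_sum]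
  unfold weightForm
  refine Finset.sum_congr rfl fun k _ => ?_
  have h1 : inner ℂ (b k) (A h - h) = (α k - 1) * inner ℂ (b k) h := by
    rw [inner_sub_right, inner_eigenbasis hb]; ring
  have h2 : inner ℂ h (b k) * inner ℂ (b k) (A h)
      = ((‖inner ℂ (b k) h‖ ^ 2 : ℝ) : ℂ) * α k := by
    rw [inner_eigenbasis hb, ← inner_conj_symm h]
    push_cast
    rw [← Complex.conj_mul']
    ring
  rw [h1, h2, norm_mul, mul_pow, ← mul_assoc, halfCot_mul_norm_sub_one_sq (hα k),
    Complex.im_ofReal_mul]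
  ring

/-- The change of the sum of the arguments of the eigenvalues of a unitary operator under the
reflection in the orthogonal complement of a subspace. -/
theorem angleSum_reflection_sub (A : H ≃ₗᵢ[ℂ] H) (D : Submodule ℂ H) :
    ∃ p : ℕ, (∃ S : Submodule ℂ H, S ≤ moveSub A D ∧ finrank ℂ S = p ∧
        ∀ h ∈ S, h ≠ 0 → 0 < (inner ℂ h (A h)).im) ∧
      (∀ S : Submodule ℂ H, S ≤ moveSub A D →
        (∀ h ∈ S, h ≠ 0 → 0 < (inner ℂ h (A h)).im) → finrank ℂ S ≤ p) ∧
      angleSum ((A.trans Dᗮ.reflection).toLinearEquiv : H →ₗ[ℂ] H)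
          - angleSum (A.toLinearEquiv : H →ₗ[ℂ] H)
        = Real.pi * (2 * (p + finrank ℂ D - finrank ℂ (D ⊓ (fixedSub A)ᗮ : Submodule ℂ H))
          - finrank ℂ D) := by
  obtain ⟨b, α, hbα⟩ := exists_orthonormalBasis_eigenvectors A
  have hb := fun k => (hbα k).1
  have hα := fun k => (hbα k).2
  -- The range of A - 1 is the orthogonal complement of the fixed vectors, so D₀ consists of the
  -- displacements A h - h that lie in D. It is also the part of D on which no weight becomes
  -- infinite.
  set D₀ : Submodule ℂ H := D ⊓ (fixedSub A)ᗮ with hD₀def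
  have hD₀ : ∀ x, x ∈ D₀ ↔ x ∈ D ∧ ∀ k, posAngle (α k) = 0 → inner ℂ (b k) x = 0 := by
    intro x
    rw [hD₀def, Submodule.mem_inf]
    refine and_congr_right fun _ => ?_
    constructor
    · intro hx k hk
      apply hx
      rw [mem_fixedSub, hb, (posAngle_eq_zero_iff (hα k)).1 hk, one_smul]
    · intro hx y hy
      rw [mem_fixedSub] at hy
      rw [← b.sum_inner_mul_inner]
      refine Finset.sum_eq_zero fun k _ => ?_
      by_cases hk : α k = 1
      · rw [hx k ((posAngle_eq_zero_iff (hα k)).2 hk), mul_zero]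
      · have h1 := inner_eigenbasis hb k y
        rw [hy] at h1
        have h2 : (1 - α k) * inner ℂ (b k) y = 0 := by rw [sub_mul, one_mul, ← h1, sub_self]
        have h3 := (mul_eq_zero.1 h2).resolve_left (sub_ne_zero.2 (Ne.symm hk))
        rw [← inner_conj_symm, h3, map_zero, zero_mul]
  obtain ⟨e₀, lam₀, he₀⟩ := exists_orthonormalBasis_compression b
    (fun k => halfCot (posAngle (α k))) D₀
  obtain ⟨P₀, Z₀, hP₀, hZ₀, -, hdim, hP, hZ⟩ := exists_pos_nonpos_subspaces he₀
  refine ⟨finrank ℂ P₀, ?_, ?_, ?_⟩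
  · obtain ⟨G, hG⟩ := exists_inverse_sub_id hb
    have hG' : ∀ x ∈ P₀, A (G x) - G x = x := fun x hx => hG x fun k hk =>
      ((hD₀ x).1 (hP₀ hx)).2 k ((posAngle_eq_zero_iff (hα k)).2 hk)
    refine ⟨P₀.map G, ?_, ?_, ?_⟩
    · rintro _ ⟨x, hx, rfl⟩
      rw [mem_moveSub, hG' x hx]
      exact ((hD₀ x).1 (hP₀ hx)).1
    · refine finrank_map_of_disjoint_ker fun x hx h0 => ?_
      rw [← hG' x hx, h0, map_zero, sub_zero]
    · rintro _ ⟨x, hx, rfl⟩ hne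
      have h1 := weightForm_sub_id hb hα (G x)
      rw [hG' x hx] at h1
      have h2 := hP x hx (by rintro rfl; exact hne (map_zero G))
      linarith
  · intro S hS hpos
    -- A positive S contains no nonzero fixed vector, so A - 1 maps it injectively onto a positive
    -- subspace of D₀, which meets Z₀ only in 0.
    set B : H →ₗ[ℂ] H := (A.toLinearEquiv : H →ₗ[ℂ] H) - LinearMap.id with hB
    have hBx : ∀ x, B x = A x - x := fun x => rfl
    have hker : ∀ x ∈ S, B x = 0 → x = 0 := by
      intro x hx h0
      by_contra hne
      have h1 := hpos x hx hne
      rw [hBx, sub_eq_zero] at h0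
      have h2 : (inner ℂ x x).im = 0 := inner_self_im (𝕜 := ℂ) x
      rw [h0, h2] at h1
      exact lt_irrefl _ h1
    have hfin : finrank ℂ (S.map B) = finrank ℂ S := finrank_map_of_disjoint_ker hker
    have hSD₀ : S.map B ≤ D₀ := by
      rintro _ ⟨x, hx, rfl⟩
      refine (hD₀ _).2 ⟨hS hx, fun k hk => ?_⟩
      rw [hBx, inner_sub_right, inner_eigenbasis hb, (posAngle_eq_zero_iff (hα k)).1 hk, one_mul,
        sub_self]
    have hinf : S.map B ⊓ Z₀ = ⊥ := by
      refine inf_eq_bot_of_pos_of_nonpos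
        (q := weightForm b fun k => halfCot (posAngle (α k))) ?_ hZ
      rintro _ ⟨x, hx, rfl⟩ hne
      rw [hBx, weightForm_sub_id hb hα]
      have := hpos x hx (by rintro rfl; exact hne (map_zero B))
      linarith
    have := finrank_add_le_of_disjoint hSD₀ hZ₀ hinf
    omega
  · set E : H ≃ₗᵢ[ℂ] H := A.trans Dᗮ.reflection with hE
    have hev := eventually_exists_pos_nonpos b (fun k => posAngle_nonneg (α k))
      (fun k => posAngle_lt (α k)) hD₀ hP₀ hZ₀ hdim hP hZ
    have hev1 : ∀ᶠ δ in 𝓝[>] (0 : ℝ), ∀ k, posAngle (α k) + δ < 2 * Real.pi := by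
      rw [eventually_all]
      intro k
      filter_upwards [Ioo_mem_nhdsGT
        (show 0 < 2 * Real.pi - posAngle (α k) by linarith [posAngle_lt (α k)])] with η h
      linarith [h.2]
    have hev2 : ∀ᶠ δ in 𝓝[>] (0 : ℝ),
        ∀ β ∈ (LinearMap.charpoly (E.toLinearEquiv : H →ₗ[ℂ] H)).roots.toFinset,
          posAngle β + δ < 2 * Real.pi := by
      rw [eventually_all_finset]
      intro β _
      filter_upwards [Ioo_mem_nhdsGT
        (show 0 < 2 * Real.pi - posAngle β by linarith [posAngle_lt β])] with η h
      linarith [h.2]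
    -- One δ > 0 small enough to fix the inertia of the shifted form on D and to keep the
    -- eigenvalues of both A and E from completing a turn. After the rotation neither has the
    -- eigenvalue 1.
    obtain ⟨δ, ⟨⟨⟨S, Z, hSD, hZD, hSZ, hSdim, hS, hZ'⟩, hδ1⟩, hδ2⟩, hδ0⟩ :=
      ((hev.and hev1).and hev2).and self_mem_nhdsWithin |>.exists
    have hδ0 : 0 < δ := hδ0
    obtain ⟨e, lam, he⟩ := exists_orthonormalBasis_compression b
      (fun k => halfCot (posAngle (α k) + δ)) D
    have hcard := card_pos_eq_of_subspaces he hSD hZD hSZ hS hZ'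
    set C : Matrix (Fin (finrank ℂ H)) (Fin (finrank ℂ D)) ℂ :=
      Matrix.of (fun k j => inner ℂ (b k) (e j : H)) with hC
    set u := Complex.exp (δ * Complex.I) with hu
    have hu1 : ‖u‖ = 1 := Complex.norm_exp_ofReal_mul_I δ
    have hu0 : u ≠ 0 := Complex.exp_ne_zero _
    set B := (1 - (2 : ℂ) • (C * Cᴴ)) * diagonal α with hB
    have hBroots : B.charpoly.roots = (LinearMap.charpoly (E.toLinearEquiv : H →ₗ[ℂ] H)).roots := by
      have h1 : (E.toLinearEquiv : H →ₗ[ℂ] H)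
          = (Dᗮ.reflection.toLinearEquiv : H →ₗ[ℂ] H) ∘ₗ (A.toLinearEquiv : H →ₗ[ℂ] H) := rfl
      rw [← LinearMap.charpoly_toMatrix _ b.toBasis, h1,
        LinearMap.toMatrix_comp b.toBasis b.toBasis b.toBasis, toMatrix_reflection b e,
        toMatrix_eigenbasis hb]
    have hAroots : (LinearMap.charpoly (A.toLinearEquiv : H →ₗ[ℂ] H)).roots
        = Finset.univ.val.map α := by
      rw [← LinearMap.charpoly_toMatrix _ b.toBasis, toMatrix_eigenbasis hb, roots_charpoly_diagonal]
    have hBu : (1 - (2 : ℂ) • (C * Cᴴ)) * diagonal (fun k => u * α k) = u • B := by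
      rw [hB, ← mul_smul_comm, ← diagonal_smul]
      rfl
    have hangle : ∀ β ∈ B.charpoly.roots, posAngle (u * β) = posAngle β + δ := by
      intro β hβ
      rw [hBroots] at hβ
      exact posAngle_exp_mul (norm_of_mem_roots E hβ) hδ0 (hδ2 β (Multiset.mem_toFinset.2 hβ))
    have hαangle : ∀ k, posAngle (u * α k) = posAngle (α k) + δ := fun k =>
      posAngle_exp_mul (hα k) hδ0 (hδ1 k)
    have hne1 : ∀ z, 0 < posAngle z → z ≠ 1 := by
      rintro z hz rfl
      rw [(posAngle_eq_zero_iff (by simp)).2 rfl] at hz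
      exact lt_irrefl _ hz
    obtain ⟨hlam0, hsum⟩ := sum_posAngle_reflection_diagonal
      (conjTranspose_mul_self_of_orthonormalBasis b e) (α := fun k => u * α k) (lam := lam)
      (fun k => by rw [norm_mul, hu1, hα k, mul_one])
      (fun k => hne1 _ (by rw [hαangle]; linarith [posAngle_nonneg (α k)]))
      (by
        have hcay : (fun k => (1 + u * α k) / (1 - u * α k))
            = fun k => Complex.I * halfCot (posAngle (α k) + δ) := by
          funext k
          have : u * α k = Complex.exp ((posAngle (α k) + δ : ℝ) * Complex.I) := by
            rw [← hαangle, exp_posAngle (by rw [norm_mul, hu1, hα k, mul_one])]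
          rw [this, cayley_exp (by linarith [posAngle_nonneg (α k)]) (hδ1 k)]
        rw [hcay]
        ext i j
        rw [mul_apply]
        simp only [mul_diagonal, conjTranspose_apply, of_apply, RCLike.star_def, inner_conj_symm,
          diagonal_apply]
        have h1 := he i j
        calc _ = Complex.I * ∑ k, inner ℂ (e i : H) (b k)
              * (halfCot (posAngle (α k) + δ) * inner ℂ (b k) (e j : H)) := by
              rw [Finset.mul_sum]
              exact Finset.sum_congr rfl fun k _ => by ring
          _ = _ := by
              rw [h1]
              by_cases hij : i = j
              · subst hij; simp
              · simp [hij])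
      (by
        rw [← hC, hBu, roots_charpoly_smul B hu0]
        intro z hz
        obtain ⟨β, hβ, rfl⟩ := Multiset.mem_map.1 hz
        refine ⟨?_, hne1 _ (by rw [hangle β hβ]; linarith [posAngle_nonneg β])⟩
        rw [norm_mul, hu1, one_mul]
        rw [hBroots] at hβ
        exact norm_of_mem_roots E hβ)
    rw [← hC, hBu, roots_charpoly_smul B hu0, Multiset.map_map] at hsum
    have hcB : (B.charpoly.roots.card : ℝ) = finrank ℂ H := by
      rw [IsAlgClosed.card_roots_eq_natDegree, Matrix.charpoly_natDegree_eq_dim, Fintype.card_fin]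
    have s1 : (B.charpoly.roots.map (posAngle ∘ fun β => u * β)).sum
        = angleSum (E.toLinearEquiv : H →ₗ[ℂ] H) + finrank ℂ H * δ := by
      have : B.charpoly.roots.map (posAngle ∘ fun β => u * β)
          = B.charpoly.roots.map fun β => posAngle β + δ :=
        Multiset.map_congr rfl fun β hβ => hangle β hβ
      rw [this, Multiset.sum_map_add, Multiset.map_const', Multiset.sum_replicate, nsmul_eq_mul,
        hcB, hBroots]
      rfl
    have s2 : ∑ k, posAngle (u * α k)
        = angleSum (A.toLinearEquiv : H →ₗ[ℂ] H) + finrank ℂ H * δ := by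
      rw [Finset.sum_congr rfl fun k _ => hαangle k, Finset.sum_add_distrib, Finset.sum_const,
        Finset.card_univ, Fintype.card_fin, nsmul_eq_mul]
      unfold angleSum
      rw [hAroots, Multiset.map_map]
      rfl
    have s3 : (∑ j, if 0 < lam j then (1 : ℝ) else -1) = 2 * finrank ℂ S - finrank ℂ D := by
      have h1 : ∀ j, (if 0 < lam j then (1 : ℝ) else -1) = 2 * (if 0 < lam j then 1 else 0) - 1 := by
        intro j; split_ifs <;> ring
      rw [Finset.sum_congr rfl fun j _ => h1 j, Finset.sum_sub_distrib, ← Finset.mul_sum,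
        Finset.sum_boole, hcard]
      simp
    -- The rotation has added the same amount, dim H · δ, to both angle sums.
    rw [s1, s2, s3] at hsum
    have hdim' : (finrank ℂ S : ℝ) + finrank ℂ D₀ = finrank ℂ P₀ + finrank ℂ D := by
      exact_mod_cast hSdim
    have : (finrank ℂ S : ℝ) = finrank ℂ P₀ + finrank ℂ D - finrank ℂ D₀ := by linarith
    rw [this] at hsum
    linarith

end Reflection

/-! ### Conjugation invariance of the spectral flow -/

section Conjugation

variable {X Y : Type*} [NormedAddCommGroup X] [InnerProductSpace ℂ X] [FiniteDimensional ℂ X]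
  [NormedAddCommGroup Y] [InnerProductSpace ℂ Y] [FiniteDimensional ℂ Y]

/-- The spectral flow is invariant under conjugation by a fixed isometry. -/
lemma IsSpectralFlow.conj {A : ℝ → (X ≃ₗᵢ[ℂ] X)} {B : ℝ → (Y ≃ₗᵢ[ℂ] Y)} {a b : ℝ} {m : ℤ}
    (φ : X ≃ₗᵢ[ℂ] Y) (hAB : ∀ s ∈ Set.Icc a b, B s = φ.symm.trans ((A s).trans φ))
    (h : IsSpectralFlow A a b m) : IsSpectralFlow B a b m := by
  obtain ⟨hA, N, t, ε, h0, hN, hmono, hε, hne, hm⟩ := h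
  have hle : ∀ i j, i ≤ j → j ≤ N → t i ≤ t j := by
    intro i j hij
    induction j, hij using Nat.le_induction with
    | base => intro _; exact le_rfl
    | succ j hij ih => intro hj; exact (ih (by omega)).trans (hmono j (by omega))
  have hmem : ∀ j ≤ N, t j ∈ Set.Icc a b := fun j hj =>
    ⟨h0 ▸ hle 0 j (by omega) hj, hN ▸ hle j N hj le_rfl⟩
  have hchar : ∀ s ∈ Set.Icc a b, LinearMap.charpoly ((B s).toLinearEquiv : Y →ₗ[ℂ] Y)
      = LinearMap.charpoly ((A s).toLinearEquiv : X →ₗ[ℂ] X) := by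
    intro s hs
    rw [hAB s hs, ← LinearEquiv.charpoly_conj φ.toLinearEquiv]
    rfl
  have harc : ∀ s ∈ Set.Icc a b, ∀ ε, arcCount ((B s).toLinearEquiv : Y →ₗ[ℂ] Y) ε
      = arcCount ((A s).toLinearEquiv : X →ₗ[ℂ] X) ε := by
    intro s hs ε
    rw [arcCount, arcCount, hchar s hs]
  refine ⟨?_, N, t, ε, h0, hN, hmono, hε, ?_, ?_⟩
  · have h1 : ContinuousOn (fun s => (φ.toContinuousLinearEquiv : X →L[ℂ] Y)
        ∘L ((A s).toContinuousLinearEquiv : X →L[ℂ] X)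
        ∘L (φ.symm.toContinuousLinearEquiv : Y →L[ℂ] X)) (Set.Icc a b) :=
      continuousOn_const.clm_comp (hA.clm_comp continuousOn_const)
    refine h1.congr fun s hs => ?_
    simp only
    rw [hAB s hs]
    rfl
  · intro j hj s hs hev
    have hs' : s ∈ Set.Icc a b :=
      ⟨(hmem j hj.le).1.trans hs.1, hs.2.trans (hmem (j + 1) hj).2⟩
    refine hne j hj s hs ?_
    rw [Module.End.hasEigenvalue_iff_isRoot_charpoly] at hev ⊢
    rwa [← hchar s hs']
  · rw [hm]
    refine Finset.sum_congr rfl fun j hj => ?_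
    have hj := Finset.mem_range.1 hj
    rw [harc _ (hmem _ hj), harc _ (hmem _ hj.le)]

end Conjugation

/-! ### Lagrangian subspaces as unitary operators of ℂ²ⁿ -/

section Cayley

variable {n : ℕ}

/-- The linear map `(x, y, z, u) ↦ (x, -z)`. -/
def projB (n : ℕ) : C4n n →ₗ[ℂ] C2n n where
  toFun v := WithLp.toLp 2 (v.fst.fst, -v.snd.fst)
  map_add' v w := by
    apply (WithLp.equiv 2 _).injective
    ext <;> simp [add_comm]
  map_smul' c v := by
    apply (WithLp.equiv 2 _).injective
    ext <;> simp

lemma projYU_fst (v : C4n n) : (projYU n v).fst = v.fst.snd := rfl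

lemma projYU_snd (v : C4n n) : (projYU n v).snd = v.snd.snd := rfl

lemma projB_fst (v : C4n n) : (projB n v).fst = v.fst.fst := rfl

lemma projB_snd (v : C4n n) : (projB n v).snd = -v.snd.fst := rfl

lemma ext_C2n {v w : C2n n} (h1 : v.fst = w.fst) (h2 : v.snd = w.snd) : v = w :=
  (WithLp.equiv 2 _).injective (Prod.ext h1 h2)

/-- The vector `(x, y, z, u)` with `(y, u) = a` and `(x, -z) = b`. -/
def ofAB (a b : C2n n) : C4n n :=
  WithLp.toLp 2 (WithLp.toLp 2 (b.fst, a.fst), WithLp.toLp 2 (-b.snd, a.snd))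

@[simp] lemma projYU_ofAB (a b : C2n n) : projYU n (ofAB a b) = a := rfl

@[simp] lemma projB_ofAB (a b : C2n n) : projB n (ofAB a b) = b := by
  exact ext_C2n rfl (neg_neg _)

lemma ofAB_proj (v : C4n n) : ofAB (projYU n v) (projB n v) = v := by
  apply (WithLp.equiv 2 _).injective
  exact Prod.ext (ext_C2n rfl rfl) (ext_C2n (neg_neg _) rfl)

lemma ext_AB {v w : C4n n} (ha : projYU n v = projYU n w) (hb : projB n v = projB n w) :
    v = w := by
  rw [← ofAB_proj v, ← ofAB_proj w, ha, hb]

lemma norm_sq_eq_AB (v : C4n n) : ‖v‖ ^ 2 = ‖projYU n v‖ ^ 2 + ‖projB n v‖ ^ 2 := by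
  simp only [WithLp.prod_norm_sq_eq_of_L2, projYU_fst, projYU_snd, projB_fst, projB_snd, norm_neg]
  ring

lemma projYU_dblJ (v : C4n n) : projYU n (dblJ n v) = -projB n v := by
  exact ext_C2n rfl (neg_neg _).symm

lemma projB_dblJ (v : C4n n) : projB n (dblJ n v) = projYU n v := by
  exact ext_C2n (neg_neg _) (neg_neg _)

lemma mem_posEig {v : C4n n} : v ∈ posEig (dblJ n) ↔ projB n v = -(Complex.I • projYU n v) := by
  rw [LinearMap.mem_ker, LinearMap.sub_apply, sub_eq_zero, LinearMap.smul_apply, LinearMap.id_apply]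
  constructor
  · intro h
    rw [← map_smul, ← h, projYU_dblJ, neg_neg]
  · intro h
    apply ext_AB
    · rw [projYU_dblJ, h, neg_neg, map_smul]
    · rw [projB_dblJ, map_smul, h, smul_neg, smul_smul, Complex.I_mul_I, neg_smul, one_smul, neg_neg]

lemma mem_negEig {v : C4n n} : v ∈ negEig (dblJ n) ↔ projB n v = Complex.I • projYU n v := by
  rw [LinearMap.mem_ker, LinearMap.add_apply, LinearMap.smul_apply, LinearMap.id_apply,
    add_eq_zero_iff_eq_neg]
  constructor
  · intro h
    rw [← map_smul, ← neg_neg (Complex.I • v), ← h, map_neg, projYU_dblJ, neg_neg]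
  · intro h
    apply ext_AB
    · rw [projYU_dblJ, h, map_neg, map_smul]
    · rw [projB_dblJ, map_neg, map_smul, h, smul_smul, Complex.I_mul_I, neg_smul, one_smul, neg_neg]

/-- The real number `1 / √2` as a complex number. -/
def invSqrtTwo : ℂ := ((Real.sqrt 2)⁻¹ : ℝ)

lemma invSqrtTwo_ne_zero : invSqrtTwo ≠ 0 := by
  unfold invSqrtTwo
  exact_mod_cast (inv_pos.2 (Real.sqrt_pos.2 two_pos)).ne'

lemma norm_invSqrtTwo_sq : ‖invSqrtTwo‖ ^ 2 = 1 / 2 := by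
  unfold invSqrtTwo
  rw [Complex.norm_real, Real.norm_eq_abs, sq_abs, inv_pow, Real.sq_sqrt two_pos.le, one_div]

lemma norm_ofAB_smul {c : ℂ} (hc : ‖c‖ = 1) (h : C2n n) :
    ‖ofAB (invSqrtTwo • h) (c • invSqrtTwo • h)‖ = ‖h‖ := by
  have h1 := norm_sq_eq_AB (ofAB (invSqrtTwo • h) (c • invSqrtTwo • h))
  rw [projYU_ofAB, projB_ofAB, norm_smul c, hc, one_mul, norm_smul, mul_pow, norm_invSqrtTwo_sq] at h1
  have h2 : ‖ofAB (invSqrtTwo • h) (c • invSqrtTwo • h)‖ ^ 2 = ‖h‖ ^ 2 := by rw [h1]; ring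
  exact (sq_eq_sq₀ (norm_nonneg _) (norm_nonneg _)).1 h2

lemma ofAB_add (a b a' b' : C2n n) : ofAB (a + a') (b + b') = ofAB a b + ofAB a' b' := by
  apply ext_AB <;> simp

lemma ofAB_smul (c : ℂ) (a b : C2n n) : ofAB (c • a) (c • b) = c • ofAB a b := by
  apply ext_AB <;> simp

/-- The isometry `h ↦ (h, -i h) / √2` onto `ker (J - i)`. -/
def posIso (n : ℕ) : C2n n ≃ₗᵢ[ℂ] posEig (dblJ n) :=
  LinearIsometryEquiv.ofSurjective
    { toFun := fun h => ⟨ofAB (invSqrtTwo • h) ((-Complex.I) • invSqrtTwo • h), by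
        rw [mem_posEig, projYU_ofAB, projB_ofAB, neg_smul]⟩
      map_add' := fun h k => by
        apply Subtype.ext
        simp [← ofAB_add]
      map_smul' := fun c h => by
        apply Subtype.ext
        simp only [RingHom.id_apply, SetLike.mk_smul_mk, ← ofAB_smul]
        rw [smul_comm c, smul_comm c (-Complex.I), smul_comm c invSqrtTwo]
      norm_map' := fun h => norm_ofAB_smul (by simp) h }
    (by
      rintro ⟨v, hv⟩
      refine ⟨invSqrtTwo⁻¹ • projYU n v, Subtype.ext ?_⟩
      change ofAB (invSqrtTwo • invSqrtTwo⁻¹ • projYU n v) _ = v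
      rw [smul_smul invSqrtTwo, mul_inv_cancel₀ invSqrtTwo_ne_zero, one_smul]
      apply ext_AB
      · simp
      · rw [projB_ofAB, mem_posEig.1 hv, neg_smul])

/-- The isometry `h ↦ (h, i h) / √2` onto `ker (J + i)`. -/
def negIso (n : ℕ) : C2n n ≃ₗᵢ[ℂ] negEig (dblJ n) :=
  LinearIsometryEquiv.ofSurjective
    { toFun := fun h => ⟨ofAB (invSqrtTwo • h) (Complex.I • invSqrtTwo • h), by
        rw [mem_negEig, projYU_ofAB, projB_ofAB]⟩
      map_add' := fun h k => by
        apply Subtype.ext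
        simp [← ofAB_add]
      map_smul' := fun c h => by
        apply Subtype.ext
        simp only [RingHom.id_apply, SetLike.mk_smul_mk, ← ofAB_smul]
        rw [smul_comm c, smul_comm c Complex.I, smul_comm c invSqrtTwo]
      norm_map' := fun h => norm_ofAB_smul (by simp) h }
    (by
      rintro ⟨v, hv⟩
      refine ⟨invSqrtTwo⁻¹ • projYU n v, Subtype.ext ?_⟩
      change ofAB (invSqrtTwo • invSqrtTwo⁻¹ • projYU n v) _ = v
      rw [smul_smul invSqrtTwo, mul_inv_cancel₀ invSqrtTwo_ne_zero, one_smul]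
      apply ext_AB
      · simp
      · rw [projB_ofAB, mem_negEig.1 hv])

lemma coe_posIso (h : C2n n) :
    (posIso n h : C4n n) = ofAB (invSqrtTwo • h) ((-Complex.I) • invSqrtTwo • h) := rfl

lemma coe_negIso (h : C2n n) :
    (negIso n h : C4n n) = ofAB (invSqrtTwo • h) (Complex.I • invSqrtTwo • h) := rfl

/-- The linear map `a + i b`. -/
def projAdd (n : ℕ) : C4n n →ₗ[ℂ] C2n n := projYU n + Complex.I • projB n

/-- The linear map `a - i b`. -/
def projSub (n : ℕ) : C4n n →ₗ[ℂ] C2n n := projYU n - Complex.I • projB n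

lemma projAdd_apply (v : C4n n) : projAdd n v = projYU n v + Complex.I • projB n v := rfl

lemma projSub_apply (v : C4n n) : projSub n v = projYU n v - Complex.I • projB n v := rfl

lemma two_smul_projYU (v : C4n n) : (2 : ℂ) • projYU n v = projAdd n v + projSub n v := by
  rw [projAdd_apply, projSub_apply, two_smul]; abel

lemma two_smul_projB (v : C4n n) :
    (2 : ℂ) • projB n v = (-Complex.I) • (projAdd n v - projSub n v) := by
  rw [projAdd_apply, projSub_apply]
  have : projYU n v + Complex.I • projB n v - (projYU n v - Complex.I • projB n v)
      = (2 * Complex.I) • projB n v := by rw [mul_smul, two_smul]; abel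
  rw [this, smul_smul]
  congr 1
  linear_combination (2 : ℂ) * Complex.I_sq

lemma ext_addSub {v w : C4n n} (h1 : projAdd n v = projAdd n w) (h2 : projSub n v = projSub n w) :
    v = w := by
  have two : (2 : ℂ) ≠ 0 := two_ne_zero
  apply ext_AB
  · apply smul_right_injective _ two
    simp only [two_smul_projYU, h1, h2]
  · apply smul_right_injective _ two
    simp only [two_smul_projB, h1, h2]

/-- The vector with prescribed `a + i b` and `a - i b`. -/
lemma exists_projAdd_projSub (p q : C2n n) : ∃ v : C4n n, projAdd n v = p ∧ projSub n v = q := by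
  refine ⟨ofAB ((2 : ℂ)⁻¹ • (p + q)) ((2 : ℂ)⁻¹ • (-Complex.I) • (p - q)), ?_, ?_⟩
  · rw [projAdd_apply, projYU_ofAB, projB_ofAB, smul_comm Complex.I, smul_smul Complex.I,
      mul_neg, Complex.I_mul_I, neg_neg, one_smul, ← smul_add]
    have : p + q + (p - q) = (2 : ℂ) • p := by rw [two_smul]; abel
    rw [this, smul_smul, inv_mul_cancel₀ two_ne_zero, one_smul]
  · rw [projSub_apply, projYU_ofAB, projB_ofAB, smul_comm Complex.I, smul_smul Complex.I,
      mul_neg, Complex.I_mul_I, neg_neg, one_smul, ← smul_sub]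
    have : p + q - (p - q) = (2 : ℂ) • q := by rw [two_smul]; abel
    rw [this, smul_smul, inv_mul_cancel₀ two_ne_zero, one_smul]

/-- `u` is the unitary operator `a + i b ↦ a - i b` of the Lagrangian subspace `Λ`. -/
def IsCayley (Λ : Submodule ℂ (C4n n)) (u : C2n n ≃ₗᵢ[ℂ] C2n n) : Prop :=
  ∀ v, v ∈ Λ ↔ projSub n v = u (projAdd n v)

lemma IsCayley.unique {Λ : Submodule ℂ (C4n n)} {u u' : C2n n ≃ₗᵢ[ℂ] C2n n}
    (h : IsCayley Λ u) (h' : IsCayley Λ u') : u = u' := by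
  ext1 p
  obtain ⟨v, hv1, hv2⟩ := exists_projAdd_projSub p (u p)
  have h1 := (h v).2 (by rw [hv1, hv2])
  have h2 := (h' v).1 h1
  rw [hv1, hv2] at h2
  exact h2

lemma IsCayley.eq {Λ Λ' : Submodule ℂ (C4n n)} {u : C2n n ≃ₗᵢ[ℂ] C2n n}
    (h : IsCayley Λ u) (h' : IsCayley Λ' u) : Λ = Λ' :=
  Submodule.ext fun v => (h v).trans (h' v).symm

/-- On ker(J - i) the map a - ib vanishes and a + ib is √2 times the inverse of `posIso`; on ker(J +
i) the roles are exchanged. -/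
lemma isCayley_isometryGraph (U : posEig (dblJ n) ≃ₗᵢ[ℂ] negEig (dblJ n)) :
    IsCayley (isometryGraph (dblJ n) U) ((posIso n).trans (U.trans (negIso n).symm)) := by
  have hp : ∀ h : C2n n, projAdd n (posIso n h) = (2 * invSqrtTwo) • h ∧ projSub n (posIso n h) = 0 := by
    intro h
    rw [projAdd_apply, projSub_apply, coe_posIso, projYU_ofAB, projB_ofAB, smul_smul Complex.I,
      mul_neg, Complex.I_mul_I, neg_neg, one_smul, sub_self, mul_smul, two_smul]
    exact ⟨rfl, rfl⟩
  have hn : ∀ h : C2n n, projAdd n (negIso n h) = 0 ∧ projSub n (negIso n h) = (2 * invSqrtTwo) • h := by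
    intro h
    rw [projAdd_apply, projSub_apply, coe_negIso, projYU_ofAB, projB_ofAB, smul_smul Complex.I,
      Complex.I_mul_I, neg_one_smul, add_neg_cancel, sub_neg_eq_add, mul_smul, two_smul]
    exact ⟨rfl, rfl⟩
  have hmem : ∀ v, v ∈ isometryGraph (dblJ n) U ↔ ∃ h : C2n n, v = (posIso n h : C4n n)
      + (negIso n (((posIso n).trans (U.trans (negIso n).symm)) h) : C4n n) := by
    intro v
    rw [isometryGraph, LinearMap.mem_range]
    constructor
    · rintro ⟨x, rfl⟩
      refine ⟨(posIso n).symm x, ?_⟩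
      simp
    · rintro ⟨h, rfl⟩
      refine ⟨posIso n h, ?_⟩
      simp
  intro v
  rw [hmem]
  set u := (posIso n).trans (U.trans (negIso n).symm)
  constructor
  · rintro ⟨h, rfl⟩
    rw [map_add, map_add, (hp h).1, (hp h).2, (hn _).1, (hn _).2, zero_add, add_zero, map_smul]
  · intro h
    refine ⟨(2 * invSqrtTwo)⁻¹ • projAdd n v, ?_⟩
    have hne : (2 * invSqrtTwo) ≠ 0 := mul_ne_zero two_ne_zero invSqrtTwo_ne_zero
    apply ext_addSub
    · rw [map_add, (hp _).1, (hn _).1, add_zero, smul_smul, mul_inv_cancel₀ hne, one_smul]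
    · rw [map_add, (hp _).2, (hn _).2, zero_add, map_smul, smul_smul, mul_inv_cancel₀ hne, one_smul,
        h]

lemma mem_WR {R : Submodule ℂ (C2n n)} {v : C4n n} :
    v ∈ WR R ↔ projB n v ∈ Rᗮ ∧ projYU n v ∈ R := Iff.rfl

/-- The reflection fixes R and negates R^⊥, which gives one direction. Conversely, with P the
projection to R, the equation reduces to a - Pa = iPb, whose sides lie in R^⊥ and R and so both
vanish. -/
lemma isCayley_WR (R : Submodule ℂ (C2n n)) : IsCayley (WR R) R.reflection := by
  intro v
  rw [mem_WR, projSub_apply, projAdd_apply, map_add, map_smul]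
  set a := projYU n v
  set b := projB n v
  constructor
  · rintro ⟨hb, ha⟩
    rw [Submodule.reflection_mem_subspace_eq_self ha,
      Submodule.reflection_mem_subspace_orthogonalComplement_eq_neg hb, smul_neg, sub_eq_add_neg]
  · intro h
    rw [Submodule.reflection_apply, Submodule.reflection_apply] at h
    have h1 : a - R.starProjection a = Complex.I • R.starProjection b := by
      have h2 : (2 : ℂ) • (a - R.starProjection a) = (2 : ℂ) • Complex.I • R.starProjection b := by
        have e1 : (2 : ℕ) • R.starProjection a = (2 : ℂ) • R.starProjection a := by
          rw [two_smul, two_smul]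
        have e2 : (2 : ℕ) • R.starProjection b = (2 : ℂ) • R.starProjection b := by
          rw [two_smul, two_smul]
        rw [e1, e2] at h
        linear_combination (norm := module) h
      exact smul_right_injective _ (two_ne_zero (α := ℂ)) h2
    have h2 : a - R.starProjection a ∈ Rᗮ := Submodule.sub_starProjection_mem_orthogonal a
    have h3 : a - R.starProjection a ∈ R := by
      rw [h1]
      exact R.smul_mem _ (Submodule.starProjection_apply_mem R b)
    have h4 : a - R.starProjection a = 0 := by
      have := Submodule.inf_orthogonal_eq_bot R
      rw [← Submodule.mem_bot ℂ, ← this]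
      exact ⟨h3, h2⟩
    rw [h4] at h1
    have h5 : R.starProjection b = 0 :=
      (smul_eq_zero.1 h1.symm).resolve_left Complex.I_ne_zero
    refine ⟨(Submodule.starProjection_apply_eq_zero_iff R).1 h5, ?_⟩
    rw [sub_eq_zero] at h4
    rw [h4]
    exact Submodule.starProjection_apply_mem R a

end Cayley

/-! ### Continuous curves of unitary operators -/

section Generic

variable {E : Type*} [NormedAddCommGroup E] [InnerProductSpace ℂ E] [FiniteDimensional ℂ E]

lemma continuousOn_trans {s : Set ℝ} {u : ℝ → (E ≃ₗᵢ[ℂ] E)} (w : E ≃ₗᵢ[ℂ] E)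
    (hu : ContinuousOn (fun t => ((u t).toContinuousLinearEquiv : E →L[ℂ] E)) s) :
    ContinuousOn (fun t => (((u t).trans w).toContinuousLinearEquiv : E →L[ℂ] E)) s :=
  continuousOn_const.clm_comp (g := fun _ => (w.toContinuousLinearEquiv : E →L[ℂ] E)) hu

/-- A continuous curve of pairs of operators with `‖Q w‖ = ‖P w‖` and `P` injective defines a
continuous curve of unitary operators `P w ↦ Q w`. -/
lemma exists_unitary_curve {s : Set ℝ} {M : ℝ → (E →L[ℂ] E)} (hM : ContinuousOn M s)
    (p₀ p₁ q₀ q₁ : E →ₗ[ℂ] E)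
    (hnorm : ∀ t ∈ s, ∀ w, ‖q₀ w + q₁ (M t w)‖ = ‖p₀ w + p₁ (M t w)‖)
    (hinj : ∀ t ∈ s, ∀ w, p₀ w + p₁ (M t w) = 0 → w = 0) :
    ∃ u : ℝ → (E ≃ₗᵢ[ℂ] E),
      (∀ t ∈ s, (∀ w, u t (p₀ w + p₁ (M t w)) = q₀ w + q₁ (M t w)) ∧
        ∀ x, ∃ w, p₀ w + p₁ (M t w) = x) ∧
      ContinuousOn (fun t => ((u t).toContinuousLinearEquiv : E →L[ℂ] E)) s := by
  let P : ℝ → (E →L[ℂ] E) := fun t =>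
    LinearMap.toContinuousLinearMap p₀ + LinearMap.toContinuousLinearMap p₁ ∘L M t
  let Q : ℝ → (E →L[ℂ] E) := fun t =>
    LinearMap.toContinuousLinearMap q₀ + LinearMap.toContinuousLinearMap q₁ ∘L M t
  have hP : ∀ t w, P t w = p₀ w + p₁ (M t w) := fun t w => rfl
  have hQ : ∀ t w, Q t w = q₀ w + q₁ (M t w) := fun t w => rfl
  have hPc : ContinuousOn P s := continuousOn_const.add (continuousOn_const.clm_comp hM)
  have hQc : ContinuousOn Q s := continuousOn_const.add (continuousOn_const.clm_comp hM)
  have h : ∀ t, ∃ u : E ≃ₗᵢ[ℂ] E, t ∈ s → (∀ w, u (P t w) = Q t w) ∧ IsUnit (P t) := by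
    intro t
    by_cases ht : t ∈ s
    · let e : E ≃ₗ[ℂ] E := LinearEquiv.ofInjectiveEndo (P t : E →ₗ[ℂ] E) (by
        rw [injective_iff_map_eq_zero]
        exact hinj t ht)
      have he : ∀ w, e w = P t w := fun w => rfl
      let u₀ : E →ₗᵢ[ℂ] E :=
        { toLinearMap := (Q t : E →ₗ[ℂ] E) ∘ₗ (e.symm : E →ₗ[ℂ] E)
          norm_map' := fun x => by
            obtain ⟨w, rfl⟩ := e.surjective x
            rw [LinearMap.comp_apply, LinearEquiv.coe_coe, e.symm_apply_apply]
            exact hnorm t ht w }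
      refine ⟨u₀.toLinearIsometryEquiv rfl, fun _ => ⟨fun w => ?_,
        ⟨ContinuousLinearEquiv.toUnit e.toContinuousLinearEquiv, by ext1 w; exact he w⟩⟩⟩
      change Q t (e.symm (e w)) = _
      rw [e.symm_apply_apply]
    -- Outside `s` the choice is arbitrary.
    · exact ⟨LinearIsometryEquiv.refl ℂ _, fun h => absurd h ht⟩
  choose u hu using h
  refine ⟨u, fun t ht => ⟨(hu t ht).1, fun x => ?_⟩, ?_⟩
  · obtain ⟨U, hU⟩ := (hu t ht).2
    refine ⟨(U⁻¹ : (E →L[ℂ] E)ˣ).1 x, ?_⟩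
    rw [← hP, ← hU]
    exact DFunLike.congr_fun U.mul_inv x
  -- On `s` the operator is Q P⁻¹, and inversion is continuous at units.
  · have h1 : ContinuousOn (fun t => Q t * Ring.inverse (P t)) s := by
      refine hQc.mul fun t ht => ?_
      obtain ⟨U, hU⟩ := (hu t ht).2
      have h2 : ContinuousAt Ring.inverse (P t) := by
        rw [← hU]
        exact NormedRing.inverse_continuousAt U
      exact ContinuousAt.comp_continuousWithinAt (f := P) h2 (hPc t ht)
    refine h1.congr fun t ht => ?_
    have h1 : ((u t).toContinuousLinearEquiv : E →L[ℂ] E) * P t = Q t := by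
      ext1 w; exact (hu t ht).1 w
    change ((u t).toContinuousLinearEquiv : E →L[ℂ] E) = Q t * Ring.inverse (P t)
    rw [← h1, mul_assoc, Ring.mul_inverse_cancel _ (hu t ht).2, mul_one]

end Generic

/-! ### Graphs of symplectic operators and the index as a spectral flow -/

section Graph

variable {n : ℕ}

lemma mem_Gr {M : C2n n →L[ℂ] C2n n} {v : C4n n} : v ∈ Gr M ↔ v.snd = M v.fst := Iff.rfl

/-- The linear map `w ↦ (w, 0)`. -/
def inFst (n : ℕ) : C2n n →ₗ[ℂ] C4n n where
  toFun w := WithLp.toLp 2 (w, 0)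
  map_add' v w := by
    apply (WithLp.equiv 2 _).injective
    simp
  map_smul' c v := by
    apply (WithLp.equiv 2 _).injective
    simp

/-- The linear map `w ↦ (0, w)`. -/
def inSnd (n : ℕ) : C2n n →ₗ[ℂ] C4n n where
  toFun w := WithLp.toLp 2 (0, w)
  map_add' v w := by
    apply (WithLp.equiv 2 _).injective
    simp
  map_smul' c v := by
    apply (WithLp.equiv 2 _).injective
    simp

lemma mem_Gr_iff {M : C2n n →L[ℂ] C2n n} {v : C4n n} :
    v ∈ Gr M ↔ v = inFst n v.fst + inSnd n (M v.fst) := by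
  rw [mem_Gr]
  have h : inFst n v.fst + inSnd n (M v.fst) = WithLp.toLp 2 (v.fst, M v.fst) := by
    apply (WithLp.equiv 2 _).injective
    simp [inFst, inSnd]
  rw [h]
  constructor
  · intro hv
    rw [← hv]
    rfl
  · intro hv
    exact congrArg WithLp.snd hv

lemma inFst_add_inSnd_mem_Gr (M : C2n n →L[ℂ] C2n n) (w : C2n n) :
    inFst n w + inSnd n (M w) ∈ Gr M := by
  rw [mem_Gr]
  simp [inFst, inSnd]

lemma fst_inFst_add_inSnd (w w' : C2n n) : (inFst n w + inSnd n w').fst = w := by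
  simp [inFst, inSnd]

/-- The symplectic form vanishes on the graph of a symplectic operator. -/
lemma inner_projYU_projB_of_mem_Gr {M : C2n n →L[ℂ] C2n n} (hM : M ∈ SpC n) {v w : C4n n}
    (hv : v ∈ Gr M) (hw : w ∈ Gr M) :
    inner ℂ (projYU n w) (projB n v) = inner ℂ (projB n w) (projYU n v) := by
  have h := hM v.fst w.fst
  rw [← mem_Gr.1 hv, ← mem_Gr.1 hw] at h
  change inner ℂ w.snd.fst (-v.snd.snd) + inner ℂ w.snd.snd v.snd.fst
    = inner ℂ w.fst.fst (-v.fst.snd) + inner ℂ w.fst.snd v.fst.fst at h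
  rw [inner_neg_right, inner_neg_right] at h
  change inner ℂ w.fst.snd v.fst.fst + inner ℂ w.snd.snd (-v.snd.fst)
    = inner ℂ w.fst.fst v.fst.snd + inner ℂ (-w.snd.fst) v.snd.snd
  rw [inner_neg_right, inner_neg_left]
  linear_combination -h

/-- The squared norms of a ± ib differ only through Re(i⟪a, b⟫), and ⟪a, b⟫ is real because the
symplectic form vanishes on the graph. -/
lemma norm_projSub_of_mem_Gr {M : C2n n →L[ℂ] C2n n} (hM : M ∈ SpC n) {v : C4n n}
    (hv : v ∈ Gr M) : ‖projSub n v‖ = ‖projAdd n v‖ := by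
  have h := inner_projYU_projB_of_mem_Gr hM hv hv
  have h1 : ‖projSub n v‖ ^ 2 = ‖projAdd n v‖ ^ 2 := by
    rw [projSub_apply, projAdd_apply, @norm_sub_sq ℂ, @norm_add_sq ℂ, inner_smul_right]
    have h2 : (inner ℂ (projYU n v) (projB n v)).im = 0 := by
      rw [← inner_conj_symm (projB n v)] at h
      have := congrArg Complex.im h
      rw [Complex.conj_im] at this
      linarith
    have h3 : RCLike.re (Complex.I * inner ℂ (projYU n v) (projB n v)) = 0 := by
      change (Complex.I * inner ℂ (projYU n v) (projB n v)).re = 0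
      rw [Complex.mul_re, h2]
      simp
    rw [h3]
    ring
  exact (sq_eq_sq₀ (norm_nonneg _) (norm_nonneg _)).1 h1

/-- The unitary operators of the graphs of a continuous curve of symplectic operators. -/
lemma exists_isCayley_path {T : ℝ} {γ : ℝ → (C2n n →L[ℂ] C2n n)}
    (hcont : ContinuousOn γ (Set.Icc 0 T)) (hSp : ∀ t ∈ Set.Icc 0 T, γ t ∈ SpC n) :
    ∃ u : ℝ → (C2n n ≃ₗᵢ[ℂ] C2n n), (∀ t ∈ Set.Icc 0 T, IsCayley (Gr (γ t)) (u t)) ∧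
      ContinuousOn (fun t => ((u t).toContinuousLinearEquiv : C2n n →L[ℂ] C2n n))
        (Set.Icc 0 T) := by
  obtain ⟨u, hu, hc⟩ := exists_unitary_curve hcont (projAdd n ∘ₗ inFst n) (projAdd n ∘ₗ inSnd n)
    (projSub n ∘ₗ inFst n) (projSub n ∘ₗ inSnd n)
    (fun t ht w => by
      simp only [LinearMap.comp_apply, ← map_add]
      exact norm_projSub_of_mem_Gr (hSp t ht) (inFst_add_inSnd_mem_Gr (γ t) w))
    (fun t ht w hw => by
      simp only [LinearMap.comp_apply, ← map_add] at hw
      -- If a + ib = 0 then a - ib = 0 too, by equality of norms, and the two determine the vector.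
      have h1 := norm_projSub_of_mem_Gr (hSp t ht) (inFst_add_inSnd_mem_Gr (γ t) w)
      rw [hw, norm_zero, norm_eq_zero] at h1
      have h2 : inFst n w + inSnd n (γ t w) = 0 :=
        ext_addSub (by rw [hw, map_zero]) (by rw [h1, map_zero])
      rw [← fst_inFst_add_inSnd w (γ t w), h2]
      rfl)
  refine ⟨u, fun t ht v => ?_, hc⟩
  have hu1 := (hu t ht).1
  have hu2 := (hu t ht).2
  simp only [LinearMap.comp_apply, ← map_add] at hu1 hu2
  constructor
  · intro hv
    rw [mem_Gr_iff.1 hv, hu1]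
  · intro h
    obtain ⟨w, hw⟩ := hu2 (projAdd n v)
    rw [← hw, hu1] at h
    rw [ext_addSub hw.symm h]
    exact inFst_add_inSnd_mem_Gr (γ t) w

/-- The Maslov-type index is minus the spectral flow of the operators of the graphs composed with
the reflection in the subspace. -/
lemma isMaslovTypeIndex_iff {T : ℝ} {γ : ℝ → (C2n n →L[ℂ] C2n n)}
    {u : ℝ → (C2n n ≃ₗᵢ[ℂ] C2n n)} (hu : ∀ t ∈ Set.Icc 0 T, IsCayley (Gr (γ t)) (u t))
    (R : Submodule ℂ (C2n n)) (m : ℤ) :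
    IsMaslovTypeIndex (WR R) T γ m
      ↔ IsSpectralFlow (fun t => (u t).trans R.reflection) 0 T (-m) := by
  -- The isometries onto ker(J ∓ i) turn U'⁻¹U into ρ_R⁻¹w up to conjugation, and ρ_R is an
  -- involution.
  have key : ∀ U U' : posEig (dblJ n) ≃ₗᵢ[ℂ] negEig (dblJ n), ∀ w : C2n n ≃ₗᵢ[ℂ] C2n n,
      (posIso n).trans (U.trans (negIso n).symm) = w →
      (posIso n).trans (U'.trans (negIso n).symm) = R.reflection →
      w.trans R.reflection = (posIso n).trans ((U.trans U'.symm).trans (posIso n).symm) := by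
    intro U U' w hw hU'
    ext1 p
    have h1 : R.reflection.symm = R.reflection := Submodule.reflection_symm
    rw [← h1, ← hU', ← hw]
    simp
  constructor
  · rintro ⟨U, U', hU, hU', hSF⟩
    refine IsSpectralFlow.conj (posIso n).symm (fun t ht => ?_) hSF
    have e1 := isCayley_isometryGraph (U t)
    rw [← hU t ht] at e1
    have e2 := isCayley_isometryGraph (U' t)
    rw [← hU' t ht] at e2
    exact key _ _ _ (e1.unique (hu t ht)) (e2.unique (isCayley_WR R))
  · intro h
    have hback : ∀ w : C2n n ≃ₗᵢ[ℂ] C2n n,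
        (posIso n).trans (((posIso n).symm.trans (w.trans (negIso n))).trans (negIso n).symm) = w := by
      intro w
      ext1 p
      simp
    refine ⟨fun t => (posIso n).symm.trans ((u t).trans (negIso n)),
      fun t => (posIso n).symm.trans (R.reflection.trans (negIso n)), fun t ht => ?_, fun t ht => ?_,
      IsSpectralFlow.conj (posIso n) (fun t ht => ?_) h⟩
    · have e1 := isCayley_isometryGraph ((posIso n).symm.trans ((u t).trans (negIso n)))
      rw [hback] at e1
      exact (hu t ht).eq e1
    · have e1 := isCayley_isometryGraph ((posIso n).symm.trans (R.reflection.trans (negIso n)))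
      rw [hback] at e1
      exact (isCayley_WR R).eq e1
    · simp only [key _ _ _ (hback (u t)) (hback R.reflection)]
      ext1 p
      simp

lemma exists_isMaslovTypeIndex {T : ℝ} (hT : 0 < T) {γ : ℝ → (C2n n →L[ℂ] C2n n)}
    {u : ℝ → (C2n n ≃ₗᵢ[ℂ] C2n n)} (hu : ∀ t ∈ Set.Icc 0 T, IsCayley (Gr (γ t)) (u t))
    (hc : ContinuousOn (fun t => ((u t).toContinuousLinearEquiv : C2n n →L[ℂ] C2n n))
        (Set.Icc 0 T)) (R : Submodule ℂ (C2n n)) :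
    ∃! m : ℤ, IsMaslovTypeIndex (WR R) T γ m := by
  have hc' := continuousOn_trans R.reflection hc
  obtain ⟨m, hm⟩ := exists_isSpectralFlow hT.le hc'
  refine ⟨-m, (isMaslovTypeIndex_iff hu R _).2 (by rwa [neg_neg]), fun m' hm' => ?_⟩
  have := (isMaslovTypeIndex_iff hu R _).1 hm'
  rw [← this.unique hT hm, neg_neg]

end Graph

/-! ### Nested subspaces, reflections and dimension formulas -/

section Subspaces

open Module

variable {H : Type*} [NormedAddCommGroup H] [InnerProductSpace ℂ H] [FiniteDimensional ℂ H]

lemma starProjection_sub_mem {R₁ R₂ : Submodule ℂ H} (hR : R₁ ≤ R₂) {x : H} (hx : x ∈ R₂) :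
    x - R₁.starProjection x ∈ R₂ ⊓ R₁ᗮ :=
  ⟨R₂.sub_mem hx (hR (Submodule.starProjection_apply_mem R₁ x)),
    Submodule.sub_starProjection_mem_orthogonal x⟩

lemma orthogonal_inf_orthogonal_eq {R₁ R₂ : Submodule ℂ H} (hR : R₁ ≤ R₂) {x : H} :
    x ∈ R₂ᗮ ↔ x ∈ R₁ᗮ ∧ x ∈ (R₂ ⊓ R₁ᗮ)ᗮ := by
  constructor
  · exact fun hx => ⟨Submodule.orthogonal_le hR hx, Submodule.orthogonal_le inf_le_left hx⟩
  · rintro ⟨h1, h2⟩ y hy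
    have h3 := h1 _ (Submodule.starProjection_apply_mem R₁ y)
    have h4 := h2 _ (starProjection_sub_mem hR hy)
    rw [inner_sub_left, h3, sub_zero] at h4
    exact h4

lemma starProjection_add_starProjection {R₁ R₂ : Submodule ℂ H} (hR : R₁ ≤ R₂) (x : H) :
    R₂.starProjection x = R₁.starProjection x + (R₂ ⊓ R₁ᗮ).starProjection x := by
  have hD := Submodule.starProjection_apply_mem (R₂ ⊓ R₁ᗮ) x
  have h1 := Submodule.starProjection_apply_mem R₁ x
  refine (Submodule.eq_starProjection_of_mem_orthogonal (R₂.add_mem (hR h1) hD.1) ?_)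
  rw [orthogonal_inf_orthogonal_eq hR]
  constructor
  · rw [← sub_sub]
    exact R₁ᗮ.sub_mem (Submodule.sub_starProjection_mem_orthogonal x) hD.2
  · rw [add_comm, ← sub_sub]
    refine (R₂ ⊓ R₁ᗮ)ᗮ.sub_mem (Submodule.sub_starProjection_mem_orthogonal x) ?_
    exact fun y hy => Submodule.inner_left_of_mem_orthogonal h1 hy.2

/-- The reflection in the larger subspace differs by the reflection in the orthogonal complement of
the relative complement. -/
lemma reflection_eq_trans {R₁ R₂ : Submodule ℂ H} (hR : R₁ ≤ R₂) :
    R₂.reflection = R₁.reflection.trans (R₂ ⊓ R₁ᗮ)ᗮ.reflection := by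
  ext1 x
  rw [LinearIsometryEquiv.trans_apply, Submodule.reflection_orthogonal_apply,
    Submodule.reflection_apply, Submodule.reflection_apply, Submodule.reflection_apply,
    starProjection_add_starProjection hR, map_sub, map_nsmul]
  have h1 : (R₂ ⊓ R₁ᗮ).starProjection (R₁.starProjection x) = 0 := by
    rw [Submodule.starProjection_apply_eq_zero_iff]
    exact fun y hy => Submodule.inner_left_of_mem_orthogonal
      (Submodule.starProjection_apply_mem R₁ x) hy.2
  rw [h1]
  module

lemma trans_reflection_eq {R₁ R₂ : Submodule ℂ H} (hR : R₁ ≤ R₂) (A : H ≃ₗᵢ[ℂ] H) :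
    A.trans R₂.reflection = (A.trans R₁.reflection).trans (R₂ ⊓ R₁ᗮ)ᗮ.reflection := by
  rw [reflection_eq_trans hR]
  rfl

/-- D ∩ F^⊥ is the orthogonal complement of D^⊥ + F, whose dimension involves F ∩ D^⊥. -/
lemma finrank_inf_orthogonal_add (D F : Submodule ℂ H) :
    finrank ℂ (D ⊓ Fᗮ : Submodule ℂ H) + finrank ℂ F
      = finrank ℂ D + finrank ℂ (F ⊓ Dᗮ : Submodule ℂ H) := by
  have h1 : D ⊓ Fᗮ = (Dᗮ ⊔ F)ᗮ := by
    rw [← Submodule.inf_orthogonal, Submodule.orthogonal_orthogonal]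
  have h2 := Submodule.finrank_add_finrank_orthogonal (Dᗮ ⊔ F)
  have h3 := Submodule.finrank_add_finrank_orthogonal D
  have h4 := Submodule.finrank_sup_add_finrank_inf_eq Dᗮ F
  rw [h1, inf_comm F]
  omega

/-- A vector of `D` which is orthogonal to all displacements in `D` is the projection of a fixed
vector. -/
lemma exists_fixed_of_orthogonal (A : H ≃ₗᵢ[ℂ] H) (D : Submodule ℂ H) {c : H} (hc : c ∈ D)
    (h : ∀ x ∈ moveSub A D, inner ℂ (A x - x) c = 0) :
    ∃ k ∈ fixedSub A, D.starProjection k = c := by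
  obtain ⟨b, α, hbα⟩ := exists_orthonormalBasis_eigenvectors A
  obtain ⟨G, hG⟩ := exists_inverse_sub_id fun k => (hbα k).1
  -- The displacements in D fill D ∩ F^⊥, F being the fixed vectors; so c lies in (D ∩ F^⊥)^⊥ = D^⊥
  -- + F, and projecting to D leaves the contribution of F.
  have hc' : c ∈ (D ⊓ (fixedSub A)ᗮ)ᗮ := by
    intro x hx
    have hGx : A (G x) - G x = x := hG x fun k hk => hx.2 _ (by
      rw [mem_fixedSub, (hbα k).1, hk, one_smul])
    rw [← hGx]
    exact h _ (by rw [mem_moveSub, hGx]; exact hx.1)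
  have h1 : D ⊓ (fixedSub A)ᗮ = (Dᗮ ⊔ fixedSub A)ᗮ := by
    rw [← Submodule.inf_orthogonal, Submodule.orthogonal_orthogonal]
  rw [h1, Submodule.orthogonal_orthogonal] at hc'
  obtain ⟨d, hd, k, hk, rfl⟩ := Submodule.mem_sup.1 hc'
  refine ⟨k, hk, ?_⟩
  have h2 := Submodule.starProjection_eq_self_iff.2 hc
  rw [map_add, (Submodule.starProjection_apply_eq_zero_iff D).2 hd, zero_add] at h2
  exact h2

end Subspaces

/-! ### The form Q and the Morse concavity -/

section Concavity

open Module

variable {n : ℕ} {M : C2n n →L[ℂ] C2n n} {u : C2n n ≃ₗᵢ[ℂ] C2n n} {R₁ R₂ : Submodule ℂ (C2n n)}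

lemma mem_spaceN {v : C4n n} :
    v ∈ spaceN M R₁ R₂ ↔ v ∈ Gr M ∧ projB n v ∈ R₁ᗮ ∧ projYU n v ∈ R₂ := and_assoc

lemma formQN_apply (v w : spaceN M R₁ R₂) :
    formQN M R₁ R₂ v w = -inner ℂ (projYU n w) (projB n v) := by
  change inner ℂ (w : C4n n).snd.snd (v : C4n n).snd.fst
      - inner ℂ (w : C4n n).fst.snd (v : C4n n).fst.fst
    = -(inner ℂ (w : C4n n).fst.snd (v : C4n n).fst.fst
      + inner ℂ (w : C4n n).snd.snd (-(v : C4n n).snd.fst))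
  rw [inner_neg_right]
  ring

/-- Hermitian symmetry of Q is the vanishing of the symplectic form on Gr(M). -/
lemma formQN_hermitian (hM : M ∈ SpC n) (v w : spaceN M R₁ R₂) :
    formQN M R₁ R₂ w v = (starRingEnd ℂ) (formQN M R₁ R₂ v w) := by
  rw [formQN_apply, formQN_apply, map_neg, inner_conj_symm,
    inner_projYU_projB_of_mem_Gr hM (mem_spaceN.1 w.2).1 (mem_spaceN.1 v.2).1]

/-- The displacement of `a + i b` for a point of the Lagrangian subspace. -/
lemma IsCayley.displacement (hu : IsCayley (Gr M) u) (R : Submodule ℂ (C2n n)) {v : C4n n}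
    (hv : v ∈ Gr M) :
    (u.trans R.reflection) (projAdd n v) - projAdd n v
      = (-2 : ℂ) • ((projYU n v - R.starProjection (projYU n v))
        + Complex.I • R.starProjection (projB n v)) := by
  rw [LinearIsometryEquiv.trans_apply, ← (hu v).1 hv, projSub_apply, projAdd_apply, map_sub,
    map_smul, Submodule.reflection_apply, Submodule.reflection_apply]
  module

lemma projAdd_injOn (hu : IsCayley (Gr M) u) {v : C4n n} (hv : v ∈ Gr M)
    (h0 : projAdd n v = 0) : v = 0 := by
  refine ext_addSub (by rw [h0, map_zero]) ?_
  rw [(hu v).1 hv, h0, map_zero, map_zero]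

lemma exists_projAdd_eq (hu : IsCayley (Gr M) u) (h : C2n n) : ∃ v ∈ Gr M, projAdd n v = h := by
  obtain ⟨v, h1, h2⟩ := exists_projAdd_projSub h (u h)
  exact ⟨v, (hu v).2 (by rw [h1, h2]), h1⟩

/-- The displacement is -2((a - Pa) + iPb), with P the projection to R₁. It is orthogonal to R₁
exactly when Pb = 0, and then lies in R₂ exactly when a does, since Pa ∈ R₁ ⊆ R₂. -/
lemma projAdd_mem_moveSub_iff (hu : IsCayley (Gr M) u) (hR : R₁ ≤ R₂) {v : C4n n} (hv : v ∈ Gr M) :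
    projAdd n v ∈ moveSub (u.trans R₁.reflection) (R₂ ⊓ R₁ᗮ) ↔ v ∈ spaceN M R₁ R₂ := by
  rw [mem_moveSub, hu.displacement R₁ hv, Submodule.smul_mem_iff _ (by norm_num), mem_spaceN]
  set a := projYU n v
  set b := projB n v
  have hPa := Submodule.starProjection_apply_mem R₁ a
  have hPb := Submodule.starProjection_apply_mem R₁ b
  have hQa := Submodule.sub_starProjection_mem_orthogonal (K := R₁) a
  constructor
  · rintro ⟨h1, h2⟩
    have h3 : Complex.I • R₁.starProjection b ∈ R₁ᗮ := by
      have := R₁ᗮ.sub_mem h2 hQa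
      rwa [add_sub_cancel_left] at this
    have h4 : R₁.starProjection b = 0 := by
      have h5 : R₁.starProjection b ∈ R₁ ⊓ R₁ᗮ :=
        ⟨hPb, (Submodule.smul_mem_iff _ Complex.I_ne_zero).1 h3⟩
      rwa [Submodule.inf_orthogonal_eq_bot, Submodule.mem_bot] at h5
    rw [h4, smul_zero, add_zero] at h1
    refine ⟨hv, (Submodule.starProjection_apply_eq_zero_iff R₁).1 h4, ?_⟩
    have := R₂.add_mem h1 (hR hPa)
    rwa [sub_add_cancel] at this
  · rintro ⟨-, hb, ha⟩
    rw [(Submodule.starProjection_apply_eq_zero_iff R₁).2 hb, smul_zero, add_zero]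
    exact starProjection_sub_mem hR ha

/-- On the graph u(a + ib) = a - ib; as ρ is an involution, fixing a + ib means a - ib = ρ(a + ib),
the equation of W(R₁). -/
lemma projAdd_mem_fixedSub_iff (hu : IsCayley (Gr M) u) {v : C4n n} (hv : v ∈ Gr M) :
    projAdd n v ∈ fixedSub (u.trans R₁.reflection) ↔ v ∈ WR R₁ := by
  rw [mem_fixedSub, LinearIsometryEquiv.trans_apply, ← (hu v).1 hv, isCayley_WR R₁ v]
  constructor
  · intro h
    rw [← h, Submodule.reflection_reflection]
  · intro h
    rw [h, Submodule.reflection_reflection]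

lemma map_projAdd_moveSub (hu : IsCayley (Gr M) u) (hR : R₁ ≤ R₂) :
    (spaceN M R₁ R₂).map (projAdd n) = moveSub (u.trans R₁.reflection) (R₂ ⊓ R₁ᗮ) := by
  ext h
  constructor
  · rintro ⟨v, hv, rfl⟩
    exact (projAdd_mem_moveSub_iff hu hR (mem_spaceN.1 hv).1).2 hv
  · intro hh
    obtain ⟨v, hv, rfl⟩ := exists_projAdd_eq hu h
    exact ⟨v, (projAdd_mem_moveSub_iff hu hR hv).1 hh, rfl⟩

lemma finrank_map_projAdd (hu : IsCayley (Gr M) u) {S : Submodule ℂ (C4n n)} (hS : S ≤ Gr M) :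
    finrank ℂ (S.map (projAdd n)) = finrank ℂ S :=
  finrank_map_of_disjoint_ker fun _ hv h0 => projAdd_injOn hu (hS hv) h0

lemma finrank_fixedSub (hu : IsCayley (Gr M) u) (R : Submodule ℂ (C2n n)) :
    finrank ℂ (fixedSub (u.trans R.reflection)) = finrank ℂ (Gr M ⊓ WR R : Submodule ℂ (C4n n)) := by
  have hmap : fixedSub (u.trans R.reflection) = (Gr M ⊓ WR R).map (projAdd n) := by
    ext h
    constructor
    · intro hh
      obtain ⟨v, hv, rfl⟩ := exists_projAdd_eq hu h
      exact ⟨v, ⟨hv, (projAdd_mem_fixedSub_iff hu hv).1 hh⟩, rfl⟩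
    · rintro ⟨v, hv, rfl⟩
      exact (projAdd_mem_fixedSub_iff hu hv.1).2 hv.2
  rw [hmap, finrank_map_projAdd hu inf_le_left]

/-- Here a ∈ R₁ is orthogonal to R₂ ∩ R₁^⊥ anyway, so only b is constrained: from R₁^⊥ it is pushed
into R₂^⊥. -/
lemma projAdd_mem_orthogonal_iff (hR : R₁ ≤ R₂) {v : C4n n} (hv : v ∈ WR R₁) :
    projAdd n v ∈ (R₂ ⊓ R₁ᗮ)ᗮ ↔ v ∈ WR R₂ := by
  obtain ⟨hb, ha⟩ := mem_WR.1 hv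
  have ha' : projYU n v ∈ (R₂ ⊓ R₁ᗮ)ᗮ := fun y hy => Submodule.inner_left_of_mem_orthogonal ha hy.2
  rw [projAdd_apply, Submodule.add_mem_iff_right _ ha', Submodule.smul_mem_iff _ Complex.I_ne_zero,
    mem_WR, orthogonal_inf_orthogonal_eq hR]
  exact ⟨fun h => ⟨⟨hb, h⟩, hR ha⟩, fun h => h.1.2⟩

lemma finrank_fixedSub_inf_orthogonal (hu : IsCayley (Gr M) u) (hR : R₁ ≤ R₂) :
    finrank ℂ (fixedSub (u.trans R₁.reflection) ⊓ (R₂ ⊓ R₁ᗮ)ᗮ : Submodule ℂ (C2n n))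
      = finrank ℂ ((Gr M ⊓ WR R₁) ⊓ (Gr M ⊓ WR R₂) : Submodule ℂ (C4n n)) := by
  have hmap : fixedSub (u.trans R₁.reflection) ⊓ (R₂ ⊓ R₁ᗮ)ᗮ
      = ((Gr M ⊓ WR R₁) ⊓ (Gr M ⊓ WR R₂)).map (projAdd n) := by
    ext h
    constructor
    · rintro ⟨hh, ho⟩
      obtain ⟨v, hv, rfl⟩ := exists_projAdd_eq hu h
      have h1 := (projAdd_mem_fixedSub_iff hu hv).1 hh
      exact ⟨v, ⟨⟨hv, h1⟩, ⟨hv, (projAdd_mem_orthogonal_iff hR h1).1 ho⟩⟩, rfl⟩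
    · rintro ⟨v, ⟨⟨hv, h1⟩, ⟨-, h2⟩⟩, rfl⟩
      exact ⟨(projAdd_mem_fixedSub_iff hu hv).2 h1, (projAdd_mem_orthogonal_iff hR h1).2 h2⟩
  rw [hmap, finrank_map_projAdd hu (inf_le_left.trans inf_le_left)]

/-- Both intersections are in the kernel by orthogonality, the first after using the Hermitian
symmetry. Conversely, for v in the kernel the projection of b to D is orthogonal to all
displacements in D, hence comes from a fixed vector, that is, from some k in Gr(M) ∩ W(R₁). -/
lemma map_ker_formQN (hM : M ∈ SpC n) (hu : IsCayley (Gr M) u) (hR : R₁ ≤ R₂) :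
    (LinearMap.ker (formQN M R₁ R₂)).map (spaceN M R₁ R₂).subtype
      = (Gr M ⊓ WR R₁) ⊔ (Gr M ⊓ WR R₂) := by
  apply le_antisymm
  · rintro _ ⟨v, hv, rfl⟩
    have hv' : ∀ w : spaceN M R₁ R₂, inner ℂ (projYU n w) (projB n v) = 0 := by
      intro w
      have h1 : formQN M R₁ R₂ v w = 0 := by
        rw [LinearMap.mem_ker.1 hv]; rfl
      rwa [formQN_apply, neg_eq_zero] at h1
    obtain ⟨hvG, hvb, hva⟩ := mem_spaceN.1 v.2
    set D := R₂ ⊓ R₁ᗮ with hD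
    obtain ⟨h, hh, hhb⟩ := exists_fixed_of_orthogonal (u.trans R₁.reflection) D
      (Submodule.starProjection_apply_mem D (projB n v)) (by
        intro x hx
        obtain ⟨w, hw, rfl⟩ := exists_projAdd_eq hu x
        have hwN := (projAdd_mem_moveSub_iff hu hR hw).1 hx
        obtain ⟨-, hwb, hwa⟩ := mem_spaceN.1 hwN
        have h1 := hx
        rw [mem_moveSub] at h1
        have h2 : inner ℂ ((u.trans R₁.reflection) (projAdd n w) - projAdd n w)
            (D.starProjection (projB n v))
            = inner ℂ ((u.trans R₁.reflection) (projAdd n w) - projAdd n w) (projB n v) := by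
          have h3 := Submodule.sub_starProjection_mem_orthogonal (K := D) (projB n v) _ h1
          rw [inner_sub_right, sub_eq_zero] at h3
          exact h3.symm
        rw [h2, hu.displacement R₁ hw, (Submodule.starProjection_apply_eq_zero_iff R₁).2 hwb,
          smul_zero, add_zero, inner_smul_left, inner_sub_left, hv' ⟨w, hwN⟩,
          hvb _ (Submodule.starProjection_apply_mem R₁ _), sub_zero, mul_zero])
    obtain ⟨k, hk, rfl⟩ := exists_projAdd_eq hu h
    have hkW := (projAdd_mem_fixedSub_iff hu hk).1 hh
    obtain ⟨hkb, hka⟩ := mem_WR.1 hkW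
    have h4 : D.starProjection (projYU n k) = 0 := by
      rw [Submodule.starProjection_apply_eq_zero_iff]
      exact fun y hy => Submodule.inner_left_of_mem_orthogonal hka hy.2
    rw [projAdd_apply, map_add, h4, zero_add, ← map_smul] at hhb
    -- The component of k in R₁ is invisible in D, so the projections to D of b(v) and i·b(k) agree.
    -- Subtracting ik removes the part of b in D and leaves a vector of W(R₂).
    refine Submodule.mem_sup.2 ⟨Complex.I • k, Submodule.smul_mem _ _ ⟨hk, hkW⟩,
      (v : C4n n) - Complex.I • k, ⟨(Gr M).sub_mem hvG ((Gr M).smul_mem _ hk), ?_⟩, by simp⟩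
    rw [SetLike.mem_coe, mem_WR, map_sub, map_sub, map_smul, map_smul]
    refine ⟨(orthogonal_inf_orthogonal_eq hR).2 ⟨R₁ᗮ.sub_mem hvb (R₁ᗮ.smul_mem _ hkb), ?_⟩,
      R₂.sub_mem hva (R₂.smul_mem _ (hR hka))⟩
    rw [← hD, ← Submodule.starProjection_apply_eq_zero_iff, map_sub, ← map_smul, hhb, sub_self]
  · apply sup_le
    · rintro v ⟨hv, hvW⟩
      obtain ⟨hb, ha⟩ := mem_WR.1 hvW
      have hvN : v ∈ spaceN M R₁ R₂ := mem_spaceN.2 ⟨hv, hb, hR ha⟩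
      refine ⟨⟨v, hvN⟩, LinearMap.mem_ker.2 (LinearMap.ext fun w => ?_), rfl⟩
      obtain ⟨hwG, hwb, -⟩ := mem_spaceN.1 w.2
      rw [formQN_apply, inner_projYU_projB_of_mem_Gr hM hv hwG,
        Submodule.inner_left_of_mem_orthogonal ha hwb, neg_zero]
      rfl
    · rintro v ⟨hv, hvW⟩
      obtain ⟨hb, ha⟩ := mem_WR.1 hvW
      have hvN : v ∈ spaceN M R₁ R₂ := mem_spaceN.2 ⟨hv, Submodule.orthogonal_le hR hb, ha⟩
      refine ⟨⟨v, hvN⟩, LinearMap.mem_ker.2 (LinearMap.ext fun w => ?_), rfl⟩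
      obtain ⟨-, -, hwa⟩ := mem_spaceN.1 w.2
      rw [formQN_apply, Submodule.inner_right_of_mem_orthogonal hwa hb, neg_zero]
      rfl

/-- On 𝒩 the displacement is -2(a - Pa), because Pb = 0. Pairing it with a + ib, the a-part is real
and the ib-part gives -i⟪a, b⟫ = iQ, with b orthogonal to Pa; the factor -2 remains. -/
lemma im_inner_projAdd (hM : M ∈ SpC n) (hu : IsCayley (Gr M) u) (v : spaceN M R₁ R₂) :
    (inner ℂ (projAdd n v) ((u.trans R₁.reflection) (projAdd n v))).im
      = -2 * (formQN M R₁ R₂ v v).re := by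
  obtain ⟨hv, hb, -⟩ := mem_spaceN.1 v.2
  have h1 := hu.displacement R₁ hv
  rw [(Submodule.starProjection_apply_eq_zero_iff R₁).2 hb, smul_zero, add_zero,
    sub_eq_iff_eq_add] at h1
  have hsym := inner_projYU_projB_of_mem_Gr hM hv hv
  rw [h1, formQN_apply]
  set a := projYU n (v : C4n n)
  set b := projB n (v : C4n n)
  have hself : (inner ℂ (projAdd n (v : C4n n)) (projAdd n (v : C4n n))).im = 0 :=
    inner_self_im (𝕜 := ℂ) (projAdd n (v : C4n n))
  have h2 : inner ℂ b (a - R₁.starProjection a) = inner ℂ a b := by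
    rw [inner_sub_right, Submodule.inner_left_of_mem_orthogonal
      (Submodule.starProjection_apply_mem R₁ a) hb, sub_zero, hsym]
  have h3 : (inner ℂ a (a - R₁.starProjection a)).im = 0 := by
    have h4 : inner ℂ a (a - R₁.starProjection a)
        = inner ℂ (a - R₁.starProjection a) (a - R₁.starProjection a) := by
      conv_rhs => rw [inner_sub_left, Submodule.inner_right_of_mem_orthogonal
        (Submodule.starProjection_apply_mem R₁ a)
        (Submodule.sub_starProjection_mem_orthogonal a), sub_zero]
    rw [h4]
    exact inner_self_im (𝕜 := ℂ) (a - R₁.starProjection a)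
  rw [inner_add_right, Complex.add_im, hself, add_zero, inner_smul_right,
    show projAdd n (v : C4n n) = a + Complex.I • b from projAdd_apply _,
    inner_add_left, inner_smul_left, h2, Complex.conj_I]
  simp only [Complex.mul_im, Complex.add_im, Complex.add_re, Complex.mul_re, Complex.neg_re,
    Complex.neg_im, Complex.I_re, Complex.I_im, h3, Complex.re_ofNat, Complex.im_ofNat]
  ring

/-- The change of the sum of the arguments between two reflections is given by the Morse
concavity. -/
theorem angleSum_sub_eq_morseConcavity (hM : M ∈ SpC n) (hu : IsCayley (Gr M) u) (hR : R₁ ≤ R₂) :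
    angleSum (((u.trans R₁.reflection).trans (R₂ ⊓ R₁ᗮ)ᗮ.reflection).toLinearEquiv :
        C2n n →ₗ[ℂ] C2n n) - angleSum ((u.trans R₁.reflection).toLinearEquiv : C2n n →ₗ[ℂ] C2n n)
      = Real.pi * (2 * morseConcavity M R₁ R₂
        - finrank ℂ (R₂ ⊓ R₁ᗮ : Submodule ℂ (C2n n))) := by
  obtain ⟨p, ⟨S, hS, hSp, hpos⟩, hmax, hangle⟩ :=
    angleSum_reflection_sub (u.trans R₁.reflection) (R₂ ⊓ R₁ᗮ)
  let κ : spaceN M R₁ R₂ →ₗ[ℂ] C2n n := projAdd n ∘ₗ (spaceN M R₁ R₂).subtype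
  have hκ : ∀ v, κ v = projAdd n v := fun v => rfl
  have hκ0 : ∀ v, κ v = 0 → v = 0 := fun v hv =>
    Subtype.ext (projAdd_injOn hu (mem_spaceN.1 v.2).1 hv)
  have hrange : LinearMap.range κ = moveSub (u.trans R₁.reflection) (R₂ ⊓ R₁ᗮ) := by
    rw [LinearMap.range_comp, Submodule.range_subtype, map_projAdd_moveSub hu hR]
  -- κ carries 𝒩 isomorphically to the displaced vectors and exchanges negativity of Q with
  -- positivity of Im⟪h, Ah⟫, so maximal dimensions agree.
  have hmorse : morseIndex (formQN M R₁ R₂) = p := by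
    have hgreat : IsGreatest {d | ∃ S : Submodule ℂ (spaceN M R₁ R₂), finrank ℂ S = d ∧
        ∀ v ∈ S, v ≠ 0 → (formQN M R₁ R₂ v v).re < 0} p := by
      constructor
      · refine ⟨S.comap κ, ?_, fun v hv hv0 => ?_⟩
        · rw [← hSp, ← finrank_map_of_disjoint_ker (f := κ) (S := S.comap κ) fun v _ h => hκ0 v h,
            Submodule.map_comap_eq, hrange, inf_eq_right.2 hS]
        · have h1 := hpos (κ v) hv fun h => hv0 (hκ0 v h)
          rw [hκ, im_inner_projAdd hM hu] at h1
          linarith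
      · rintro d ⟨S', rfl, hS'⟩
        rw [← finrank_map_of_disjoint_ker (f := κ) (S := S') fun v _ h => hκ0 v h]
        refine hmax _ ?_ ?_
        · rw [← hrange]
          exact LinearMap.map_le_range
        · rintro _ ⟨v, hv, rfl⟩ hne
          have h1 := hS' v hv (by rintro rfl; exact hne (map_zero κ))
          rw [hκ, im_inner_projAdd hM hu]
          linarith
    exact hgreat.csSup_eq
  have hker : finrank ℂ (LinearMap.ker (formQN M R₁ R₂))
      = finrank ℂ ((Gr M ⊓ WR R₁) ⊔ (Gr M ⊓ WR R₂) : Submodule ℂ (C4n n)) := by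
    rw [← map_ker_formQN hM hu hR, Submodule.finrank_map_subtype_eq]
  have hdim := Submodule.finrank_sup_add_finrank_inf_eq (Gr M ⊓ WR R₁) (Gr M ⊓ WR R₂)
  have hD := finrank_inf_orthogonal_add (R₂ ⊓ R₁ᗮ) (fixedSub (u.trans R₁.reflection))
  rw [finrank_fixedSub_inf_orthogonal hu hR, finrank_fixedSub hu] at hD
  rw [hangle, morseConcavity, hmorse, hker]
  have hdim' := congrArg (Nat.cast (R := ℝ)) hdim
  have hD' := congrArg (Nat.cast (R := ℝ)) hD
  push_cast at hdim' hD' ⊢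
  -- With F the fixed vectors, dim D - dim(D ∩ F^⊥) = dim F - dim(F ∩ D^⊥). Here F and F ∩ D^⊥ have
  -- the dimensions of Gr ∩ W(R₁) and Gr ∩ W(R₁) ∩ W(R₂), so the difference is dim ker Q - dim(Gr ∩
  -- W(R₂)).
  linear_combination (-(2 * Real.pi)) * hdim' - (2 * Real.pi) * hD'

/-- `𝒩` for the identity splits into its two components. -/
lemma finrank_spaceN_id (R R' : Submodule ℂ (C2n n)) :
    finrank ℂ (spaceN (ContinuousLinearMap.id ℂ (C2n n)) R R')
      = finrank ℂ ↥(Gr (ContinuousLinearMap.id ℂ (Cn n)) ⊓ flatSub R)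
        + finrank ℂ ↥(Gr (ContinuousLinearMap.id ℂ (Cn n)) ⊓ R') := by
  set G := Gr (ContinuousLinearMap.id ℂ (Cn n))
  let f : spaceN (ContinuousLinearMap.id ℂ (C2n n)) R R' →ₗ[ℂ] C2n n × C2n n :=
    (LinearMap.prod (projXZ n) (projYU n)) ∘ₗ (Submodule.subtype _)
  have hf : LinearMap.range f = (G ⊓ flatSub R).prod (G ⊓ R') := by
    ext ⟨p, q⟩
    constructor
    · rintro ⟨⟨v, hv⟩, hvpq⟩
      obtain ⟨⟨h1, h2⟩, h3⟩ := hv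
      have e1 : projXZ n v = p := congrArg Prod.fst hvpq
      have e2 : projYU n v = q := congrArg Prod.snd hvpq
      have h4 : v.snd = v.fst := h1
      refine ⟨⟨?_, e1 ▸ h2⟩, ⟨?_, e2 ▸ h3⟩⟩
      · change p.snd = p.fst
        rw [← e1]
        have h5 := congrArg (fun p : C2n n => p.fst) h4
        exact h5
      · change q.snd = q.fst
        rw [← e2]
        have h5 := congrArg (fun p : C2n n => p.snd) h4
        exact h5
    · rintro ⟨⟨h1, h2⟩, ⟨h3, h4⟩⟩
      have h1' : p.snd = p.fst := h1
      have h3' : q.snd = q.fst := h3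
      let v : C4n n := WithLp.toLp 2 (WithLp.toLp 2 (p.fst, q.fst), WithLp.toLp 2 (p.snd, q.snd))
      have e1 : projXZ n v = p := rfl
      have e2 : projYU n v = q := rfl
      refine ⟨⟨v, ⟨⟨?_, ?_⟩, ?_⟩⟩, rfl⟩
      · change WithLp.toLp 2 (p.snd, q.snd) = WithLp.toLp 2 (p.fst, q.fst)
        rw [h1', h3']
      · exact h2
      · exact h4
  have hinj : Function.Injective f := by
    rintro ⟨v, hv⟩ ⟨w, hw⟩ h
    have e1 : projXZ n v = projXZ n w := congrArg Prod.fst h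
    have e2 : projYU n v = projYU n w := congrArg Prod.snd h
    have e3 := congrArg (fun p : C2n n => p.fst) e1
    have e4 := congrArg (fun p : C2n n => p.snd) e1
    change v.fst.fst = w.fst.fst at e3
    change v.snd.fst = w.snd.fst at e4
    refine Subtype.ext (ext_AB e2 (ext_C2n ?_ ?_))
    · rw [projB_fst, projB_fst, e3]
    · rw [projB_snd, projB_snd, e4]
  rw [← LinearMap.finrank_range_of_inj hinj, hf, ← finrank_prod]
  have hprod := LinearMap.finrank_range_of_inj
    (f := (G ⊓ flatSub R).subtype.prodMap (G ⊓ R').subtype)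
    (Prod.map_injective.2 ⟨Subtype.val_injective, Subtype.val_injective⟩)
  rwa [LinearMap.range_prodMap, Submodule.range_subtype, Submodule.range_subtype] at hprod

/-- On the graph of the identity z = x and u = y, so Q = 0 and its kernel is 𝒩. The summand Gr(Iₙ) ∩
R₂ of 𝒩 also occurs in Gr ∩ W(R₂) and cancels. -/
lemma morseConcavity_id (R₁ R₂ : Submodule ℂ (C2n n)) :
    morseConcavity (ContinuousLinearMap.id ℂ (C2n n)) R₁ R₂
      = (finrank ℂ ↥(Gr (ContinuousLinearMap.id ℂ (Cn n)) ⊓ flatSub R₁) : ℤ)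
        - (finrank ℂ ↥(Gr (ContinuousLinearMap.id ℂ (Cn n)) ⊓ flatSub R₂) : ℤ) := by
  have hQ : formQN (ContinuousLinearMap.id ℂ (C2n n)) R₁ R₂ = 0 := by
    refine LinearMap.ext fun v => LinearMap.ext fun w => ?_
    have hv : (v : C4n n).snd = (v : C4n n).fst := (mem_spaceN.1 v.2).1
    have hw : (w : C4n n).snd = (w : C4n n).fst := (mem_spaceN.1 w.2).1
    change inner ℂ (w : C4n n).snd.snd (v : C4n n).snd.fst
      - inner ℂ (w : C4n n).fst.snd (v : C4n n).fst.fst = 0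
    rw [hv, hw, sub_self]
  have hmorse : morseIndex (formQN (ContinuousLinearMap.id ℂ (C2n n)) R₁ R₂) = 0 := by
    have : IsGreatest {d | ∃ S : Submodule ℂ (spaceN (ContinuousLinearMap.id ℂ (C2n n)) R₁ R₂),
        finrank ℂ S = d ∧
        ∀ v ∈ S, v ≠ 0 → (formQN (ContinuousLinearMap.id ℂ (C2n n)) R₁ R₂ v v).re < 0} 0 := by
      constructor
      · exact ⟨⊥, finrank_bot ℂ _, fun v hv h0 => absurd ((Submodule.mem_bot ℂ).1 hv) h0⟩
      · rintro d ⟨S, rfl, hS⟩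
        have hbot : S = ⊥ := by
          rw [eq_bot_iff]
          intro v hv
          by_contra hne
          have := hS v hv fun h => hne ((Submodule.mem_bot ℂ).2 h)
          rw [hQ] at this
          exact lt_irrefl _ this
        rw [hbot, finrank_bot]
    exact this.csSup_eq
  have hW : Gr (ContinuousLinearMap.id ℂ (C2n n)) ⊓ WR R₂
      = spaceN (ContinuousLinearMap.id ℂ (C2n n)) R₂ R₂ := by
    rw [WR, spaceN, inf_assoc]
  rw [morseConcavity, hmorse, hQ, LinearMap.ker_zero, finrank_top, hW, finrank_spaceN_id,
    finrank_spaceN_id]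
  push_cast
  ring

lemma maslovTypeIndex_spec {W : Submodule ℂ (C4n n)} {T : ℝ} {γ : ℝ → (C2n n →L[ℂ] C2n n)}
    (h : ∃ m, IsMaslovTypeIndex W T γ m) : IsMaslovTypeIndex W T γ (maslovTypeIndex W T γ) := by
  rw [maslovTypeIndex, dif_pos h]
  exact h.choose_spec

end Concavity

end

theorem proposition4p1 (n : ℕ) (T : ℝ) (hT : 0 < T)
    (γ : ℝ → (C2n n →L[ℂ] C2n n))
    (hcont : ContinuousOn γ (Set.Icc 0 T))
    (hSp : ∀ t ∈ Set.Icc 0 T, γ t ∈ SpC n)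
    (h0 : γ 0 = ContinuousLinearMap.id ℂ (C2n n))
    (R₁ R₂ : Submodule ℂ (C2n n)) (hR : R₁ ≤ R₂) :
    -- `Q` is a quadratic (Hermitian) form on `𝒩`
    (∀ v w : spaceN (γ T) R₁ R₂,
      formQN (γ T) R₁ R₂ w v = (starRingEnd ℂ) (formQN (γ T) R₁ R₂ v w)) ∧
    -- the two Maslov-type indices are well defined
    (∃! m : ℤ, IsMaslovTypeIndex (WR R₁) T γ m) ∧
    (∃! m : ℤ, IsMaslovTypeIndex (WR R₂) T γ m) ∧
    maslovTypeIndex (WR R₂) T γ - maslovTypeIndex (WR R₁) T γ =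
      morseConcavity (γ T) R₁ R₂
        + (Module.finrank ℂ ↥(Gr (ContinuousLinearMap.id ℂ (Cn n)) ⊓ flatSub R₂) : ℤ)
        - (Module.finrank ℂ ↥(Gr (ContinuousLinearMap.id ℂ (Cn n)) ⊓ flatSub R₁) : ℤ) := by
  have hT0 : (0 : ℝ) ∈ Set.Icc 0 T := ⟨le_rfl, hT.le⟩
  have hTT : T ∈ Set.Icc 0 T := ⟨hT.le, le_rfl⟩
  obtain ⟨u, hu, hc⟩ := exists_isCayley_path hcont hSp
  have ex1 := exists_isMaslovTypeIndex hT hu hc R₁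
  have ex2 := exists_isMaslovTypeIndex hT hu hc R₂
  refine ⟨formQN_hermitian (hSp T hTT), ex1, ex2, ?_⟩
  have s1 := (isMaslovTypeIndex_iff hu R₁ _).1 (maslovTypeIndex_spec ex1.exists)
  have s2 := (isMaslovTypeIndex_iff hu R₂ _).1 (maslovTypeIndex_spec ex2.exists)
  have htrans : (fun t => (u t).trans R₂.reflection)
      = fun t => ((u t).trans R₁.reflection).trans (R₂ ⊓ R₁ᗮ)ᗮ.reflection := by
    funext t
    exact trans_reflection_eq hR (u t)
  rw [htrans] at s2
  -- The two spectral flows are those of one curve and of its product with a fixed reflection, so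
  -- only t = T and t = 0 contribute; the term dim(R₂ ∩ R₁^⊥) is the same at both and cancels.
  have key := s1.sub_eq hT s2
  rw [angleSum_sub_eq_morseConcavity (hSp T hTT) (hu T hTT) hR,
    angleSum_sub_eq_morseConcavity (hSp 0 hT0) (hu 0 hT0) hR, h0, morseConcavity_id] at key
  have key2 : (2 * Real.pi) * ((maslovTypeIndex (WR R₂) T γ - maslovTypeIndex (WR R₁) T γ : ℤ) : ℝ)
      = (2 * Real.pi) * ((morseConcavity (γ T) R₁ R₂
        + (Module.finrank ℂ ↥(Gr (ContinuousLinearMap.id ℂ (Cn n)) ⊓ flatSub R₂) : ℤ)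
        - (Module.finrank ℂ ↥(Gr (ContinuousLinearMap.id ℂ (Cn n)) ⊓ flatSub R₁) : ℤ) : ℤ) : ℝ) := by
    push_cast at key ⊢
    linear_combination key
  have key3 := mul_left_cancel₀ (by positivity) key2
  exact_mod_cast key3
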